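/- **Setting.** Let $M\ge 2$ be the number of arms and $\alpha_1,\dots,\alpha_M\in\mathbb R^p$ their (unknown) coefficients; put $\delta_{i,j}=\alpha_i-\alpha_j$, $\bar\delta=\max_{i\ne j}\|\delta_{i,j}\|$ (Euclidean norm). In periods $t=1,\dots,T$ i.i.d. triples $(v_t,z_t,\epsilon_t)\in\mathbb R^p\times\mathbb R^q\times\mathbb R$ are drawn; pulling arm $a_t$ yields the reward $R_t=v_t^\top\alpha_{a_t}+\epsilon_t$. The regret is $\mathsf{Regret}(T)=\sum_{t=1}^T\mathbb E\big[\max_i v_t^\top\alpha_i-v_t^\top\alpha_{a_t}\big]$. Assume, for the common law of the triples: - $q\ge Mp$; $\mathbb E\epsilon_t=0$, $\mathrm{Var}(\epsilon_t)=\sigma^2<\infty$, and $\epsilon_t$ is sub-Gaussian with variance proxy $\varsigma^2$, i.e. $\mathbb E e^{\lambda(\epsilon_t-\mathbb E\epsilon_t)}\le e^{\lambda^2\varsigma^2/2}$ for all $\lambda\in\mathbb R$; $\mathbb E[z_t\epsilon_t]=0$; - $\|z_t\|_\infty\le\bar z$ and $\|v_t\|_\infty\le\bar v$ almost surely, with $\bar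 z,\bar v>0$; - with $v_t^*\in\mathbb R^{Mp}$ the vector with blocks $\mathbf 1(v_t^\top\delta_{i,j}>0\ \forall j\ne i)\,v_t$, $i=1,\dots,M$, the matrix $\Sigma_{vz}^*=\mathbb E[v_t^*z_t^\top]$ has full rank, and $\Sigma_{zz}=\mathbb E[z_tz_t^\top]$ is positive definite; - there is $L>0$ with $\Pr(|v_t^\top\delta_{i,j}|\le c)\le Lc$ for all $c>0$ and $i\ne j$. **Algorithm (IV-Greedy) with phase ends $\mathtt T_1\le\mathtt T_2$.** For matrices $V,Z$ with equally many rows and a vector $R$, let $\mathcal P[Z]=Z(Z^\top Z)^{-1}Z^\top$ and $\mathrm{2SLS}(V,Z,R)=(V^\top\mathcal P[Z]V)^{-1}V^\top\mathcal P[Z]R$ (the inverse of a singular matrix is read as $0$). In periods $1,\dots,\mathtt T_1$ the arms are uniform on $\{1,\dots,M\}$, independent of each other and of all the triples. Then, for each $i$, $\widehat\alpha_{i,\mathtt T_1}$ is the 2SLS estimate from the rows $v_s^\top,z_s^\top,R_s$ of the periods $s\le\mathtt T_1$ with $a_s=i$. In periods $t=\mathtt T_1+1,\dots,\mathtt T_2+1$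 an arm maximizing $v_t^\top\widehat\alpha_{i,\mathtt T_1}$ is pulled. In periods $t\ge\mathtt T_2+2$ an arm maximizing $v_t^\top\widehat\alpha_{i,t-1}$ is pulled, where $(\widehat\alpha_{1,t-1},\dots,\widehat\alpha_{M,t-1})\in\mathbb R^{Mp}$ is the (joint) 2SLS estimate from the rows $\big(\mathbf 1(a_s=1)v_s^\top,\dots,\mathbf 1(a_s=M)v_s^\top\big),z_s^\top,R_s$ of the periods $s=\mathtt T_1+1,\dots,t-1$. Ties are broken by any measurable rule. The phase lengths are $\mathtt T_1=C_1\log T$ and $\mathtt T_2-\mathtt T_1=C_2\log T$, each rounded up to an integer. **Constants.** Let $\phi_{\max},\phi_{\min}$ be the largest and smallest singular values, and $\breve\Sigma_{vz}=\mathbb E[\tilde v\tilde z^\top]$, $\breve\Sigma_{zz}=\mathbb E[\tilde z\tilde z^\top]$, where $\tilde v=(\mathbf 1(a=i)v)_{i\le M}$, $\tilde z=(\mathbf 1(a=i)z)_{i\le M}$ with $(v,z)$ distributed as $(v_t,z_t)$ and $a$ uniform on the arms and independent of $(v,z)$. Put $$\bar\kappa=\frac{2\phi_{\max}(\Sigma_{vz}^*)\phi_{\max}(\Sigma_{zz})}{\phi_{\min}(\Sigma_{vz}^*)^2\phi_{\min}(\Sigma_{zz})},\qquad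 \breve\kappa=\frac{2\phi_{\max}(\breve\Sigma_{vz})\phi_{\max}(\breve\Sigma_{zz})}{\phi_{\min}(\breve\Sigma_{vz})^2\phi_{\min}(\breve\Sigma_{zz})}.$$ **Theorem.** (a) There are thresholds $c_1,c_2>0$, depending only on the law of the triples, the $\alpha_i$ and the constants above, such that for all $C_1\ge c_1$, $C_2\ge c_2$ there is $K$ with $\mathsf{Regret}(T)\le K\log T$ for all $T\ge2$ with $T>\mathtt T_2$, and for every run of the algorithm; that is, $\mathsf{Regret}(T)=\mathcal O(\log T)$. (b) Explicitly, let $0<\eta\le\frac1{10}\min\{\phi_{\min}(\Sigma_{vz}^*),\phi_{\min}(\Sigma_{zz})\}$, $C_{\mathscr A}\ge 2q\bar z\varsigma\bar\kappa$, and $$C_1\ge\max\Big\{\Big(\frac{40M\max\{\sqrt{pq}\,\bar v\bar z,\,q\bar z^2\}}{\min\{\phi_{\min}(\breve\Sigma_{vz}),\phi_{\min}(\breve\Sigma_{zz})\}}\Big)^2,\ 1024M^4p^2q^3\bar v^4\bar z^4\varsigma^2\breve\kappa^2L^2\eta^{-2}\Big\},$$ $$C_2\ge\eta^{-2}\max\big\{6q^2\bar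 z^4,\ 128(M-1)^2pq\bar v^2\bar z^2,\ 256M^2L^2p^2q\bar v^4\bar z^2C_{\mathscr A}^2\big\}.$$ Then for all $T>\mathtt T_2$ $$\mathsf{Regret}(T)\le\big[\sqrt p\,\bar v\bar\delta(C_1+C_2)+16(M-1)Lpq^3\bar v^2\bar z^2\varsigma^2\bar\kappa^2\big]\log T+\sqrt p\,\bar v\bar\delta(M-1)\big[12Mp+(20M+24)q+7\big].$$ -/

import Mathlib

open MeasureTheory ProbabilityTheory Matrix
open scoped NNReal

namespace IVBandit

noncomputable section

/-! ### Singular values -/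

/-- `s` is a singular value of the `k × l` matrix `A`: `s ≥ 0` and `s ^ 2` is an eigenvalue of
`Aᵀ A` if `k ≥ l`, respectively of `A Aᵀ` if `k < l`. -/
def IsSingularValue {k l : Type*} [Fintype k] [Fintype l] [DecidableEq k] [DecidableEq l]
    (A : Matrix k l ℝ) (s : ℝ) : Prop :=
  0 ≤ s ∧
    if Fintype.card l ≤ Fintype.card k then
      Module.End.HasEigenvalue (Matrix.toLin' (Aᵀ * A)) (s ^ 2)
    else
      Module.End.HasEigenvalue (Matrix.toLin' (A * Aᵀ)) (s ^ 2)

/-- The largest singular value. -/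
def phiMax {k l : Type*} [Fintype k] [Fintype l] [DecidableEq k] [DecidableEq l]
    (A : Matrix k l ℝ) : ℝ :=
  sSup {s | IsSingularValue A s}

/-- The smallest singular value. -/
def phiMin {k l : Type*} [Fintype k] [Fintype l] [DecidableEq k] [DecidableEq l]
    (A : Matrix k l ℝ) : ℝ :=
  sInf {s | IsSingularValue A s}

/-- `2 φ_max(A) φ_max(B) / (φ_min(A)² φ_min(B))`. -/
def kappa {k l m n : Type*} [Fintype k] [Fintype l] [DecidableEq k] [DecidableEq l]
    [Fintype m] [Fintype n] [DecidableEq m] [DecidableEq n]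
    (A : Matrix k l ℝ) (B : Matrix m n ℝ) : ℝ :=
  2 * phiMax A * phiMax B / (phiMin A ^ 2 * phiMin B)

/-! ### The model -/

/-- What is drawn in one period: the covariates `v`, the instruments `z` and the noise `ε`. -/
abbrev Obs (p q : ℕ) : Type := (Fin p → ℝ) × (Fin q → ℝ) × ℝ

variable {p q M : ℕ}

/-- The covariate vector `v`. -/
abbrev Obs.v (x : Obs p q) : Fin p → ℝ := x.1

/-- The vector of instruments `z`. -/
abbrev Obs.z (x : Obs p q) : Fin q → ℝ := x.2.1

/-- The noise `ε`. -/
abbrev Obs.ε (x : Obs p q) : ℝ := x.2.2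

/-- The stacked covariates `(1(a = 1) v, …, 1(a = M) v)` when arm `a` is pulled. -/
def stack {r : ℕ} (a : Fin M) (v : Fin r → ℝ) : Fin M × Fin r → ℝ :=
  fun ik => if a = ik.1 then v ik.2 else 0

/-- The stacked covariates under the optimal arm; the block of arm `i` is `v` if arm `i` is
strictly better than all the other arms at `v`, and `0` otherwise. -/
def optStack (α : Fin M → Fin p → ℝ) (v : Fin p → ℝ) : Fin M × Fin p → ℝ :=
  fun ik => if ∀ j, j ≠ ik.1 → 0 < v ⬝ᵥ (α ik.1 - α j) then v ik.2 else 0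

/-- `Σ*_vz = E[v* zᵀ]`. -/
def SigmaVZStar (ν : Measure (Obs p q)) (α : Fin M → Fin p → ℝ) :
    Matrix (Fin M × Fin p) (Fin q) ℝ :=
  Matrix.of fun ik l => ∫ x, optStack α x.v ik * x.z l ∂ν

/-- `Σ_zz = E[z zᵀ]`. -/
def SigmaZZ (ν : Measure (Obs p q)) : Matrix (Fin q) (Fin q) ℝ :=
  Matrix.of fun l m => ∫ x, x.z l * x.z m ∂ν

/-- `E[ṽ z̃ᵀ]` where both `v` and `z` are stacked according to an arm that is uniformly distributed
on the `M` arms and independent of `(v, z)`. -/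
def SigmaVZBreve (M : ℕ) (ν : Measure (Obs p q)) :
    Matrix (Fin M × Fin p) (Fin M × Fin q) ℝ :=
  Matrix.of fun ik jl =>
    (1 / (M : ℝ)) * ∑ a : Fin M, ∫ x, stack a x.v ik * stack a x.z jl ∂ν

/-- `E[z̃ z̃ᵀ]` where `z` is stacked according to an arm that is uniformly distributed on the
`M` arms and independent of `z`. -/
def SigmaZZBreve (M : ℕ) (ν : Measure (Obs p q)) :
    Matrix (Fin M × Fin q) (Fin M × Fin q) ℝ :=
  Matrix.of fun ik jl =>
    (1 / (M : ℝ)) * ∑ a : Fin M, ∫ x, stack a x.z ik * stack a x.z jl ∂ν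

/-- `κ̄`. -/
def kappaBar (ν : Measure (Obs p q)) (α : Fin M → Fin p → ℝ) : ℝ :=
  kappa (SigmaVZStar ν α) (SigmaZZ ν)

/-- `κ̆`. -/
def kappaBreve (M : ℕ) (ν : Measure (Obs p q)) : ℝ :=
  kappa (SigmaVZBreve M ν) (SigmaZZBreve M ν)

/-- `δ̄`, the largest Euclidean distance between the coefficient vectors of two different arms. -/
def deltaBar (α : Fin M → Fin p → ℝ) : ℝ :=
  ⨆ ij : {ij : Fin M × Fin M // ij.1 ≠ ij.2},
    ‖(WithLp.toLp 2 (α ij.1.1 - α ij.1.2) : EuclideanSpace ℝ (Fin p))‖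

/-- The standing assumptions on the common law `ν` of the triples `(v_t, z_t, ε_t)`. The norm of
`Fin p → ℝ` and `Fin q → ℝ` is the maximum norm. -/
structure IVAssumption (ν : Measure (Obs p q)) (α : Fin M → Fin p → ℝ)
    (ς : ℝ≥0) (σ vbar zbar L : ℝ) : Prop where
  enough_instruments : M * p ≤ q
  noise_mean : ∫ x, x.ε ∂ν = 0
  noise_subGaussian : HasSubgaussianMGF (fun x : Obs p q => x.ε - ∫ y, y.ε ∂ν) (ς ^ 2) ν
  noise_variance : variance (fun x : Obs p q => x.ε) ν = σ ^ 2
  valid_instruments : ∀ l, ∫ x, x.z l * x.ε ∂ν = 0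
  vbar_pos : 0 < vbar
  zbar_pos : 0 < zbar
  bounded_v : ∀ᵐ x ∂ν, ‖x.v‖ ≤ vbar
  bounded_z : ∀ᵐ x ∂ν, ‖x.z‖ ≤ zbar
  full_rank : (SigmaVZStar ν α).rank = min (M * p) q
  posDef : (SigmaZZ ν).PosDef
  L_pos : 0 < L
  margin : ∀ c : ℝ, 0 < c → ∀ i j : Fin M, i ≠ j →
    ν.real {x | |x.v ⬝ᵥ (α i - α j)| ≤ c} ≤ L * c

/-- The requirements on the constants `C₁`, `C₂` of the phase lengths, for auxiliary constants
`η` and `C_A`. -/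
structure LargeConstants (ν : Measure (Obs p q)) (α : Fin M → Fin p → ℝ)
    (ς : ℝ≥0) (vbar zbar L η CA C₁ C₂ : ℝ) : Prop where
  eta_pos : 0 < η
  eta_le : η ≤ (1 / 10) * min (phiMin (SigmaVZStar ν α)) (phiMin (SigmaZZ ν))
  le_CA : 2 * q * zbar * ς * kappaBar ν α ≤ CA
  le_C₁ : max
      ((40 * M * max (√(p * q) * vbar * zbar) (q * zbar ^ 2) /
        min (phiMin (SigmaVZBreve M ν)) (phiMin (SigmaZZBreve M ν))) ^ 2)
      (1024 * M ^ 4 * p ^ 2 * q ^ 3 * vbar ^ 4 * zbar ^ 4 * ς ^ 2 * kappaBreve M ν ^ 2 * L ^ 2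
        / η ^ 2) ≤ C₁
  le_C₂ : max (6 * q ^ 2 * zbar ^ 4 / η ^ 2)
      (max (128 * (M - 1) ^ 2 * p * q * vbar ^ 2 * zbar ^ 2 / η ^ 2)
        (256 * M ^ 2 * L ^ 2 * p ^ 2 * q * vbar ^ 4 * zbar ^ 2 * CA ^ 2 / η ^ 2)) ≤ C₂

/-! ### Two-stage least squares -/

/-- `𝒫[Z] = Z (Zᵀ Z)⁻¹ Zᵀ`. -/
def proj {n m : Type*} [Fintype n] [Fintype m] [DecidableEq m] (Z : Matrix n m ℝ) :
    Matrix n n ℝ :=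
  Z * (Zᵀ * Z)⁻¹ * Zᵀ

/-- The two-stage least squares estimator `(Vᵀ 𝒫[Z] V)⁻¹ Vᵀ 𝒫[Z] R`. -/
def twoSLS {n k m : Type*} [Fintype n] [Fintype k] [DecidableEq k] [Fintype m] [DecidableEq m]
    (V : Matrix n k ℝ) (Z : Matrix n m ℝ) (R : n → ℝ) : k → ℝ :=
  ((Vᵀ * proj Z * V)⁻¹ * Vᵀ * proj Z) *ᵥ R

/-- The reward of pulling arm `a` in a period with draw `x`. -/
def reward (α : Fin M → Fin p → ℝ) (x : Obs p q) (a : Fin M) : ℝ :=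
  x.v ⬝ᵥ α a + x.ε

/-- The reward of the oracle policy, which pulls an arm with the largest `vᵀ α_i`. -/
def oracleReward (α : Fin M → Fin p → ℝ) (x : Obs p q) : ℝ :=
  (⨆ i, x.v ⬝ᵥ α i) + x.ε

/-- Arm-specific 2SLS at the end of the first phase: the estimate of `α i` from the periods in
`{1, …, T₁}` in which arm `i` was pulled. Here `d` and `a` are the realized draws and arms. -/
def armEstimate (α : Fin M → Fin p → ℝ) (d : ℕ → Obs p q) (a : ℕ → Fin M) (T₁ : ℕ) (i : Fin M) :
    Fin p → ℝ :=
  twoSLS (n := {s // s ∈ (Finset.Icc 1 T₁).filter fun s => a s = i})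
    (Matrix.of fun s => (d s).v) (Matrix.of fun s => (d s).z) (fun s => reward α (d s) (a s))

/-- Joint 2SLS at the end of period `t`: the estimate of the stacked coefficient vector from the
periods `T₁ + 1, …, t`. Here `d` and `a` are the realized draws and arms. -/
def jointEstimate (α : Fin M → Fin p → ℝ) (d : ℕ → Obs p q) (a : ℕ → Fin M) (T₁ t : ℕ) :
    Fin M → Fin p → ℝ :=
  fun i k => twoSLS (n := {s // s ∈ Finset.Icc (T₁ + 1) t})
    (Matrix.of fun s => stack (a s) (d s).v) (Matrix.of fun s => (d s).z)
    (fun s => reward α (d s) (a s)) (i, k)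

/-- The coefficient estimate that is in use when the arm of period `t + 1` is chosen, `t ≥ T₁`:
the arm-specific estimate of the first phase up to the end `T₂` of the second phase, the joint
estimate afterwards. -/
def estimate (α : Fin M → Fin p → ℝ) (d : ℕ → Obs p q) (a : ℕ → Fin M) (T₁ T₂ t : ℕ) :
    Fin M → Fin p → ℝ :=
  if t ≤ T₂ then armEstimate α d a T₁ else jointEstimate α d a T₁ t

/-! ### Runs of the algorithm and regret -/

/-- `(D, a)` is a run of IV-Greedy over the periods `1, …, T` with phase ends `T₁`, `T₂`:
the draws `D t = (v_t, z_t, ε_t)` are i.i.d. with law `ν`; in the periods `1, …, T₁` the arms are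
uniformly distributed, independent of each other and of the draws; in every later period the arm
maximizes the estimated expected reward (with any rule for breaking ties). -/
structure IsIVGreedyRun {Ω : Type*} [MeasurableSpace Ω] (μ : Measure Ω) (ν : Measure (Obs p q))
    (α : Fin M → Fin p → ℝ) (T₁ T₂ T : ℕ) (D : ℕ → Ω → Obs p q) (a : ℕ → Ω → Fin M) : Prop where
  measurable_draw : ∀ t ∈ Finset.Icc 1 T, Measurable (D t)
  law_draw : ∀ t ∈ Finset.Icc 1 T, μ.map (D t) = ν
  indep_draw : iIndepFun (fun t : Finset.Icc 1 T => D t) μ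
  measurable_arm : ∀ t ∈ Finset.Icc 1 T, Measurable (a t)
  explore_uniform : ∀ t ∈ Finset.Icc 1 T₁, ∀ i, μ.real {ω | a t ω = i} = 1 / M
  explore_indep : iIndepFun (fun t : Finset.Icc 1 T₁ => a t) μ
  explore_indep_draw :
    IndepFun (fun ω (t : Finset.Icc 1 T₁) => a t ω) (fun ω (t : Finset.Icc 1 T) => D t ω) μ
  greedy : ∀ t ∈ Finset.Icc (T₁ + 1) T, ∀ ω, ∀ i : Fin M,
    (D t ω).v ⬝ᵥ estimate α (fun s => D s ω) (fun s => a s ω) T₁ T₂ (t - 1) i ≤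
      (D t ω).v ⬝ᵥ estimate α (fun s => D s ω) (fun s => a s ω) T₁ T₂ (t - 1) (a t ω)

/-- The expected cumulative regret over the periods `1, …, T`. -/
def regret {Ω : Type*} [MeasurableSpace Ω] (μ : Measure Ω) (α : Fin M → Fin p → ℝ) (T : ℕ)
    (D : ℕ → Ω → Obs p q) (a : ℕ → Ω → Fin M) : ℝ :=
  ∑ t ∈ Finset.Icc 1 T, ∫ ω, (oracleReward α (D t ω) - reward α (D t ω) (a t ω)) ∂μ

/-- The end of the first phase, `C₁ log T` rounded up. -/
def phaseOneEnd (C₁ : ℝ) (T : ℕ) : ℕ := ⌈C₁ * Real.log T⌉₊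

/-- The end of the second phase, which has length `C₂ log T` rounded up. -/
def phaseTwoEnd (C₁ C₂ : ℝ) (T : ℕ) : ℕ := ⌈C₁ * Real.log T⌉₊ + ⌈C₂ * Real.log T⌉₊

end

end IVBandit

/-!
The regret of IV-Greedy is logarithmic because the error of the estimate used in period `t` of the
third phase is of order `1 / √t`, while by the margin condition an error of size `c` costs at most
`c` and only with probability of order `c`: the expected loss in period `t` is of order `1 / t`.

*Error of two-stage least squares.* If the responses are `V β + e`, the estimate minus `β` is the
image of `Zᵀ e / n` under a map that depends on `Vᵀ Z / n` and `Zᵀ Z / n` only. If these two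
matrices are entrywise close to population matrices with positive smallest singular values, the map
is bounded by the corresponding `kappa` (`l2norm_twoSLS_sub_le_of_close`). The lower bound is the
coercivity of `A B⁻¹ Aᵀ`, which follows from the Cauchy-Schwarz inequality of the form given by `B`.

*Adaptivity.* From the second phase on the arms depend on the past, so the moments of the stacked
covariates are not averages of i.i.d. terms. But if all the estimates used so far are within a fixed
`x` of the coefficients, an arm pulled is the optimal one unless the draw of that period is a near
tie at scale `2 √p v̄ x`. So these moments differ from averages of i.i.d. terms by at most a
multiple of the frequency of near ties (`jointEstimate_error`), again an average of i.i.d.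
indicators with a small mean. Hence on an event defined through averages of i.i.d. terms only, an
induction on the period shows that all the estimates are within `x`, and that the errors in the
third phase are at most `kappaBar` times the norm of the averaged noise `n⁻¹ ∑ z_s ε_s`
(`estimate_error`).

*Probabilities.* Each entry of the averages is sub-Gaussian; for `z ε` this is deduced from
`exp y ≤ y + cosh (2 y)` and `E[z ε] = 0` (`subgaussian_of_abs_le_mul`). Phase lengths proportional
to `log T` make every entry fail with probability at most `2 T⁻³`, and since `T ≥ 400 q²` whenever
a horizon `T ≥ 2` exceeds the second phase, all the failures cost at most one period
(`horizon_mul_failure_le`).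

*Summation.* The averaged noise of the periods before `t` is independent of the draw of period `t`
and has mean squared norm of order `1 / n`, so the margin condition bounds the expected loss by a
multiple of `1 / n` (`integral_gap_le_of_error_le`). The sum over the periods is harmonic.
-/

namespace IVBandit

noncomputable section

/-! ### Euclidean norm of coordinate vectors -/

/-- The Euclidean norm of a plain coordinate vector. -/
def l2norm {ι : Type*} [Fintype ι] (x : ι → ℝ) : ℝ := ‖(WithLp.toLp 2 x : EuclideanSpace ℝ ι)‖

section l2norm

variable {ι κ : Type*} [Fintype ι] [Fintype κ]

lemma l2norm_nonneg (x : ι → ℝ) : 0 ≤ l2norm x := norm_nonneg _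

lemma sq_l2norm (x : ι → ℝ) : l2norm x ^ 2 = x ⬝ᵥ x := by
  simp [l2norm, EuclideanSpace.norm_sq_eq, dotProduct, ← sq]

lemma sq_l2norm_eq_sum (x : ι → ℝ) : l2norm x ^ 2 = ∑ i, x i ^ 2 := by
  simp [l2norm, EuclideanSpace.norm_sq_eq]

lemma l2norm_add_le (x y : ι → ℝ) : l2norm (x + y) ≤ l2norm x + l2norm y := by
  simpa [l2norm] using norm_add_le (WithLp.toLp 2 x : EuclideanSpace ℝ ι) (WithLp.toLp 2 y)

lemma l2norm_sub_le (x y : ι → ℝ) : l2norm (x - y) ≤ l2norm x + l2norm y := by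
  simpa [l2norm] using norm_sub_le (WithLp.toLp 2 x : EuclideanSpace ℝ ι) (WithLp.toLp 2 y)

lemma l2norm_eq_zero {x : ι → ℝ} : l2norm x = 0 ↔ x = 0 := by
  simp [l2norm]

lemma abs_dotProduct_le (x y : ι → ℝ) : |x ⬝ᵥ y| ≤ l2norm x * l2norm y := by
  rw [← abs_of_nonneg (mul_nonneg (l2norm_nonneg x) (l2norm_nonneg y)), ← sq_le_sq, mul_pow,
    sq_l2norm_eq_sum, sq_l2norm_eq_sum]
  exact Finset.sum_mul_sq_le_sq_mul_sq _ _ _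

lemma l2norm_le_of_abs_le {x : ι → ℝ} {y : ℝ} (hy : 0 ≤ y) (h : ∀ i, |x i| ≤ y) :
    l2norm x ≤ √(Fintype.card ι) * y := by
  refine le_of_sq_le_sq ?_ (by positivity)
  rw [mul_pow, Real.sq_sqrt (by positivity), sq_l2norm_eq_sum]
  calc ∑ i, x i ^ 2 ≤ ∑ _i : ι, y ^ 2 :=
        Finset.sum_le_sum fun i _ => sq_le_sq' (abs_le.1 (h i)).1 (abs_le.1 (h i)).2
    _ = _ := by simp

lemma l2norm_mulVec_le_of_abs_le {A : Matrix ι κ ℝ} {y : ℝ} (h : ∀ i j, |A i j| ≤ y)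
    (hy : 0 ≤ y) (x : κ → ℝ) :
    l2norm (A *ᵥ x) ≤ √(Fintype.card ι * Fintype.card κ) * y * l2norm x := by
  have h1 : ∀ i, |(A *ᵥ x) i| ≤ √(Fintype.card κ) * y * l2norm x := fun i =>
    (abs_dotProduct_le _ _).trans
      (mul_le_mul_of_nonneg_right (l2norm_le_of_abs_le hy (h i)) (l2norm_nonneg _))
  refine (l2norm_le_of_abs_le (by have := l2norm_nonneg x; positivity) h1).trans (le_of_eq ?_)
  rw [Real.sqrt_mul (by positivity)]
  ring

end l2norm

/-! ### Stability of two-stage least squares -/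

section TwoStage

variable {n k m : Type*} [Fintype n] [Fintype k] [DecidableEq k] [Fintype m] [DecidableEq m]

/-- Stability of the two-stage least squares map: the solution of
`A B⁻¹ Aᵀ θ = A B⁻¹ w` is bounded by `w` in terms of bounds on `A` and `B`. -/
lemma isUnit_and_l2norm_twoStage_le {A : Matrix k m ℝ} {B : Matrix m m ℝ} (hB : Bᵀ = B)
    {s S b β : ℝ} (hs : 0 < s) (hb : 0 < b) (hS : 0 ≤ S) (hβ : 0 ≤ β)
    (hAlow : ∀ y, s * l2norm y ≤ l2norm (Aᵀ *ᵥ y)) (hAup : ∀ u, l2norm (A *ᵥ u) ≤ S * l2norm u)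
    (hBlow : ∀ x, b * l2norm x ^ 2 ≤ x ⬝ᵥ B *ᵥ x) (hBup : ∀ x, x ⬝ᵥ B *ᵥ x ≤ β * l2norm x ^ 2) :
    IsUnit B.det ∧ IsUnit (A * B⁻¹ * Aᵀ).det ∧ ∀ w,
      l2norm ((A * B⁻¹ * Aᵀ)⁻¹ *ᵥ (A * B⁻¹) *ᵥ w) ≤ β * S / (s ^ 2 * b) * l2norm w := by
  have hBsym : ∀ x y, x ⬝ᵥ B *ᵥ y = y ⬝ᵥ B *ᵥ x := fun x y => by
    rw [dotProduct_mulVec, ← mulVec_transpose, hB, dotProduct_comm]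
  have hBu : IsUnit B := by
    rw [← mulVec_injective_iff_isUnit]
    refine (injective_iff_map_eq_zero B.mulVecLin).2 fun x hx => ?_
    have h := hBlow x
    rw [mulVecLin_apply] at hx
    rw [hx, dotProduct_zero] at h
    have : l2norm x ^ 2 ≤ 0 := by nlinarith [sq_nonneg (l2norm x)]
    exact l2norm_eq_zero.1 (pow_eq_zero_iff two_ne_zero |>.1 (le_antisymm this (sq_nonneg _)))
  have hBd : IsUnit B.det := (isUnit_iff_isUnit_det B).1 hBu
  -- `‖B y‖² ≤ β ⟨y, B y⟩` is the Cauchy-Schwarz inequality of the form defined by `B`.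
  have hBy : ∀ y, l2norm (B *ᵥ y) ^ 2 ≤ β * (y ⬝ᵥ B *ᵥ y) := by
    intro y
    set g := B *ᵥ y with hg
    have hnn : ∀ x, 0 ≤ x ⬝ᵥ B *ᵥ x := fun x =>
      (mul_nonneg hb.le (sq_nonneg _)).trans (hBlow x)
    have hyg : y ⬝ᵥ B *ᵥ g = l2norm g ^ 2 := by rw [hBsym, ← hg, sq_l2norm]
    have hq : ∀ r : ℝ, 0 ≤ (y ⬝ᵥ g) - 2 * r * l2norm g ^ 2 + r ^ 2 * (g ⬝ᵥ B *ᵥ g) := by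
      intro r
      have h := hnn (y - r • g)
      simp only [mulVec_sub, mulVec_smul, dotProduct_sub, sub_dotProduct, dotProduct_smul,
        smul_dotProduct, smul_eq_mul, hyg, ← hg] at h
      rw [← sq_l2norm] at h
      nlinarith
    have hgg := hBup g
    rcases eq_or_lt_of_le hβ with h0 | h0
    · have h1 : g ⬝ᵥ B *ᵥ g ≤ 0 := by simpa [← h0] using hgg
      have h2 : b * l2norm g ^ 2 ≤ b * 0 := by simpa using (hBlow g).trans h1
      simpa [← h0] using le_of_mul_le_mul_left h2 hb
    · have h1 := hq (1 / β)
      have h2 : (1 / β) ^ 2 * (g ⬝ᵥ B *ᵥ g) ≤ (1 / β) * l2norm g ^ 2 := by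
        calc (1 / β) ^ 2 * (g ⬝ᵥ B *ᵥ g) ≤ (1 / β) ^ 2 * (β * l2norm g ^ 2) :=
              mul_le_mul_of_nonneg_left hgg (by positivity)
          _ = _ := by field_simp
      have h3 : (1 / β) * l2norm g ^ 2 ≤ y ⬝ᵥ g := by linarith
      calc l2norm g ^ 2 = β * ((1 / β) * l2norm g ^ 2) := by field_simp
        _ ≤ _ := mul_le_mul_of_nonneg_left h3 hβ
  have hkey : ∀ θ, s ^ 2 * l2norm θ ^ 2 ≤ β * (θ ⬝ᵥ (A * B⁻¹ * Aᵀ) *ᵥ θ) := by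
    intro θ
    have h1 := hBy (B⁻¹ *ᵥ Aᵀ *ᵥ θ)
    rw [mulVec_mulVec _ B, mul_nonsing_inv _ hBd, one_mulVec] at h1
    have h2 : (B⁻¹ *ᵥ Aᵀ *ᵥ θ) ⬝ᵥ Aᵀ *ᵥ θ = θ ⬝ᵥ (A * B⁻¹ * Aᵀ) *ᵥ θ := by
      rw [← mulVec_mulVec, ← mulVec_mulVec, dotProduct_comm, dotProduct_mulVec θ A,
        ← mulVec_transpose]
    rw [h2] at h1
    refine le_trans ?_ h1
    rw [← mul_pow]
    exact pow_le_pow_left₀ (mul_nonneg hs.le (l2norm_nonneg _)) (hAlow θ) 2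
  have hGu : IsUnit (A * B⁻¹ * Aᵀ) := by
    rw [← mulVec_injective_iff_isUnit]
    refine (injective_iff_map_eq_zero (A * B⁻¹ * Aᵀ).mulVecLin).2 fun x hx => ?_
    have h := hkey x
    rw [mulVecLin_apply] at hx
    rw [hx, dotProduct_zero, mul_zero] at h
    have : l2norm x ^ 2 ≤ 0 := by
      by_contra hc
      have := mul_pos (pow_pos hs 2) (not_le.1 hc)
      linarith
    exact l2norm_eq_zero.1 (pow_eq_zero_iff two_ne_zero |>.1 (le_antisymm this (sq_nonneg _)))
  have hGd := (isUnit_iff_isUnit_det _).1 hGu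
  refine ⟨hBd, hGd, fun w => ?_⟩
  set θ := (A * B⁻¹ * Aᵀ)⁻¹ *ᵥ (A * B⁻¹) *ᵥ w with hθ
  have h1 : (A * B⁻¹ * Aᵀ) *ᵥ θ = A *ᵥ B⁻¹ *ᵥ w := by
    rw [hθ, mulVec_mulVec, mul_nonsing_inv _ hGd, one_mulVec, mulVec_mulVec]
  have h2 := hkey θ
  rw [h1] at h2
  set u := B⁻¹ *ᵥ w with hu
  have hBuw : B *ᵥ u = w := by rw [hu, mulVec_mulVec, mul_nonsing_inv _ hBd, one_mulVec]
  have hun : b * l2norm u ≤ l2norm w := by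
    have h3 := hBlow u
    rw [hBuw] at h3
    have h4 := (le_abs_self _).trans (abs_dotProduct_le u w)
    rcases eq_or_lt_of_le (l2norm_nonneg u) with h0 | h0
    · rw [← h0, mul_zero]; exact l2norm_nonneg _
    · by_contra hc
      nlinarith
  have h5 : θ ⬝ᵥ A *ᵥ u ≤ l2norm θ * (S * l2norm u) :=
    ((le_abs_self _).trans (abs_dotProduct_le _ _)).trans
      (mul_le_mul_of_nonneg_left (hAup u) (l2norm_nonneg _))
  have h6 : s ^ 2 * l2norm θ ≤ β * (S * l2norm u) := by
    rcases eq_or_lt_of_le (l2norm_nonneg θ) with h0 | h0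
    · rw [← h0, mul_zero]
      have := l2norm_nonneg u
      positivity
    · have h7 := h2.trans (mul_le_mul_of_nonneg_left h5 hβ)
      by_contra hc
      nlinarith
  rw [div_mul_eq_mul_div, le_div_iff₀ (by positivity)]
  calc l2norm θ * (s ^ 2 * b) = b * (s ^ 2 * l2norm θ) := by ring
    _ ≤ b * (β * (S * l2norm u)) := mul_le_mul_of_nonneg_left h6 hb.le
    _ = β * S * (b * l2norm u) := by ring
    _ ≤ _ := mul_le_mul_of_nonneg_left hun (by positivity)

/-- The error of the two-stage least squares estimator when the responses are `V β₀ + e`, in terms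
of bounds on the normalized moment matrices `r Vᵀ Z` and `r Zᵀ Z`. -/
lemma l2norm_twoSLS_sub_le {V : Matrix n k ℝ} {Z : Matrix n m ℝ} {R e : n → ℝ} {β₀ : k → ℝ}
    (hR : R = V *ᵥ β₀ + e) {r s S b β : ℝ} (hr : 0 < r) (hs : 0 < s) (hb : 0 < b) (hS : 0 ≤ S)
    (hβ : 0 ≤ β)
    (hAlow : ∀ y, s * l2norm y ≤ l2norm ((r • (Vᵀ * Z))ᵀ *ᵥ y))
    (hAup : ∀ u, l2norm ((r • (Vᵀ * Z)) *ᵥ u) ≤ S * l2norm u)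
    (hBlow : ∀ x, b * l2norm x ^ 2 ≤ x ⬝ᵥ (r • (Zᵀ * Z)) *ᵥ x)
    (hBup : ∀ x, x ⬝ᵥ (r • (Zᵀ * Z)) *ᵥ x ≤ β * l2norm x ^ 2) :
    l2norm (twoSLS V Z R - β₀) ≤ β * S / (s ^ 2 * b) * l2norm (r • (Zᵀ *ᵥ e)) := by
  have hBt : (r • (Zᵀ * Z))ᵀ = r • (Zᵀ * Z) := by simp [transpose_mul]
  obtain ⟨h1, h2, h3⟩ := isUnit_and_l2norm_twoStage_le hBt hs hb hS hβ hAlow hAup hBlow hBup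
  set A := r • (Vᵀ * Z) with hA
  set B := r • (Zᵀ * Z) with hB
  have hZZ : (Zᵀ * Z)⁻¹ = r • B⁻¹ := by
    have : Zᵀ * Z = r⁻¹ • B := by rw [hB, smul_smul, inv_mul_cancel₀ hr.ne', one_smul]
    rw [this]
    refine inv_eq_right_inv ?_
    rw [smul_mul_smul_comm, inv_mul_cancel₀ hr.ne', one_smul, mul_nonsing_inv _ h1]
  have hVP : Vᵀ * proj Z = (A * B⁻¹) * Zᵀ := by
    rw [proj, hZZ, hA]
    simp only [Matrix.mul_smul, Matrix.smul_mul, Matrix.mul_assoc]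
  have hAt : Zᵀ * V = r⁻¹ • Aᵀ := by
    rw [hA, transpose_smul, transpose_mul, transpose_transpose, smul_smul,
      inv_mul_cancel₀ hr.ne', one_smul]
  have hVPV : Vᵀ * proj Z * V = r⁻¹ • (A * B⁻¹ * Aᵀ) := by
    rw [hVP, Matrix.mul_assoc, hAt, Matrix.mul_smul]
  have hinv : (Vᵀ * proj Z * V)⁻¹ = r • (A * B⁻¹ * Aᵀ)⁻¹ := by
    rw [hVPV]
    refine inv_eq_right_inv ?_
    rw [smul_mul_smul_comm, inv_mul_cancel₀ hr.ne', one_smul, mul_nonsing_inv _ h2]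
  have hunit : (Vᵀ * proj Z * V)⁻¹ * (Vᵀ * proj Z * V) = 1 := by
    rw [hinv, hVPV, smul_mul_smul_comm, mul_inv_cancel₀ hr.ne', one_smul, nonsing_inv_mul _ h2]
  have hθ : twoSLS V Z R - β₀ = (A * B⁻¹ * Aᵀ)⁻¹ *ᵥ (A * B⁻¹) *ᵥ (r • (Zᵀ *ᵥ e)) := by
    rw [twoSLS, hR, mulVec_add, mulVec_mulVec, Matrix.mul_assoc _ Vᵀ, Matrix.mul_assoc _ _ V, hunit,
      one_mulVec, add_sub_cancel_left, hinv, hVP]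
    simp only [Matrix.mul_assoc, mulVec_smul, ← mulVec_mulVec, smul_mulVec]
  rw [hθ]
  exact h3 _

end TwoStage

/-! ### Entrywise perturbations of matrices -/

section Perturbation

variable {k m : Type*} [Fintype k] [Fintype m]

lemma l2norm_mulVec_sub_le {A A₀ : Matrix k m ℝ} {y δ : ℝ} (hy : 0 ≤ y)
    (h : ∀ i j, |A i j - A₀ i j| ≤ y) (hδ : √(Fintype.card k * Fintype.card m) * y ≤ δ)
    (u : m → ℝ) : l2norm (A *ᵥ u - A₀ *ᵥ u) ≤ δ * l2norm u := by
  rw [← sub_mulVec]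
  exact (l2norm_mulVec_le_of_abs_le (A := A - A₀) h hy u).trans
    (mul_le_mul_of_nonneg_right hδ (l2norm_nonneg _))

lemma l2norm_mulVec_le_of_close {A A₀ : Matrix k m ℝ} {y δ S : ℝ} (hy : 0 ≤ y)
    (h : ∀ i j, |A i j - A₀ i j| ≤ y) (hδ : √(Fintype.card k * Fintype.card m) * y ≤ δ)
    (hA₀ : ∀ u, l2norm (A₀ *ᵥ u) ≤ S * l2norm u) (u : m → ℝ) :
    l2norm (A *ᵥ u) ≤ (S + δ) * l2norm u := by
  have h1 := l2norm_mulVec_sub_le hy h hδ u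
  have h2 := l2norm_add_le (A₀ *ᵥ u) (A *ᵥ u - A₀ *ᵥ u)
  rw [add_sub_cancel] at h2
  linarith [hA₀ u]

lemma le_l2norm_mulVec_of_close {A A₀ : Matrix k m ℝ} {y δ s : ℝ} (hy : 0 ≤ y)
    (h : ∀ i j, |A i j - A₀ i j| ≤ y) (hδ : √(Fintype.card k * Fintype.card m) * y ≤ δ)
    (hA₀ : ∀ u, s * l2norm u ≤ l2norm (A₀ᵀ *ᵥ u)) (u : k → ℝ) :
    (s - δ) * l2norm u ≤ l2norm (Aᵀ *ᵥ u) := by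
  have h1 := l2norm_mulVec_sub_le (A := Aᵀ) (A₀ := A₀ᵀ) (δ := δ) hy (fun i j => h j i)
    (by rwa [mul_comm (Fintype.card m : ℝ)]) u
  have h2 := l2norm_sub_le (Aᵀ *ᵥ u) (Aᵀ *ᵥ u - A₀ᵀ *ᵥ u)
  rw [sub_sub_cancel] at h2
  linarith [hA₀ u]

lemma abs_dotProduct_mulVec_sub_le {A A₀ : Matrix m m ℝ} {y δ : ℝ} (hy : 0 ≤ y)
    (h : ∀ i j, |A i j - A₀ i j| ≤ y) (hδ : Fintype.card m * y ≤ δ) (x : m → ℝ) :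
    |x ⬝ᵥ A *ᵥ x - x ⬝ᵥ A₀ *ᵥ x| ≤ δ * l2norm x ^ 2 := by
  rw [← dotProduct_sub]
  have h1 := l2norm_mulVec_sub_le (δ := δ) hy h
    (by rwa [Real.sqrt_mul_self (Nat.cast_nonneg _)]) x
  refine (abs_dotProduct_le _ _).trans ?_
  nlinarith [mul_le_mul_of_nonneg_left h1 (l2norm_nonneg x)]

end Perturbation

/-! ### Bounds by singular values -/

section SingularValues

variable {k l : Type*} [Fintype k] [Fintype l]

lemma hasEigenvalue_toLin'_iff [DecidableEq k] {S : Matrix k k ℝ} {μ : ℝ} :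
    Module.End.HasEigenvalue (Matrix.toLin' S) μ ↔ ∃ x, x ≠ 0 ∧ S *ᵥ x = μ • x := by
  constructor
  · intro h
    obtain ⟨x, hx⟩ := h.exists_hasEigenvector
    exact ⟨x, hx.2, by simpa using hx.apply_eq_smul⟩
  · rintro ⟨x, hx0, hx⟩
    exact Module.End.hasEigenvalue_of_hasEigenvector
      (Module.End.hasEigenvector_iff.2 ⟨Module.End.mem_eigenspace_iff.2 (by simpa using hx), hx0⟩)

lemma hasEigenvalue_eigenvalues [DecidableEq k] {S : Matrix k k ℝ} (hS : S.IsHermitian) (i : k) :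
    Module.End.HasEigenvalue (Matrix.toLin' S) (hS.eigenvalues i) := by
  refine hasEigenvalue_toLin'_iff.2 ⟨⇑(hS.eigenvectorBasis i), fun h => ?_,
    hS.mulVec_eigenvectorBasis i⟩
  have h0 : hS.eigenvectorBasis i = 0 := by
    ext j
    exact congrFun h j
  simpa [h0] using hS.eigenvectorBasis.orthonormal.1 i

lemma mul_sq_l2norm_le_of_le_eigenvalue [DecidableEq k] {S : Matrix k k ℝ} (hS : Sᵀ = S) {c : ℝ}
    (h : ∀ μ, Module.End.HasEigenvalue (Matrix.toLin' S) μ → c ≤ μ) (x : k → ℝ) :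
    c * l2norm x ^ 2 ≤ x ⬝ᵥ S *ᵥ x := by
  have hH : (S - c • (1 : Matrix k k ℝ)).IsHermitian := by
    simp [Matrix.IsHermitian, conjTranspose_eq_transpose_of_trivial, hS]
  have hP : (S - c • (1 : Matrix k k ℝ)).PosSemidef := by
    rw [hH.posSemidef_iff_eigenvalues_nonneg]
    intro i
    obtain ⟨y, hy0, hy⟩ := hasEigenvalue_toLin'_iff.1 (hasEigenvalue_eigenvalues hH i)
    rw [sub_mulVec, smul_mulVec, one_mulVec, sub_eq_iff_eq_add, ← add_smul] at hy
    have := h _ (hasEigenvalue_toLin'_iff.2 ⟨y, hy0, hy⟩)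
    simpa using this
  have h2 := hP.dotProduct_mulVec_nonneg x
  simp only [star_trivial, sub_mulVec, smul_mulVec, one_mulVec, dotProduct_sub, dotProduct_smul,
    smul_eq_mul] at h2
  rw [sq_l2norm]
  linarith

lemma le_mul_sq_l2norm_of_eigenvalue_le [DecidableEq k] {S : Matrix k k ℝ} (hS : Sᵀ = S) {c : ℝ}
    (h : ∀ μ, Module.End.HasEigenvalue (Matrix.toLin' S) μ → μ ≤ c) (x : k → ℝ) :
    x ⬝ᵥ S *ᵥ x ≤ c * l2norm x ^ 2 := by
  have h1 := mul_sq_l2norm_le_of_le_eigenvalue (S := -S) (c := -c) (by simp [hS])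
    (fun μ hμ => by
      obtain ⟨y, hy0, hy⟩ := hasEigenvalue_toLin'_iff.1 hμ
      rw [neg_mulVec, neg_eq_iff_eq_neg, ← neg_smul] at hy
      linarith [h _ (hasEigenvalue_toLin'_iff.2 ⟨y, hy0, hy⟩)]) x
  rw [neg_mulVec, dotProduct_neg] at h1
  linarith

lemma dotProduct_gram_mulVec (A : Matrix k l ℝ) (u : l → ℝ) :
    u ⬝ᵥ (Aᵀ * A) *ᵥ u = l2norm (A *ᵥ u) ^ 2 := by
  rw [sq_l2norm, ← mulVec_mulVec, dotProduct_mulVec, vecMul_transpose]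

lemma gram_eigenvalue_nonneg [DecidableEq l] {A : Matrix k l ℝ} {μ : ℝ}
    (h : Module.End.HasEigenvalue (Matrix.toLin' (Aᵀ * A)) μ) : 0 ≤ μ := by
  obtain ⟨y, hy0, hy⟩ := hasEigenvalue_toLin'_iff.1 h
  have h1 := dotProduct_gram_mulVec A y
  rw [hy, dotProduct_smul, smul_eq_mul, ← sq_l2norm] at h1
  have h2 : 0 < l2norm y := lt_of_le_of_ne (l2norm_nonneg _) fun h => hy0 (l2norm_eq_zero.1 h.symm)
  by_contra hc
  nlinarith [sq_nonneg (l2norm (A *ᵥ y)), pow_pos h2 2]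

/-- A bound `‖A u‖ ≤ c ‖u‖` passes to the transpose. -/
lemma l2norm_transpose_mulVec_le {A : Matrix k l ℝ} {c : ℝ} (hc : 0 ≤ c)
    (h : ∀ u, l2norm (A *ᵥ u) ≤ c * l2norm u) (y : k → ℝ) :
    l2norm (Aᵀ *ᵥ y) ≤ c * l2norm y := by
  have h1 : l2norm (Aᵀ *ᵥ y) ^ 2 ≤ l2norm y * (c * l2norm (Aᵀ *ᵥ y)) := by
    have h2 := abs_dotProduct_le y (A *ᵥ Aᵀ *ᵥ y)
    have h3 : y ⬝ᵥ A *ᵥ Aᵀ *ᵥ y = l2norm (Aᵀ *ᵥ y) ^ 2 := by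
      rw [← dotProduct_gram_mulVec, transpose_transpose, mulVec_mulVec]
    rw [h3] at h2
    exact ((le_abs_self _).trans h2).trans (mul_le_mul_of_nonneg_left (h _) (l2norm_nonneg _))
  rcases eq_or_lt_of_le (l2norm_nonneg (Aᵀ *ᵥ y)) with h0 | h0
  · rw [← h0]
    exact mul_nonneg hc (l2norm_nonneg _)
  · by_contra hcon
    nlinarith

/-- For a square matrix (up to the names of the indices), a positive lower bound `‖A u‖ ≥ c ‖u‖`
passes to the transpose. -/
lemma le_l2norm_transpose_mulVec {A : Matrix k l ℝ} (hkl : Fintype.card k = Fintype.card l)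
    {c : ℝ} (hc : 0 < c) (h : ∀ u, c * l2norm u ≤ l2norm (A *ᵥ u)) (y : k → ℝ) :
    c * l2norm y ≤ l2norm (Aᵀ *ᵥ y) := by
  have hinj : Function.Injective A.mulVecLin := by
    refine (injective_iff_map_eq_zero _).2 fun u hu => ?_
    have h1 := h u
    rw [mulVecLin_apply] at hu
    have h0 : l2norm (0 : k → ℝ) = 0 := l2norm_eq_zero.2 rfl
    rw [hu, h0] at h1
    exact l2norm_eq_zero.1 (le_antisymm (by nlinarith) (l2norm_nonneg _))
  have hsurj : Function.Surjective A.mulVecLin :=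
    (LinearMap.injective_iff_surjective_of_finrank_eq_finrank (by simp [hkl])).1 hinj
  obtain ⟨u, hu⟩ := hsurj y
  rw [mulVecLin_apply] at hu
  have h1 : l2norm y ^ 2 ≤ l2norm u * l2norm (Aᵀ *ᵥ y) := by
    have h2 := (le_abs_self _).trans (abs_dotProduct_le u (Aᵀ *ᵥ y))
    rwa [dotProduct_mulVec, vecMul_transpose, hu, ← sq_l2norm] at h2
  have h2 := h u
  rw [hu] at h2
  rcases eq_or_lt_of_le (l2norm_nonneg y) with h0 | h0
  · rw [← h0, mul_zero]
    exact l2norm_nonneg _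
  · have h3 : c * l2norm y ^ 2 ≤ l2norm y * l2norm (Aᵀ *ᵥ y) := by
      nlinarith [mul_le_mul_of_nonneg_right h2 (l2norm_nonneg (Aᵀ *ᵥ y)),
        mul_le_mul_of_nonneg_left h1 hc.le]
    by_contra hcon
    nlinarith

lemma l2norm_mulVec_le_of_gram_eigenvalue [DecidableEq l] (A : Matrix k l ℝ) {φ : ℝ} (hφ : 0 ≤ φ)
    (h : ∀ s, 0 ≤ s → Module.End.HasEigenvalue (Matrix.toLin' (Aᵀ * A)) (s ^ 2) → s ≤ φ)
    (u : l → ℝ) : l2norm (A *ᵥ u) ≤ φ * l2norm u := by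
  refine le_of_sq_le_sq ?_ (mul_nonneg hφ (l2norm_nonneg _))
  rw [← dotProduct_gram_mulVec, mul_pow]
  refine le_mul_sq_l2norm_of_eigenvalue_le (by simp) (fun μ hμ => ?_) u
  have h0 := gram_eigenvalue_nonneg hμ
  have h1 := h (√μ) (Real.sqrt_nonneg _) (by rwa [Real.sq_sqrt h0])
  exact (Real.sqrt_le_left hφ).1 h1

lemma le_l2norm_mulVec_of_gram_eigenvalue [DecidableEq l] (A : Matrix k l ℝ) {φ : ℝ} (hφ : 0 ≤ φ)
    (h : ∀ s, 0 ≤ s → Module.End.HasEigenvalue (Matrix.toLin' (Aᵀ * A)) (s ^ 2) → φ ≤ s)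
    (u : l → ℝ) : φ * l2norm u ≤ l2norm (A *ᵥ u) := by
  refine le_of_sq_le_sq ?_ (l2norm_nonneg _)
  rw [← dotProduct_gram_mulVec, mul_pow]
  refine mul_sq_l2norm_le_of_le_eigenvalue (by simp) (fun μ hμ => ?_) u
  have h0 := gram_eigenvalue_nonneg hμ
  have h1 := h (√μ) (Real.sqrt_nonneg _) (by rwa [Real.sq_sqrt h0])
  exact (Real.le_sqrt hφ h0).1 h1

lemma exists_gram_eigenvalue [DecidableEq l] [Nonempty l] (A : Matrix k l ℝ) :
    ∃ s : ℝ, 0 ≤ s ∧ Module.End.HasEigenvalue (Matrix.toLin' (Aᵀ * A)) (s ^ 2) := by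
  have hH : (Aᵀ * A).IsHermitian := by
    simp [Matrix.IsHermitian, conjTranspose_eq_transpose_of_trivial]
  have h1 := hasEigenvalue_eigenvalues hH (Classical.arbitrary l)
  exact ⟨√_, Real.sqrt_nonneg _, by rwa [Real.sq_sqrt (gram_eigenvalue_nonneg h1)]⟩

lemma gram_eigenvalue_pos [DecidableEq l] {A : Matrix k l ℝ} (hA : A.rank = Fintype.card l) {s : ℝ}
    (h0 : 0 ≤ s) (hs : Module.End.HasEigenvalue (Matrix.toLin' (Aᵀ * A)) (s ^ 2)) : 0 < s := by
  refine lt_of_le_of_ne h0 ?_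
  rintro rfl
  obtain ⟨x, hx0, hx⟩ := hasEigenvalue_toLin'_iff.1 hs
  have hrk : (Aᵀ * A).rank = Fintype.card l := by rw [rank_transpose_mul_self, hA]
  have hinj : Function.Injective (Aᵀ * A).mulVecLin := by
    rw [LinearMap.injective_iff_surjective, ← LinearMap.range_eq_top]
    exact Submodule.eq_top_of_finrank_eq (by simpa [Matrix.rank] using hrk)
  refine hx0 (hinj ?_)
  simp only [mulVecLin_apply, hx]
  simp

variable [DecidableEq k] [DecidableEq l]

lemma isSingularValue_iff_of_le {A : Matrix k l ℝ} (h : Fintype.card l ≤ Fintype.card k) {s : ℝ} :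
    IsSingularValue A s ↔ 0 ≤ s ∧ Module.End.HasEigenvalue (Matrix.toLin' (Aᵀ * A)) (s ^ 2) := by
  rw [IsSingularValue, if_pos h]

lemma isSingularValue_iff_of_lt {A : Matrix k l ℝ} (h : ¬ Fintype.card l ≤ Fintype.card k) {s : ℝ} :
    IsSingularValue A s ↔ 0 ≤ s ∧ Module.End.HasEigenvalue (Matrix.toLin' (Aᵀᵀ * Aᵀ)) (s ^ 2) := by
  rw [IsSingularValue, if_neg h, transpose_transpose]

lemma finite_setOf_hasEigenvalue_sq (S : Matrix k k ℝ) :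
    {s : ℝ | 0 ≤ s ∧ Module.End.HasEigenvalue (Matrix.toLin' S) (s ^ 2)}.Finite := by
  refine Set.Finite.of_finite_image (f := fun s : ℝ => s ^ 2)
    ((Module.End.finite_hasEigenvalue (Matrix.toLin' S)).subset ?_) ?_
  · rintro _ ⟨s, hs, rfl⟩
    exact hs.2
  · intro s hs t ht hst
    exact (pow_left_inj₀ hs.1 ht.1 two_ne_zero).1 hst

lemma finite_isSingularValue (A : Matrix k l ℝ) : {s | IsSingularValue A s}.Finite := by
  by_cases h : Fintype.card l ≤ Fintype.card k
  · simpa only [isSingularValue_iff_of_le h] using finite_setOf_hasEigenvalue_sq (Aᵀ * A)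
  · simpa only [isSingularValue_iff_of_lt h] using finite_setOf_hasEigenvalue_sq (Aᵀᵀ * Aᵀ)

lemma phiMin_nonneg (A : Matrix k l ℝ) : 0 ≤ phiMin A := Real.sInf_nonneg fun _ hs => hs.1

lemma phiMax_nonneg (A : Matrix k l ℝ) : 0 ≤ phiMax A := Real.sSup_nonneg fun _ hs => hs.1

lemma phiMin_le {A : Matrix k l ℝ} {s : ℝ} (h : IsSingularValue A s) : phiMin A ≤ s :=
  csInf_le (finite_isSingularValue A).bddBelow h

lemma le_phiMax {A : Matrix k l ℝ} {s : ℝ} (h : IsSingularValue A s) : s ≤ phiMax A :=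
  le_csSup (finite_isSingularValue A).bddAbove h

lemma phiMin_le_phiMax (A : Matrix k l ℝ) : phiMin A ≤ phiMax A := by
  rcases Set.eq_empty_or_nonempty {s | IsSingularValue A s} with h | ⟨s, hs⟩
  · simp [phiMin, phiMax, h]
  · exact (phiMin_le hs).trans (le_phiMax hs)

lemma l2norm_mulVec_le_phiMax (A : Matrix k l ℝ) (u : l → ℝ) :
    l2norm (A *ᵥ u) ≤ phiMax A * l2norm u := by
  by_cases h : Fintype.card l ≤ Fintype.card k
  · exact l2norm_mulVec_le_of_gram_eigenvalue A (phiMax_nonneg A)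
      (fun s h0 hs => le_phiMax ((isSingularValue_iff_of_le h).2 ⟨h0, hs⟩)) u
  · exact l2norm_transpose_mulVec_le (phiMax_nonneg A) (l2norm_mulVec_le_of_gram_eigenvalue Aᵀ
      (phiMax_nonneg A) (fun s h0 hs => le_phiMax ((isSingularValue_iff_of_lt h).2 ⟨h0, hs⟩))) u

/-- The smallest singular value of a matrix with at most as many rows as columns bounds its
transpose from below. -/
lemma phiMin_mul_le (A : Matrix k l ℝ) (hkl : Fintype.card k ≤ Fintype.card l) (y : k → ℝ) :
    phiMin A * l2norm y ≤ l2norm (Aᵀ *ᵥ y) := by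
  by_cases h : Fintype.card l ≤ Fintype.card k
  · rcases eq_or_lt_of_le (phiMin_nonneg A) with h0 | h0
    · rw [← h0, zero_mul]
      exact l2norm_nonneg _
    · exact le_l2norm_transpose_mulVec (le_antisymm hkl h) h0
        (le_l2norm_mulVec_of_gram_eigenvalue A h0.le
          (fun s h0 hs => phiMin_le ((isSingularValue_iff_of_le h).2 ⟨h0, hs⟩))) y
  · exact le_l2norm_mulVec_of_gram_eigenvalue Aᵀ (phiMin_nonneg A)
      (fun s h0 hs => phiMin_le ((isSingularValue_iff_of_lt h).2 ⟨h0, hs⟩)) y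

lemma isSingularValue_of_posSemidef {S : Matrix k k ℝ} (hS : S.PosSemidef) {μ : ℝ}
    (hμ : Module.End.HasEigenvalue (Matrix.toLin' S) μ) : IsSingularValue S μ := by
  have hSt : Sᵀ = S := by
    simpa [Matrix.IsHermitian, conjTranspose_eq_transpose_of_trivial] using hS.1
  obtain ⟨x, hx0, hx⟩ := hasEigenvalue_toLin'_iff.1 hμ
  refine ⟨?_, ?_⟩
  · have h1 := hS.dotProduct_mulVec_nonneg x
    rw [hx, star_trivial, dotProduct_smul, smul_eq_mul, ← sq_l2norm] at h1
    have h2 : 0 < l2norm x :=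
      lt_of_le_of_ne (l2norm_nonneg _) fun h => hx0 (l2norm_eq_zero.1 h.symm)
    exact nonneg_of_mul_nonneg_left h1 (by positivity)
  · simp only [le_refl, if_true]
    refine hasEigenvalue_toLin'_iff.2 ⟨x, hx0, ?_⟩
    rw [hSt, ← mulVec_mulVec, hx, mulVec_smul, hx, smul_smul, sq]

lemma phiMin_mul_sq_le {S : Matrix k k ℝ} (hS : S.PosSemidef) (x : k → ℝ) :
    phiMin S * l2norm x ^ 2 ≤ x ⬝ᵥ S *ᵥ x :=
  mul_sq_l2norm_le_of_le_eigenvalue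
    (by simpa [Matrix.IsHermitian, conjTranspose_eq_transpose_of_trivial] using hS.1)
    (fun _ hμ => phiMin_le (isSingularValue_of_posSemidef hS hμ)) x

lemma le_phiMax_mul_sq {S : Matrix k k ℝ} (hS : S.PosSemidef) (x : k → ℝ) :
    x ⬝ᵥ S *ᵥ x ≤ phiMax S * l2norm x ^ 2 :=
  le_mul_sq_l2norm_of_eigenvalue_le
    (by simpa [Matrix.IsHermitian, conjTranspose_eq_transpose_of_trivial] using hS.1)
    (fun _ hμ => le_phiMax (isSingularValue_of_posSemidef hS hμ)) x

/-- A matrix of full row rank has a positive smallest singular value. -/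
lemma phiMin_pos [Nonempty k] {A : Matrix k l ℝ} (hkl : Fintype.card k ≤ Fintype.card l)
    (hA : A.rank = Fintype.card k) : 0 < phiMin A := by
  have hA' : Aᵀ.rank = Fintype.card k := by rw [rank_transpose, hA]
  have hmem : (∃ s, IsSingularValue A s) → IsSingularValue A (phiMin A) := fun h =>
    Set.Nonempty.csInf_mem h (finite_isSingularValue A)
  by_cases h : Fintype.card l ≤ Fintype.card k
  · have : Nonempty l := Fintype.card_pos_iff.1 (Fintype.card_pos.trans_le hkl)
    simp only [isSingularValue_iff_of_le h] at hmem
    obtain ⟨h0, hs⟩ := hmem (exists_gram_eigenvalue A)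
    exact gram_eigenvalue_pos (hA.trans (le_antisymm hkl h)) h0 hs
  · simp only [isSingularValue_iff_of_lt h] at hmem
    obtain ⟨h0, hs⟩ := hmem (exists_gram_eigenvalue Aᵀ)
    exact gram_eigenvalue_pos hA' h0 hs

lemma phiMin_pos_of_transpose_mulVec_ne_zero [Nonempty k] {A : Matrix k l ℝ}
    (hkl : Fintype.card k ≤ Fintype.card l) (hA : ∀ y, Aᵀ *ᵥ y = 0 → y = 0) : 0 < phiMin A := by
  refine phiMin_pos hkl ?_
  rw [← rank_transpose, Matrix.rank, LinearMap.finrank_range_of_inj,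
    Module.finrank_fintype_fun_eq_card]
  exact (injective_iff_map_eq_zero _).2 fun y hy => hA y hy

end SingularValues

/-! ### Sub-Gaussian concentration -/

section Concentration

variable {Ω : Type*} [MeasurableSpace Ω] {μ : Measure Ω}

lemma subgaussian_mono {X : Ω → ℝ} {c d : ℝ≥0} (h : HasSubgaussianMGF X c μ) (hcd : c ≤ d) :
    HasSubgaussianMGF X d μ where
  integrable_exp_mul := h.integrable_exp_mul
  mgf_le t := (h.mgf_le t).trans (by gcongr)

/-- Two-sided tail bound for sums of independent sub-Gaussian variables. It is stated with a target
exponent `Λ`, so that it also covers vanishing variance proxies. -/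
lemma measure_le_abs_sum_le [IsProbabilityMeasure μ] {ι : Type*} [Fintype ι] {X : ι → Ω → ℝ}
    (h_indep : iIndepFun X μ) {c : ℝ≥0} (hX : ∀ i, HasSubgaussianMGF (X i) c μ) {u Λ : ℝ}
    (hu : 0 < u) (h : 2 * (Fintype.card ι * c) * Λ ≤ u ^ 2) :
    μ.real {ω | u ≤ |∑ i, X i ω|} ≤ 2 * Real.exp (-Λ) := by
  rcases le_or_gt Λ 0 with hΛ | hΛ
  · have : (1 : ℝ) ≤ Real.exp (-Λ) := Real.one_le_exp (by linarith)
    linarith [measureReal_le_one (μ := μ) (s := {ω | u ≤ |∑ i, X i ω|})]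
  have hS : HasSubgaussianMGF (fun ω => ∑ i, X i ω) (u ^ 2 / (2 * Λ)).toNNReal μ := by
    refine subgaussian_mono (HasSubgaussianMGF.sum_of_iIndepFun h_indep
      (c := fun _ => c) fun i _ => hX i) ?_
    rw [← NNReal.coe_le_coe, Real.coe_toNNReal _ (by positivity), le_div_iff₀ (by positivity)]
    simp
    linarith
  have hexp : Real.exp (-u ^ 2 / (2 * ((u ^ 2 / (2 * Λ)).toNNReal : ℝ))) = Real.exp (-Λ) := by
    rw [Real.coe_toNNReal _ (by positivity)]
    congr 1
    field_simp
  have h1 := hS.measure_ge_le hu.le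
  have h2 := hS.neg.measure_ge_le hu.le
  rw [hexp] at h1 h2
  calc μ.real {ω | u ≤ |∑ i, X i ω|}
      ≤ μ.real ({ω | u ≤ ∑ i, X i ω} ∪ {ω | u ≤ (-fun ω => ∑ i, X i ω) ω}) := by
        refine measureReal_mono fun ω hω => ?_
        simpa [le_abs] using hω
    _ ≤ _ := measureReal_union_le _ _
    _ ≤ _ := by linarith

/-- Tail bound for the average of independent variables with common mean `m`. -/
lemma measure_le_abs_average_sub_le [IsProbabilityMeasure μ] {s : Finset ℕ} {X : ℕ → Ω → ℝ} {m : ℝ}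
    (h_indep : iIndepFun (fun t : s => X t) μ) {c : ℝ≥0}
    (hX : ∀ i ∈ s, HasSubgaussianMGF (fun ω => X i ω - m) c μ) {n y Λ : ℝ} (hn : n = s.card)
    (hn0 : 0 < n) (hy : 0 < y) (h : 2 * c * Λ ≤ n * y ^ 2) :
    μ.real {ω | y ≤ |n⁻¹ * ∑ i ∈ s, X i ω - m|} ≤ 2 * Real.exp (-Λ) := by
  have h1 := measure_le_abs_sum_le (X := fun (i : s) ω => X i ω - m) (u := n * y) (Λ := Λ) (c := c)
    (h_indep.comp (fun _ x => x - m) (fun _ => by fun_prop)) (fun i => hX i i.2) (by positivity)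
    (by rw [Fintype.card_coe, ← hn]; nlinarith)
  refine le_trans (le_of_eq ?_) h1
  congr 1
  ext ω
  have h2 : ∑ i : s, (X i ω - m) = n * (n⁻¹ * ∑ i ∈ s, X i ω - m) := by
    rw [Finset.sum_coe_sort s (fun i => X i ω - m), Finset.sum_sub_distrib, Finset.sum_const,
      nsmul_eq_mul, ← hn]
    field_simp
  simp only [Set.mem_ofPred_eq, h2, abs_mul, abs_of_pos hn0]
  exact (mul_le_mul_iff_right₀ hn0).symm

lemma subgaussian_sub_integral_of_abs_le [IsProbabilityMeasure μ] {X : Ω → ℝ} {B : ℝ}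
    (hX : AEMeasurable X μ) (hB : ∀ᵐ ω ∂μ, |X ω| ≤ B) :
    HasSubgaussianMGF (fun ω => X ω - ∫ ω, X ω ∂μ) (B ^ 2).toNNReal μ := by
  have hB0 : 0 ≤ B := by
    obtain ⟨ω, hω⟩ := hB.exists
    exact (abs_nonneg _).trans hω
  refine subgaussian_mono (hasSubgaussianMGF_of_mem_Icc (a := -B) (b := B) hX
    (hB.mono fun ω hω => abs_le.1 hω)) (le_of_eq ?_)
  rw [← NNReal.coe_inj, Real.coe_toNNReal _ (by positivity)]
  simp only [sub_neg_eq_add, NNReal.coe_pow, NNReal.coe_div, coe_nnnorm, Real.norm_eq_abs,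
    NNReal.coe_ofNat, abs_of_nonneg (add_nonneg hB0 hB0)]
  ring

/-- The linear term on the right integrates to `0` for centred variables, and the even term only
increases when the variable is replaced by a bound for its absolute value. -/
lemma exp_le_add_cosh (x : ℝ) : Real.exp x ≤ x + Real.cosh (2 * x) := by
  have h0 := Real.exp_pos x
  have h1 : 1 - (Real.exp x)⁻¹ ≤ x := by
    rw [← Real.exp_neg]
    linarith [Real.add_one_le_exp (-x)]
  have h2 : Real.cosh (2 * x) = (Real.exp x ^ 2 + (Real.exp x ^ 2)⁻¹) / 2 := by
    rw [Real.cosh_eq, ← Real.exp_nat_mul, ← Real.exp_neg]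
    push_cast
    ring_nf
  rw [h2]
  set u := Real.exp x with hu
  have h3 : u ≤ (1 - u⁻¹) + (u ^ 2 + (u ^ 2)⁻¹) / 2 := by
    have : (1 - u⁻¹) + (u ^ 2 + (u ^ 2)⁻¹) / 2 - u = ((u - 1) ^ 2 * (u ^ 2 + 1)) / (2 * u ^ 2) := by
      field_simp
      ring
    have h4 : 0 ≤ ((u - 1) ^ 2 * (u ^ 2 + 1)) / (2 * u ^ 2) := by positivity
    linarith
  linarith

/-- A centred variable dominated by a multiple of a sub-Gaussian variable is sub-Gaussian. -/
lemma subgaussian_of_abs_le_mul [IsProbabilityMeasure μ] {X E : Ω → ℝ} {c : ℝ≥0}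
    (hE : HasSubgaussianMGF E c μ) {r : ℝ≥0} (hX : AEMeasurable X μ)
    (hXE : ∀ᵐ ω ∂μ, |X ω| ≤ r * |E ω|) (h0 : ∫ ω, X ω ∂μ = 0) :
    HasSubgaussianMGF X (4 * r ^ 2 * c) μ := by
  have hcosh : ∀ t : ℝ, Integrable (fun ω => Real.cosh (t * E ω)) μ := by
    intro t
    have := ((hE.integrable_exp_mul t).add (hE.integrable_exp_mul (-t))).div_const 2
    refine this.congr (ae_of_all _ fun ω => ?_)
    simp [Real.cosh_eq]
  have hcosh_le : ∀ t : ℝ, ∫ ω, Real.cosh (t * E ω) ∂μ ≤ Real.exp (c * t ^ 2 / 2) := by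
    intro t
    have h1 : ∫ ω, Real.cosh (t * E ω) ∂μ = (mgf E μ t + mgf E μ (-t)) / 2 := by
      rw [mgf, mgf, ← integral_add (hE.integrable_exp_mul t) (hE.integrable_exp_mul (-t)),
        ← integral_div]
      simp [Real.cosh_eq]
    have h2 := hE.mgf_le t
    have h3 := hE.mgf_le (-t)
    rw [neg_sq] at h3
    rw [h1]
    linarith
  have hXint : Integrable X μ := by
    refine Integrable.mono (hE.integrable.const_mul (r : ℝ)) hX.aestronglyMeasurable ?_
    filter_upwards [hXE] with ω hω
    simpa [abs_mul] using hω
  have hdom : ∀ t : ℝ, ∀ᵐ ω ∂μ,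
      Real.exp (t * X ω) ≤ t * X ω + Real.cosh (2 * t * r * E ω) := by
    intro t
    filter_upwards [hXE] with ω hω
    refine (exp_le_add_cosh _).trans (add_le_add_right ?_ _)
    rw [Real.cosh_le_cosh]
    simp only [abs_mul, NNReal.abs_eq, abs_two]
    nlinarith [abs_nonneg t]
  have hint : ∀ t : ℝ, Integrable (fun ω => Real.exp (t * X ω)) μ := by
    intro t
    refine Integrable.mono' ((hXint.const_mul t).add (hcosh (2 * t * r)))
      (by fun_prop) ?_
    filter_upwards [hdom t] with ω hω
    simpa [abs_of_pos (Real.exp_pos _)] using hω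
  refine ⟨hint, fun t => ?_⟩
  calc mgf X μ t ≤ ∫ ω, (t * X ω + Real.cosh (2 * t * r * E ω)) ∂μ :=
        integral_mono_ae (hint t) ((hXint.const_mul t).add (hcosh (2 * t * r))) (hdom t)
    _ = ∫ ω, Real.cosh (2 * t * r * E ω) ∂μ := by
        rw [integral_add (hXint.const_mul t) (hcosh _), integral_const_mul, h0, mul_zero, zero_add]
    _ ≤ _ := hcosh_le _
    _ = _ := by
        congr 1
        push_cast
        ring

lemma one_add_sq_div_two_le_cosh (x : ℝ) : 1 + x ^ 2 / 2 ≤ Real.cosh x := by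
  have h1 : Real.cosh x = 1 + 2 * Real.sinh (x / 2) ^ 2 := by
    rw [show x = 2 * (x / 2) by ring, Real.cosh_two_mul, Real.cosh_sq]
    ring_nf
  have h2 : (x / 2) ^ 2 ≤ Real.sinh (x / 2) ^ 2 := by
    rcases le_total 0 (x / 2) with h | h
    · exact pow_le_pow_left₀ h (Real.self_le_sinh_iff.2 h) 2
    · nlinarith [Real.sinh_le_self_iff.2 h]
  rw [h1]
  linarith

/-- The factor `2` instead of the optimal `1` suffices for the constants of the regret bound. -/
lemma integral_sq_le_of_subgaussian [IsProbabilityMeasure μ] {X : Ω → ℝ} {c : ℝ≥0}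
    (hX : HasSubgaussianMGF X c μ) : ∫ ω, X ω ^ 2 ∂μ ≤ 2 * c := by
  -- Compare `1 + t² X² / 2 ≤ cosh (t X)` at a `t` with `c t² / 2 ≤ 1`.
  set t : ℝ := (√(c + 1))⁻¹ with ht
  have hc : (0 : ℝ) < c + 1 := by positivity
  have ht2 : t ^ 2 = (c + 1 : ℝ)⁻¹ := by rw [ht, inv_pow, Real.sq_sqrt hc.le]
  have hsq : Integrable (fun ω => X ω ^ 2) μ := (hX.memLp 2).integrable_sq
  have h1 : ∀ ω, 2 + t ^ 2 * X ω ^ 2 ≤ Real.exp (t * X ω) + Real.exp (-t * X ω) := by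
    intro ω
    have h := one_add_sq_div_two_le_cosh (t * X ω)
    rw [Real.cosh_eq] at h
    have : -t * X ω = -(t * X ω) := by ring
    rw [this]
    nlinarith
  have h2 : 2 + t ^ 2 * ∫ ω, X ω ^ 2 ∂μ ≤ 2 * Real.exp (c * t ^ 2 / 2) := by
    calc 2 + t ^ 2 * ∫ ω, X ω ^ 2 ∂μ = ∫ ω, (2 + t ^ 2 * X ω ^ 2) ∂μ := by
          rw [integral_add (integrable_const _) (hsq.const_mul _), integral_const_mul]
          simp
      _ ≤ ∫ ω, (Real.exp (t * X ω) + Real.exp (-t * X ω)) ∂μ :=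
          integral_mono ((integrable_const _).add (hsq.const_mul _))
            ((hX.integrable_exp_mul t).add (hX.integrable_exp_mul (-t))) h1
      _ = mgf X μ t + mgf X μ (-t) := by
          rw [integral_add (hX.integrable_exp_mul t) (hX.integrable_exp_mul (-t))]
          rfl
      _ ≤ _ := by
          have h3 := hX.mgf_le t
          have h4 := hX.mgf_le (-t)
          rw [neg_sq] at h4
          linarith
  have h5 : (c : ℝ) * t ^ 2 / 2 ≤ 1 := by
    rw [ht2, ← div_eq_mul_inv]
    have : (c : ℝ) / (c + 1) ≤ 1 := (div_le_one hc).2 (by linarith)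
    linarith
  have h6 := (abs_le.1 (Real.abs_exp_sub_one_le (x := (c : ℝ) * t ^ 2 / 2)
    (by rw [abs_of_nonneg (by positivity)]; exact h5))).2
  rw [abs_of_nonneg (by positivity)] at h6
  have h7 : t ^ 2 * ∫ ω, X ω ^ 2 ∂μ ≤ t ^ 2 * (2 * c) := by linarith
  exact le_of_mul_le_mul_left h7 (by rw [ht2]; positivity)

lemma integral_sq_sum_le [IsProbabilityMeasure μ] {ι : Type*} [Fintype ι] {X : ι → Ω → ℝ} {v : ℝ}
    (h_indep : iIndepFun X μ) (hL : ∀ i, MemLp (X i) 2 μ) (h0 : ∀ i, ∫ ω, X i ω ∂μ = 0)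
    (hv : ∀ i, ∫ ω, X i ω ^ 2 ∂μ ≤ v) :
    ∫ ω, (∑ i, X i ω) ^ 2 ∂μ ≤ Fintype.card ι * v := by
  have h1 := IndepFun.variance_sum (s := Finset.univ) (X := X) (fun i _ => hL i)
    (fun i _ j _ hij => h_indep.indepFun hij)
  have h2 : ∫ ω, (∑ i, X i) ω ∂μ = 0 := by
    simp only [Finset.sum_apply]
    rw [integral_finsetSum _ fun i _ => (hL i).integrable (by norm_num)]
    simp [h0]
  have h3 : AEMeasurable (∑ i, X i) μ := Finset.aemeasurable_sum _ fun i _ => (hL i).1.aemeasurable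
  rw [variance_of_integral_eq_zero h3 h2] at h1
  simp only [Finset.sum_apply] at h1
  rw [h1]
  calc ∑ i, variance (X i) μ ≤ ∑ _i : ι, v := Finset.sum_le_sum fun i _ => by
        rw [variance_of_integral_eq_zero (hL i).1.aemeasurable (h0 i)]
        exact hv i
    _ = _ := by simp

/-- Pairing two independent families, each of them of independent variables. -/
lemma iIndepFun_prodMk [IsProbabilityMeasure μ] {ι β γ : Type*} [Fintype ι] [MeasurableSpace β]
    [MeasurableSpace γ] {X : ι → Ω → β} {Y : ι → Ω → γ} (hXm : ∀ i, Measurable (X i))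
    (hYm : ∀ i, Measurable (Y i)) (hX : iIndepFun X μ) (hY : iIndepFun Y μ)
    (hXY : IndepFun (fun ω i => X i ω) (fun ω i => Y i ω) μ) :
    iIndepFun (fun i ω => (X i ω, Y i ω)) μ := by
  have hXp : ∀ i, IsProbabilityMeasure (μ.map (X i)) := fun i =>
    Measure.isProbabilityMeasure_map (hXm i).aemeasurable
  have hYp : ∀ i, IsProbabilityMeasure (μ.map (Y i)) := fun i =>
    Measure.isProbabilityMeasure_map (hYm i).aemeasurable
  rw [iIndepFun_iff_map_fun_eq_pi_map (fun i => ((hXm i).prodMk (hYm i)).aemeasurable)]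
  rw [iIndepFun_iff_map_fun_eq_pi_map (fun i => (hXm i).aemeasurable)] at hX
  rw [iIndepFun_iff_map_fun_eq_pi_map (fun i => (hYm i).aemeasurable)] at hY
  have hpair : ∀ i, μ.map (fun ω => (X i ω, Y i ω)) = (μ.map (X i)).prod (μ.map (Y i)) := fun i =>
    (indepFun_iff_map_prod_eq_prod_map_map (hXm i).aemeasurable (hYm i).aemeasurable).1
      (hXY.comp (φ := fun x : ι → β => x i) (ψ := fun y : ι → γ => y i) (measurable_pi_apply i)
        (measurable_pi_apply i))
  simp only [hpair]
  have hXm' : Measurable (fun ω i => X i ω) := measurable_pi_iff.2 hXm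
  have hYm' : Measurable (fun ω i => Y i ω) := measurable_pi_iff.2 hYm
  have h1 := (indepFun_iff_map_prod_eq_prod_map_map hXm'.aemeasurable hYm'.aemeasurable).1 hXY
  rw [hX, hY, ← (measurePreserving_arrowProdEquivProdArrow β γ ι (fun i => μ.map (X i))
    (fun i => μ.map (Y i))).map_eq] at h1
  have h2 : (fun ω i => (X i ω, Y i ω)) = (MeasurableEquiv.arrowProdEquivProdArrow β γ ι).symm ∘
      (fun ω => (fun i => X i ω, fun i => Y i ω)) := rfl
  rw [h2, ← Measure.map_map (MeasurableEquiv.measurable _) (hXm'.prodMk hYm'), h1,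
    Measure.map_map (MeasurableEquiv.measurable _) (MeasurableEquiv.measurable _)]
  simp

end Concentration

/-! ### Two-stage least squares with empirical moments -/

section TwoStagePerturbed

variable {n k m : Type*} [Fintype n] [Fintype k] [DecidableEq k] [Fintype m] [DecidableEq m]

/-- The error of two-stage least squares when the empirical moment matrices are entrywise close to
population matrices `A₀`, `B₀` whose singular values lie in `[φA, ΦA]` and `[φB, ΦB]`. The relative
perturbations `0.12` and `0.1` cost less than the factor `2` of `kappa`. -/
lemma l2norm_twoSLS_sub_le_of_close {V : Matrix n k ℝ} {Z : Matrix n m ℝ} {R e : n → ℝ}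
    {β₀ : k → ℝ} (hR : R = V *ᵥ β₀ + e) {A₀ : Matrix k m ℝ} {B₀ : Matrix m m ℝ}
    {φA ΦA φB ΦB r yA yB : ℝ} (hr : 0 < r) (hφA : 0 < φA) (hφB : 0 < φB) (hΦA : φA ≤ ΦA)
    (hΦB : φB ≤ ΦB)
    (hAlow : ∀ y, φA * l2norm y ≤ l2norm (A₀ᵀ *ᵥ y)) (hAup : ∀ u, l2norm (A₀ *ᵥ u) ≤ ΦA * l2norm u)
    (hBlow : ∀ x, φB * l2norm x ^ 2 ≤ x ⬝ᵥ B₀ *ᵥ x) (hBup : ∀ x, x ⬝ᵥ B₀ *ᵥ x ≤ ΦB * l2norm x ^ 2)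
    (hyA : 0 ≤ yA) (hyB : 0 ≤ yB)
    (hyA' : √(Fintype.card k * Fintype.card m) * yA ≤ 12 / 100 * φA)
    (hyB' : Fintype.card m * yB ≤ 1 / 10 * φB)
    (hA : ∀ i j, |r * ∑ s, V s i * Z s j - A₀ i j| ≤ yA)
    (hB : ∀ i j, |r * ∑ s, Z s i * Z s j - B₀ i j| ≤ yB) :
    l2norm (twoSLS V Z R - β₀) ≤
      2 * ΦA * ΦB / (φA ^ 2 * φB) * l2norm (fun j => r * ∑ s, Z s j * e s) := by
  have hA1 : ∀ i j, |(r • (Vᵀ * Z)) i j - A₀ i j| ≤ yA := by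
    simpa [Matrix.mul_apply] using hA
  have hB1 : ∀ i j, |(r • (Zᵀ * Z)) i j - B₀ i j| ≤ yB := by
    simpa [Matrix.mul_apply] using hB
  have hN : r • (Zᵀ *ᵥ e) = fun j => r * ∑ s, Z s j * e s := by
    ext j
    simp [Matrix.mulVec, dotProduct]
  have hBc := abs_dotProduct_mulVec_sub_le hyB hB1 hyB'
  have h1 := l2norm_twoSLS_sub_le (V := V) (Z := Z) hR hr (s := 88 / 100 * φA)
    (S := 112 / 100 * ΦA) (b := 9 / 10 * φB) (β := 11 / 10 * ΦB)
    (by positivity) (by positivity) (by linarith) (by linarith)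
    (fun y => by
      have := le_l2norm_mulVec_of_close hyA hA1 hyA' hAlow y
      linarith)
    (fun u => by
      have h := l2norm_mulVec_le_of_close hyA hA1 hyA' hAup u
      have : φA * l2norm u ≤ ΦA * l2norm u := mul_le_mul_of_nonneg_right hΦA (l2norm_nonneg _)
      linarith)
    (fun x => by
      have := (abs_le.1 (hBc x)).1
      linarith [hBlow x])
    (fun x => by
      have h := (abs_le.1 (hBc x)).2
      have : φB * l2norm x ^ 2 ≤ ΦB * l2norm x ^ 2 := mul_le_mul_of_nonneg_right hΦB (sq_nonneg _)
      linarith [hBup x])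
  rw [hN] at h1
  refine h1.trans (mul_le_mul_of_nonneg_right ?_ (l2norm_nonneg _))
  · rw [div_le_div_iff₀ (by positivity) (by positivity)]
    have : 0 ≤ ΦA * ΦB * (φA ^ 2 * φB) := by
      have := hφA.le.trans hΦA
      have := hφB.le.trans hΦB
      positivity
    nlinarith

end TwoStagePerturbed

/-! ### Stacked vectors and block diagonal matrices -/

section Stack

variable {p q M : ℕ}

lemma stack_dotProduct (a : Fin M) (v : Fin p → ℝ) (w : Fin M × Fin p → ℝ) :
    stack a v ⬝ᵥ w = v ⬝ᵥ fun k => w (a, k) := by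
  simp [stack, dotProduct, Fintype.sum_prod_type]

lemma l2norm_stack (a : Fin M) (v : Fin p → ℝ) : l2norm (stack a v) = l2norm v := by
  rw [← pow_left_inj₀ (l2norm_nonneg _) (l2norm_nonneg _) two_ne_zero, sq_l2norm, sq_l2norm,
    stack_dotProduct]
  simp [stack]

lemma l2norm_block_le (w : Fin M × Fin p → ℝ) (i : Fin M) :
    l2norm (fun k => w (i, k)) ≤ l2norm w := by
  refine le_of_sq_le_sq ?_ (l2norm_nonneg _)
  rw [sq_l2norm_eq_sum, sq_l2norm_eq_sum, Fintype.sum_prod_type]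
  exact Finset.single_le_sum (f := fun i => ∑ k, w (i, k) ^ 2)
    (fun j _ => Finset.sum_nonneg fun k _ => sq_nonneg _) (Finset.mem_univ i)

/-- The block diagonal matrix with `M` equal blocks. -/
def blockDiag (M : ℕ) (A : Matrix (Fin p) (Fin q) ℝ) : Matrix (Fin M × Fin p) (Fin M × Fin q) ℝ :=
  Matrix.of fun ik jl => if ik.1 = jl.1 then A ik.2 jl.2 else 0

lemma blockDiag_transpose (A : Matrix (Fin p) (Fin q) ℝ) :
    (blockDiag M A)ᵀ = blockDiag M Aᵀ := by
  ext ⟨i, k⟩ ⟨j, l⟩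
  simp [blockDiag, eq_comm]

lemma blockDiag_mulVec_apply (A : Matrix (Fin p) (Fin q) ℝ) (w : Fin M × Fin q → ℝ) (i : Fin M)
    (k : Fin p) : (blockDiag M A *ᵥ w) (i, k) = (A *ᵥ fun l => w (i, l)) k := by
  simp [blockDiag, Matrix.mulVec, dotProduct, Fintype.sum_prod_type, Finset.sum_ite_irrel]

lemma blockDiag_mulVec_stack (A : Matrix (Fin p) (Fin q) ℝ) (a : Fin M) (v : Fin q → ℝ) :
    blockDiag M A *ᵥ stack a v = stack a (A *ᵥ v) := by
  ext ⟨i, k⟩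
  rw [blockDiag_mulVec_apply]
  by_cases h : a = i <;> simp [stack, h, Matrix.mulVec, dotProduct]

end Stack

/-! ### Population moments -/

section Population

variable {p q M : ℕ}

/-- `E[v zᵀ]`. -/
def SigmaVZ (ν : Measure (Obs p q)) : Matrix (Fin p) (Fin q) ℝ :=
  Matrix.of fun k l => ∫ x, x.v k * x.z l ∂ν

/-- Some arm other than `i` has, up to `c`, the same expected reward as arm `i`. -/
def nearTie (α : Fin M → Fin p → ℝ) (c : ℝ) (i : Fin M) (x : Obs p q) : Prop :=
  ∃ j, i ≠ j ∧ |x.v ⬝ᵥ (α i - α j)| ≤ c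

lemma measurable_dotProduct_v (w : Fin p → ℝ) : Measurable fun x : Obs p q => x.v ⬝ᵥ w := by
  simp only [dotProduct, Obs.v]
  fun_prop

lemma measurableSet_nearTie (α : Fin M → Fin p → ℝ) (c : ℝ) (i : Fin M) :
    MeasurableSet {x : Obs p q | nearTie α c i x} := by
  have h : {x : Obs p q | nearTie α c i x} =
      ⋃ j, ⋃ (_ : i ≠ j), {x : Obs p q | |x.v ⬝ᵥ (α i - α j)| ≤ c} := by
    ext x
    simp [nearTie]
  rw [h]
  refine MeasurableSet.iUnion fun j => MeasurableSet.iUnion fun _ => ?_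
  exact measurableSet_le (measurable_dotProduct_v _).abs measurable_const

lemma measurable_optStack (α : Fin M → Fin p → ℝ) (ik : Fin M × Fin p) :
    Measurable fun x : Obs p q => optStack α x.v ik := by
  unfold optStack
  refine Measurable.ite ?_ (by fun_prop) measurable_const
  have h : {x : Obs p q | ∀ j, j ≠ ik.1 → 0 < x.v ⬝ᵥ (α ik.1 - α j)} =
      ⋂ j, ⋂ (_ : j ≠ ik.1), {x : Obs p q | 0 < x.v ⬝ᵥ (α ik.1 - α j)} := by
    ext x
    simp
  rw [h]
  refine MeasurableSet.iInter fun j => MeasurableSet.iInter fun _ => ?_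
  exact measurableSet_lt measurable_const (measurable_dotProduct_v _)

namespace IVAssumption

variable {α : Fin M → Fin p → ℝ} {ν : Measure (Obs p q)}
  {ς : ℝ≥0} {σ vbar zbar L : ℝ}

lemma p_le_q (hA : IVAssumption ν α ς σ vbar zbar L) (hM : 2 ≤ M) : p ≤ q :=
  (Nat.le_mul_of_pos_left p (by omega)).trans hA.enough_instruments

lemma abs_v_le (hA : IVAssumption ν α ς σ vbar zbar L) : ∀ᵐ x ∂ν, ∀ k, |x.v k| ≤ vbar := by
  filter_upwards [hA.bounded_v] with x hx k
  exact (norm_le_pi_norm x.v k).trans hx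

lemma abs_z_le (hA : IVAssumption ν α ς σ vbar zbar L) : ∀ᵐ x ∂ν, ∀ l, |x.z l| ≤ zbar := by
  filter_upwards [hA.bounded_z] with x hx l
  exact (norm_le_pi_norm x.z l).trans hx

lemma noise_sub (hA : IVAssumption ν α ς σ vbar zbar L) :
    HasSubgaussianMGF (fun x : Obs p q => x.ε) (ς ^ 2) ν := by
  simpa [hA.noise_mean] using hA.noise_subGaussian

lemma nearTie_le (hA : IVAssumption ν α ς σ vbar zbar L) {c : ℝ} (hc : 0 < c) (i : Fin M) :
    ν.real {x | nearTie α c i x} ≤ (M - 1) * (L * c) := by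
  have h : {x : Obs p q | nearTie α c i x} =
      ⋃ j ∈ Finset.univ.erase i, {x : Obs p q | |x.v ⬝ᵥ (α i - α j)| ≤ c} := by
    ext x
    simp [nearTie, eq_comm]
  rw [h]
  refine (measureReal_biUnion_finset_le _ _).trans ?_
  refine (Finset.sum_le_sum fun j hj => hA.margin c hc i j (Finset.ne_of_mem_erase hj).symm).trans
    (le_of_eq ?_)
  have : 1 ≤ M := by have := i.2; omega
  rw [Finset.sum_const, Finset.card_erase_of_mem (Finset.mem_univ i), nsmul_eq_mul]
  simp [Nat.cast_sub this]

lemma abs_optStack_mul_le (hA : IVAssumption ν α ς σ vbar zbar L) :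
    ∀ᵐ x ∂ν, ∀ ik l, |optStack α x.v ik * x.z l| ≤ vbar * zbar := by
  filter_upwards [hA.abs_v_le, hA.abs_z_le] with x hv hz ik l
  rw [abs_mul]
  refine mul_le_mul ?_ (hz l) (abs_nonneg _) hA.vbar_pos.le
  unfold optStack
  split_ifs
  · exact hv _
  · simpa using hA.vbar_pos.le

lemma exists_nearTie_le (hA : IVAssumption ν α ς σ vbar zbar L) {c : ℝ} (hc : 0 < c) :
    ν.real {x | ∃ i, nearTie α c i x} ≤ M ^ 2 * (L * c) := by
  have h : {x : Obs p q | ∃ i, nearTie α c i x} = ⋃ i, {x : Obs p q | nearTie α c i x} := by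
    ext x
    simp
  rw [h]
  refine (measureReal_iUnion_fintype_le _).trans ?_
  refine (Finset.sum_le_sum fun i _ => hA.nearTie_le hc i).trans ?_
  rw [Finset.sum_const, nsmul_eq_mul, Finset.card_univ, Fintype.card_fin]
  have := hA.L_pos
  have : 0 ≤ L * c := by positivity
  have hM : (0 : ℝ) ≤ M := Nat.cast_nonneg M
  nlinarith [mul_nonneg hM this]

variable [IsProbabilityMeasure ν]

/-- Without covariates all the arms are tied, against the margin condition. -/
lemma p_pos (hA : IVAssumption ν α ς σ vbar zbar L) (hM : 2 ≤ M) : 0 < p := by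
  by_contra h
  obtain rfl : p = 0 := by omega
  have h1 := hA.margin (1 / (2 * L)) (by have := hA.L_pos; positivity) ⟨0, by omega⟩ ⟨1, by omega⟩
    (by simp)
  have h2 : {x : Obs 0 q | |x.v ⬝ᵥ (α ⟨0, by omega⟩ - α ⟨1, by omega⟩)| ≤ 1 / (2 * L)} =
      Set.univ := by
    ext x
    have := hA.L_pos
    simp [dotProduct]
    positivity
  have h3 : L * (1 / (2 * L)) = 1 / 2 := by
    have := hA.L_pos
    field_simp
  rw [h2, h3, probReal_univ] at h1
  norm_num at h1

lemma le_q (hA : IVAssumption ν α ς σ vbar zbar L) (hM : 2 ≤ M) : M ≤ q :=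
  (Nat.le_mul_of_pos_right M (hA.p_pos hM)).trans hA.enough_instruments

lemma integrable_zz (hA : IVAssumption ν α ς σ vbar zbar L) (l m : Fin q) :
    Integrable (fun x : Obs p q => x.z l * x.z m) ν := by
  refine Integrable.of_bound (C := zbar * zbar) (by fun_prop) ?_
  filter_upwards [hA.abs_z_le] with x hz
  rw [norm_mul]
  exact mul_le_mul (hz l) (hz m) (norm_nonneg _) hA.zbar_pos.le

lemma integrable_optStack_mul (hA : IVAssumption ν α ς σ vbar zbar L) (ik : Fin M × Fin p)
    (l : Fin q) : Integrable (fun x : Obs p q => optStack α x.v ik * x.z l) ν := by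
  refine Integrable.of_bound (C := vbar * zbar)
    ((measurable_optStack α ik).mul (by fun_prop)).aestronglyMeasurable ?_
  filter_upwards [hA.abs_optStack_mul_le] with x hx
  exact hx ik l

/-- Almost surely no two arms have the same expected reward. -/
lemma ae_ne (hA : IVAssumption ν α ς σ vbar zbar L) :
    ∀ᵐ x ∂ν, ∀ i j, i ≠ j → x.v ⬝ᵥ (α i - α j) ≠ 0 := by
  refine ae_all_iff.2 fun i => ae_all_iff.2 fun j => ?_
  by_cases hij : i = j
  · simp [hij]
  have h : ν.real {x : Obs p q | x.v ⬝ᵥ (α i - α j) = 0} ≤ 0 := by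
    refine le_of_forall_pos_le_add fun e he => ?_
    have h1 := hA.margin (e / L) (div_pos he hA.L_pos) i j hij
    rw [mul_div_cancel₀ _ hA.L_pos.ne'] at h1
    rw [zero_add]
    refine (measureReal_mono fun x hx => ?_).trans h1
    have hx' : x.v ⬝ᵥ (α i - α j) = 0 := by simpa using hx
    have := hA.L_pos
    simp only [Set.mem_ofPred_eq, hx', abs_zero]
    positivity
  have h2 : ν {x : Obs p q | x.v ⬝ᵥ (α i - α j) = 0} = 0 := by
    rw [← measureReal_eq_zero_iff]
    exact le_antisymm h measureReal_nonneg
  filter_upwards [measure_eq_zero_iff_ae_notMem.1 h2] with x hx _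
  simpa using hx

/-- Almost surely exactly one arm is strictly optimal, hence the blocks of `Σ*_vz` add up to
`E[v zᵀ]`. -/
lemma sum_SigmaVZStar (hA : IVAssumption ν α ς σ vbar zbar L) (hM : 2 ≤ M) (k : Fin p)
    (l : Fin q) : ∑ i, SigmaVZStar ν α (i, k) l = SigmaVZ ν k l := by
  simp only [SigmaVZStar, SigmaVZ, Matrix.of_apply]
  rw [← integral_finsetSum _ fun i _ => hA.integrable_optStack_mul (i, k) l]
  refine integral_congr_ae ?_
  filter_upwards [hA.ae_ne] with x hx
  have : Nonempty (Fin M) := ⟨⟨0, by omega⟩⟩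
  obtain ⟨i, hi⟩ := Finite.exists_max fun i => x.v ⬝ᵥ α i
  have hopt : ∀ j, j ≠ i → 0 < x.v ⬝ᵥ (α i - α j) := fun j hj => by
    refine lt_of_le_of_ne ?_ (hx i j hj.symm).symm
    rw [dotProduct_sub]
    linarith [hi j]
  rw [← Finset.sum_mul, Finset.sum_eq_single i]
  · simp only [optStack]
    rw [if_pos hopt]
  · intro j _ hj
    simp only [optStack]
    rw [if_neg]
    intro h
    have h1 := h i hj.symm
    have h2 := hopt j hj
    rw [dotProduct_sub] at h1 h2
    linarith
  · simp

lemma phiMin_star_pos (hA : IVAssumption ν α ς σ vbar zbar L) (hM : 2 ≤ M) :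
    0 < phiMin (SigmaVZStar ν α) := by
  have := hA.p_pos hM
  have : Nonempty (Fin M × Fin p) := ⟨(⟨0, by omega⟩, ⟨0, this⟩)⟩
  refine phiMin_pos (by simpa using hA.enough_instruments) ?_
  rw [hA.full_rank, min_eq_left hA.enough_instruments]
  simp

lemma phiMin_zz_pos (hA : IVAssumption ν α ς σ vbar zbar L) (hM : 2 ≤ M) :
    0 < phiMin (SigmaZZ ν) := by
  have := hA.le_q hM
  have : Nonempty (Fin q) := ⟨⟨0, by omega⟩⟩
  refine phiMin_pos le_rfl ?_
  exact Matrix.rank_of_isUnit _ hA.posDef.isUnit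

lemma phiMin_zz_le (hA : IVAssumption ν α ς σ vbar zbar L) (hM : 2 ≤ M) :
    phiMin (SigmaZZ ν) ≤ zbar ^ 2 := by
  have := hA.le_q hM
  set l : Fin q := ⟨0, by omega⟩
  have h := phiMin_mul_sq_le hA.posDef.posSemidef (Pi.single l 1)
  rw [sq_l2norm] at h
  simp only [mulVec_single_one, single_one_dotProduct, dotProduct_single_one, Pi.single_eq_same,
    mul_one] at h
  refine h.trans ?_
  simp only [SigmaZZ, Matrix.col_apply, Matrix.of_apply]
  calc ∫ x, x.z l * x.z l ∂ν ≤ ∫ _x, zbar ^ 2 ∂ν := by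
        refine integral_mono_ae (hA.integrable_zz l l) (integrable_const _) ?_
        filter_upwards [hA.abs_z_le] with x hx
        nlinarith [abs_le.1 (hx l), abs_nonneg (x.z l), abs_mul_abs_self (x.z l), hx l]
    _ = _ := by simp

end IVAssumption

lemma SigmaVZBreve_eq (ν : Measure (Obs p q)) :
    SigmaVZBreve M ν = blockDiag M ((1 / (M : ℝ)) • SigmaVZ ν) := by
  ext ⟨i, k⟩ ⟨j, l⟩
  simp only [SigmaVZBreve, blockDiag, SigmaVZ, Matrix.of_apply, Matrix.smul_apply, smul_eq_mul]
  by_cases h : i = j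
  · subst h
    rw [if_pos rfl, Finset.sum_eq_single i]
    · simp [stack]
    · intro b _ hb
      simp [stack, hb]
    · simp
  · rw [if_neg h, Finset.sum_eq_zero, mul_zero]
    intro a _
    by_cases hi : a = i
    · have : a ≠ j := fun hj => h (hi.symm.trans hj)
      simp [stack, this]
    · simp [stack, hi]

lemma SigmaZZBreve_eq (ν : Measure (Obs p q)) :
    SigmaZZBreve M ν = blockDiag M ((1 / (M : ℝ)) • SigmaZZ ν) := by
  ext ⟨i, k⟩ ⟨j, l⟩
  simp only [SigmaZZBreve, blockDiag, SigmaZZ, Matrix.of_apply, Matrix.smul_apply, smul_eq_mul]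
  by_cases h : i = j
  · subst h
    rw [if_pos rfl, Finset.sum_eq_single i]
    · simp [stack]
    · intro b _ hb
      simp [stack, hb]
    · simp
  · rw [if_neg h, Finset.sum_eq_zero, mul_zero]
    intro a _
    by_cases hi : a = i
    · have : a ≠ j := fun hj => h (hi.symm.trans hj)
      simp [stack, this]
    · simp [stack, hi]

lemma phiMin_blockDiag_mul_le (hM : 0 < M) (hpq : p ≤ q) (A : Matrix (Fin p) (Fin q) ℝ)
    (y : Fin p → ℝ) : phiMin (blockDiag M A) * l2norm y ≤ l2norm (Aᵀ *ᵥ y) := by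
  have h := phiMin_mul_le (blockDiag M A) (by simpa using Nat.mul_le_mul_left M hpq)
    (stack ⟨0, hM⟩ y)
  rwa [blockDiag_transpose, blockDiag_mulVec_stack, l2norm_stack, l2norm_stack] at h

lemma l2norm_mulVec_le_phiMax_blockDiag (hM : 0 < M) (A : Matrix (Fin p) (Fin q) ℝ)
    (u : Fin q → ℝ) : l2norm (A *ᵥ u) ≤ phiMax (blockDiag M A) * l2norm u := by
  have h := l2norm_mulVec_le_phiMax (blockDiag M A) (stack ⟨0, hM⟩ u)
  rwa [blockDiag_mulVec_stack, l2norm_stack, l2norm_stack] at h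

lemma posSemidef_blockDiag {A : Matrix (Fin q) (Fin q) ℝ} (hA : A.PosSemidef) :
    (blockDiag M A).PosSemidef := by
  have hAt : Aᵀ = A := by
    simpa [Matrix.IsHermitian, conjTranspose_eq_transpose_of_trivial] using hA.1
  refine Matrix.PosSemidef.of_dotProduct_mulVec_nonneg ?_ fun w => ?_
  · simp [Matrix.IsHermitian, conjTranspose_eq_transpose_of_trivial, blockDiag_transpose, hAt]
  · simp only [star_trivial, dotProduct, Fintype.sum_prod_type, blockDiag_mulVec_apply]
    refine Finset.sum_nonneg fun i _ => ?_
    simpa [dotProduct] using hA.dotProduct_mulVec_nonneg fun l => w (i, l)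

lemma phiMin_blockDiag_mul_sq_le (hM : 0 < M) {A : Matrix (Fin q) (Fin q) ℝ} (hA : A.PosSemidef)
    (x : Fin q → ℝ) : phiMin (blockDiag M A) * l2norm x ^ 2 ≤ x ⬝ᵥ A *ᵥ x := by
  have h := phiMin_mul_sq_le (posSemidef_blockDiag (M := M) hA) (stack ⟨0, hM⟩ x)
  rw [blockDiag_mulVec_stack, l2norm_stack, stack_dotProduct] at h
  simpa [stack] using h

lemma le_phiMax_blockDiag_mul_sq (hM : 0 < M) {A : Matrix (Fin q) (Fin q) ℝ} (hA : A.PosSemidef)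
    (x : Fin q → ℝ) : x ⬝ᵥ A *ᵥ x ≤ phiMax (blockDiag M A) * l2norm x ^ 2 := by
  have h := le_phiMax_mul_sq (posSemidef_blockDiag (M := M) hA) (stack ⟨0, hM⟩ x)
  rw [blockDiag_mulVec_stack, l2norm_stack, stack_dotProduct] at h
  simpa [stack] using h

/-- A block diagonal matrix with injective transposed blocks has a positive smallest singular
value. -/
lemma phiMin_blockDiag_pos (hM : 0 < M) (hp : 0 < p) (hpq : p ≤ q)
    {A : Matrix (Fin p) (Fin q) ℝ} (hA : ∀ y, Aᵀ *ᵥ y = 0 → y = 0) :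
    0 < phiMin (blockDiag M A) := by
  have : Nonempty (Fin M × Fin p) := ⟨(⟨0, hM⟩, ⟨0, hp⟩)⟩
  refine phiMin_pos_of_transpose_mulVec_ne_zero (by simpa using Nat.mul_le_mul_left M hpq)
    fun w hw => ?_
  ext ⟨i, k⟩
  refine congrFun (hA (fun k => w (i, k)) ?_) k
  ext l
  rw [← blockDiag_mulVec_apply, ← blockDiag_transpose, hw]
  rfl

namespace IVAssumption

variable {α : Fin M → Fin p → ℝ} {ν : Measure (Obs p q)} [IsProbabilityMeasure ν]
  {ς : ℝ≥0} {σ vbar zbar L : ℝ}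

/-- The smallest singular value of `E[v zᵀ]` is positive because `E[v zᵀ]` is the sum of the blocks
of `Σ*_vz`, which has full row rank. -/
lemma phiMin_breve_vz_pos (hA : IVAssumption ν α ς σ vbar zbar L) (hM : 2 ≤ M) :
    0 < phiMin (SigmaVZBreve M ν) := by
  rw [SigmaVZBreve_eq]
  refine phiMin_blockDiag_pos (by omega) (hA.p_pos hM) (hA.p_le_q hM) fun y hy => ?_
  have hM0 : (1 / (M : ℝ)) ≠ 0 := by
    have : (M : ℝ) ≠ 0 := by exact_mod_cast (by omega : M ≠ 0)
    positivity
  rw [transpose_smul, smul_mulVec] at hy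
  have hy1 := (smul_eq_zero.1 hy).resolve_left hM0
  have h1 : (SigmaVZStar ν α)ᵀ *ᵥ (fun ik : Fin M × Fin p => y ik.2) = 0 := by
    rw [← hy1]
    ext l
    simp only [Matrix.mulVec, dotProduct, Fintype.sum_prod_type, transpose_apply]
    rw [Finset.sum_comm]
    refine Finset.sum_congr rfl fun k _ => ?_
    rw [← Finset.sum_mul, hA.sum_SigmaVZStar hM]
  have h2 := phiMin_mul_le (SigmaVZStar ν α) (by simpa using hA.enough_instruments)
    (fun ik : Fin M × Fin p => y ik.2)
  rw [h1, l2norm_eq_zero.2 rfl] at h2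
  have h3 : l2norm (fun ik : Fin M × Fin p => y ik.2) = 0 :=
    le_antisymm (by nlinarith [hA.phiMin_star_pos hM]) (l2norm_nonneg _)
  ext k
  exact congrFun (l2norm_eq_zero.1 h3) (⟨0, by omega⟩, k)

lemma phiMin_breve_zz_pos (hA : IVAssumption ν α ς σ vbar zbar L) (hM : 2 ≤ M) :
    0 < phiMin (SigmaZZBreve M ν) := by
  rw [SigmaZZBreve_eq]
  refine phiMin_blockDiag_pos (by omega) (by have := hA.le_q hM; omega) le_rfl fun y hy => ?_
  have hM0 : (1 / (M : ℝ)) ≠ 0 := by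
    have : (M : ℝ) ≠ 0 := by exact_mod_cast (by omega : M ≠ 0)
    positivity
  rw [transpose_smul, smul_mulVec] at hy
  have hy1 := (smul_eq_zero.1 hy).resolve_left hM0
  have h2 := phiMin_mul_le (SigmaZZ ν) le_rfl y
  rw [hy1, l2norm_eq_zero.2 rfl] at h2
  exact l2norm_eq_zero.1 (le_antisymm (by nlinarith [hA.phiMin_zz_pos hM]) (l2norm_nonneg _))

lemma kappaBar_pos (hA : IVAssumption ν α ς σ vbar zbar L) (hM : 2 ≤ M) : 0 < kappaBar ν α := by
  have h1 := hA.phiMin_star_pos hM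
  have h2 := hA.phiMin_zz_pos hM
  have h3 := h1.trans_le (phiMin_le_phiMax _)
  have h4 := h2.trans_le (phiMin_le_phiMax _)
  unfold kappaBar kappa
  positivity

lemma kappaBreve_pos (hA : IVAssumption ν α ς σ vbar zbar L) (hM : 2 ≤ M) :
    0 < kappaBreve M ν := by
  have h1 := hA.phiMin_breve_vz_pos hM
  have h2 := hA.phiMin_breve_zz_pos hM
  have h3 := h1.trans_le (phiMin_le_phiMax _)
  have h4 := h2.trans_le (phiMin_le_phiMax _)
  unfold kappaBreve kappa
  positivity

end IVAssumption

end Population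

/-! ### Estimation error along a path -/

section Pathwise

variable {p q M : ℕ}

/-- The averaged noise `n⁻¹ ∑ z_s ε_s` over the periods of `S`. -/
def noiseMean (d : ℕ → Obs p q) (S : Finset ℕ) (n : ℝ) : Fin q → ℝ :=
  fun l => n⁻¹ * ∑ s ∈ S, (d s).z l * (d s).ε

/-- The empirical moments of the first phase that belong to arm `i` are within `uA`, `uB`, `uN` of
their expectations. -/
structure ArmGood (ν : Measure (Obs p q)) (d : ℕ → Obs p q) (a : ℕ → Fin M) (T₁ : ℕ)
    (uA uB uN : ℝ) (i : Fin M) : Prop where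
  vz : ∀ k l, |(T₁ : ℝ)⁻¹ * ∑ s ∈ Finset.Icc 1 T₁, (if a s = i then (d s).v k * (d s).z l else 0) -
    1 / (M : ℝ) * SigmaVZ ν k l| < uA
  zz : ∀ l m, |(T₁ : ℝ)⁻¹ * ∑ s ∈ Finset.Icc 1 T₁, (if a s = i then (d s).z l * (d s).z m else 0) -
    1 / (M : ℝ) * SigmaZZ ν l m| < uB
  noise : ∀ l, |(T₁ : ℝ)⁻¹ * ∑ s ∈ Finset.Icc 1 T₁, (if a s = i then (d s).z l * (d s).ε else 0) -
    0| < uN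

open Classical in
/-- The empirical moments of the periods `T₁ + 1, …, t`, with the covariates stacked according to
the optimal arms, the frequencies of near ties and the averaged noise are within `yA`, `yB`, `yT`,
`yN` of their expectations. -/
structure JointGood (ν : Measure (Obs p q)) (α : Fin M → Fin p → ℝ) (d : ℕ → Obs p q) (T₁ t : ℕ)
    (c yA yB yT yN : ℝ) : Prop where
  vz : ∀ ik l, |((t - T₁ : ℕ) : ℝ)⁻¹ * ∑ s ∈ Finset.Icc (T₁ + 1) t,
    optStack α (d s).v ik * (d s).z l - SigmaVZStar ν α ik l| < yA
  zz : ∀ l m, |((t - T₁ : ℕ) : ℝ)⁻¹ * ∑ s ∈ Finset.Icc (T₁ + 1) t, (d s).z l * (d s).z m -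
    SigmaZZ ν l m| < yB
  tie : ∀ i, |((t - T₁ : ℕ) : ℝ)⁻¹ * ∑ s ∈ Finset.Icc (T₁ + 1) t,
    (if nearTie α c i (d s) then 1 else 0) - ν.real {x | nearTie α c i x}| < yT
  noise : ∀ l, |((t - T₁ : ℕ) : ℝ)⁻¹ * ∑ s ∈ Finset.Icc (T₁ + 1) t, (d s).z l * (d s).ε - 0| < yN

variable {α : Fin M → Fin p → ℝ} {ν : Measure (Obs p q)} {ς : ℝ≥0} {σ vbar zbar L : ℝ}

/-- In the first phase the moments of the observations of arm `i` are normalized by `T₁`, not by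
the number of pulls, so that their expectations are the diagonal blocks of the two matrices in
`kappaBreve`. -/
lemma armEstimate_error [IsProbabilityMeasure ν] (hM : 2 ≤ M)
    (hA : IVAssumption ν α ς σ vbar zbar L) {d : ℕ → Obs p q} {a : ℕ → Fin M} {T₁ : ℕ}
    (hT₁ : 0 < T₁) {uA uB uN x : ℝ} {i : Fin M} (hg : ArmGood ν d a T₁ uA uB uN i)
    (huA : √(p * q) * uA ≤ 12 / 100 * phiMin (SigmaVZBreve M ν))
    (huB : q * uB ≤ 1 / 10 * phiMin (SigmaZZBreve M ν))
    (huN : kappaBreve M ν * (√q * uN) ≤ x) :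
    l2norm (armEstimate α d a T₁ i - α i) ≤ x := by
  have hp := hA.p_pos hM
  have hq : 0 < q := hp.trans_le (hA.p_le_q hM)
  have hMpos : 0 < M := by omega
  have hsum : ∀ f : ℕ → ℝ, ∑ s : {s // s ∈ (Finset.Icc 1 T₁).filter fun s => a s = i}, f s =
      ∑ s ∈ Finset.Icc 1 T₁, if a s = i then f s else 0 := fun f => by
    rw [Finset.sum_coe_sort _ f, Finset.sum_filter]
  have hB₀ : ((1 / (M : ℝ)) • SigmaZZ ν).PosSemidef := hA.posDef.posSemidef.smul (by positivity)
  have hr : (0 : ℝ) < (T₁ : ℝ)⁻¹ := by positivity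
  have h := l2norm_twoSLS_sub_le_of_close
    (V := Matrix.of fun s : {s // s ∈ (Finset.Icc 1 T₁).filter fun s => a s = i} => (d s).v)
    (Z := Matrix.of fun s => (d s).z) (R := fun s => reward α (d s) (a s))
    (e := fun s => (d s).ε) (β₀ := α i)
    (by
      ext s
      have hs : a s = i := (Finset.mem_filter.1 s.2).2
      simp [reward, hs, Matrix.mulVec])
    (A₀ := (1 / (M : ℝ)) • SigmaVZ ν) (B₀ := (1 / (M : ℝ)) • SigmaZZ ν) hr
    (hA.phiMin_breve_vz_pos hM) (hA.phiMin_breve_zz_pos hM) (phiMin_le_phiMax _)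
    (phiMin_le_phiMax _)
    (by rw [SigmaVZBreve_eq]; exact phiMin_blockDiag_mul_le hMpos (hA.p_le_q hM) _)
    (by rw [SigmaVZBreve_eq]; exact l2norm_mulVec_le_phiMax_blockDiag hMpos _)
    (by rw [SigmaZZBreve_eq]; exact phiMin_blockDiag_mul_sq_le hMpos hB₀)
    (by rw [SigmaZZBreve_eq]; exact le_phiMax_blockDiag_mul_sq hMpos hB₀)
    (yA := uA) (yB := uB)
    ((abs_nonneg _).trans (hg.vz ⟨0, hp⟩ ⟨0, hq⟩).le)
    ((abs_nonneg _).trans (hg.zz ⟨0, hq⟩ ⟨0, hq⟩).le)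
    (by simpa using huA) (by simpa using huB)
    (fun k l => by
      have h1 := (hg.vz k l).le
      rw [← hsum fun s => (d s).v k * (d s).z l] at h1
      exact h1)
    (fun l m => by
      have h1 := (hg.zz l m).le
      rw [← hsum fun s => (d s).z l * (d s).z m] at h1
      exact h1)
  refine h.trans (le_trans ?_ huN)
  refine mul_le_mul_of_nonneg_left ?_ (hA.kappaBreve_pos hM).le
  have h2 := l2norm_le_of_abs_le (x := fun l => (T₁ : ℝ)⁻¹ *
    ∑ s : {s // s ∈ (Finset.Icc 1 T₁).filter fun s => a s = i}, (d s).z l * (d s).ε) (y := uN)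
    ((abs_nonneg _).trans (hg.noise ⟨0, hq⟩).le)
    (fun l => by
      have h1 := (hg.noise l).le
      rw [← hsum fun s => (d s).z l * (d s).ε, sub_zero] at h1
      exact h1)
  simpa using h2

open Classical in
/-- Pulling an arm that maximizes the rewards predicted by estimates which are accurate up to
`c / 2` gives, unless there is a near tie with arm `i`, the same `i`-th block as the optimal arm. -/
lemma abs_stack_sub_optStack_le {θ : Fin M → Fin p → ℝ} {x : Obs p q} {c B : ℝ}
    {a : Fin M} (hθ : ∀ i, |x.v ⬝ᵥ (θ i - α i)| ≤ c / 2)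
    (hmax : ∀ i, x.v ⬝ᵥ θ i ≤ x.v ⬝ᵥ θ a) (hv : ∀ k, |x.v k| ≤ B) (ik : Fin M × Fin p) :
    |stack a x.v ik - optStack α x.v ik| ≤ if nearTie α c ik.1 x then B else 0 := by
  have hd : ∀ i j, x.v ⬝ᵥ θ i ≤ x.v ⬝ᵥ θ j → x.v ⬝ᵥ (α i - α j) ≤ c := fun i j hij => by
    have h1 := (abs_le.1 (hθ i)).1
    have h2 := (abs_le.1 (hθ j)).2
    rw [dotProduct_sub] at h1 h2 ⊢
    linarith
  have hc : 0 ≤ c := by linarith [(abs_nonneg _).trans (hθ a)]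
  obtain ⟨i, k⟩ := ik
  simp only [stack, optStack]
  by_cases ha : a = i
  · by_cases ho : ∀ j, j ≠ i → 0 < x.v ⬝ᵥ (α i - α j)
    · rw [if_pos ha, if_pos ho, sub_self, abs_zero]
      split_ifs
      · exact (abs_nonneg _).trans (hv k)
      · exact le_rfl
    · have hnt : nearTie α c i x := by
        push Not at ho
        obtain ⟨j, hj, hle⟩ := ho
        refine ⟨j, hj.symm, abs_le.2 ⟨?_, hle.trans hc⟩⟩
        have := hd j i (ha ▸ hmax j)
        rw [dotProduct_sub] at this ⊢
        linarith
      rw [if_pos ha, if_neg ho, if_pos hnt, sub_zero]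
      exact hv k
  · by_cases ho : ∀ j, j ≠ i → 0 < x.v ⬝ᵥ (α i - α j)
    · have hnt : nearTie α c i x := by
        refine ⟨a, fun h => ha h.symm, abs_le.2 ⟨?_, hd i a (hmax i)⟩⟩
        linarith [ho a ha]
      rw [if_neg ha, if_pos ho, if_pos hnt, zero_sub, abs_neg]
      exact hv k
    · rw [if_neg ha, if_neg ho, sub_self, abs_zero]
      split_ifs
      · exact (abs_nonneg _).trans (hv k)
      · exact le_rfl

/-- The moment matrix of the stacked covariates of the arms pulled differs from the one of the
optimal arms only through the frequency of near ties, whatever the dependence between the arms and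
the earlier draws. So the joint estimate is accurate as soon as averages of i.i.d. terms are. -/
lemma jointEstimate_error [IsProbabilityMeasure ν] (hM : 2 ≤ M)
    (hA : IVAssumption ν α ς σ vbar zbar L) {d : ℕ → Obs p q} {a : ℕ → Fin M} {T₁ t : ℕ}
    (ht : T₁ < t) {θ : ℕ → Fin M → Fin p → ℝ} {c mT yA yB yT yN : ℝ}
    (hg : JointGood ν α d T₁ t c yA yB yT yN)
    (hv : ∀ s ∈ Finset.Icc (T₁ + 1) t, ∀ k, |(d s).v k| ≤ vbar)
    (hz : ∀ s ∈ Finset.Icc (T₁ + 1) t, ∀ l, |(d s).z l| ≤ zbar)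
    (hθ : ∀ s ∈ Finset.Icc (T₁ + 1) t, ∀ i, |(d s).v ⬝ᵥ (θ s i - α i)| ≤ c / 2)
    (hmax : ∀ s ∈ Finset.Icc (T₁ + 1) t, ∀ i, (d s).v ⬝ᵥ θ s i ≤ (d s).v ⬝ᵥ θ s (a s))
    (hmT : ∀ i, ν.real {x | nearTie α c i x} ≤ mT)
    (hyA : √(M * p * q) * (yA + vbar * zbar * (yT + mT)) ≤
      12 / 100 * phiMin (SigmaVZStar ν α))
    (hyB : q * yB ≤ 1 / 10 * phiMin (SigmaZZ ν)) (i : Fin M) :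
    l2norm (jointEstimate α d a T₁ t i - α i) ≤
      kappaBar ν α * l2norm (noiseMean d (Finset.Icc (T₁ + 1) t) (t - T₁ : ℕ)) := by
  classical
  have hp := hA.p_pos hM
  have hq : 0 < q := hp.trans_le (hA.p_le_q hM)
  have hMpos : 0 < M := by omega
  set n : ℝ := ((t - T₁ : ℕ) : ℝ) with hn
  have hn0 : 0 < n := by
    rw [hn]
    exact_mod_cast Nat.sub_pos_of_lt ht
  have hr : (0 : ℝ) < n⁻¹ := by positivity
  have hsum : ∀ f : ℕ → ℝ, ∑ s : {s // s ∈ Finset.Icc (T₁ + 1) t}, f s =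
      ∑ s ∈ Finset.Icc (T₁ + 1) t, f s := fun f => Finset.sum_coe_sort _ f
  have hyA0 : 0 ≤ yA := (abs_nonneg _).trans (hg.vz (⟨0, hMpos⟩, ⟨0, hp⟩) ⟨0, hq⟩).le
  have hyT0 : 0 ≤ yT := (abs_nonneg _).trans (hg.tie i).le
  have hmT0 : 0 ≤ mT := measureReal_nonneg.trans (hmT i)
  have hv0 := hA.vbar_pos
  have hz0 := hA.zbar_pos
  have hVZ : ∀ ik l, |n⁻¹ * ∑ s ∈ Finset.Icc (T₁ + 1) t, stack (a s) (d s).v ik * (d s).z l -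
      SigmaVZStar ν α ik l| ≤ yA + vbar * zbar * (yT + mT) := by
    intro ik l
    have h1 : |n⁻¹ * ∑ s ∈ Finset.Icc (T₁ + 1) t, stack (a s) (d s).v ik * (d s).z l -
        n⁻¹ * ∑ s ∈ Finset.Icc (T₁ + 1) t, optStack α (d s).v ik * (d s).z l| ≤
        vbar * zbar * (n⁻¹ * ∑ s ∈ Finset.Icc (T₁ + 1) t,
          if nearTie α c ik.1 (d s) then (1 : ℝ) else 0) := by
      rw [← mul_sub, ← Finset.sum_sub_distrib, abs_mul, abs_of_pos hr, mul_left_comm,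
        Finset.mul_sum]
      refine mul_le_mul_of_nonneg_left ?_ hr.le
      refine (Finset.abs_sum_le_sum_abs _ _).trans (Finset.sum_le_sum fun s hs => ?_)
      rw [← sub_mul, abs_mul]
      have h2 := abs_stack_sub_optStack_le (x := d s) (hθ s hs) (hmax s hs) (hv s hs) ik
      have h3 := mul_le_mul h2 (hz s hs l) (abs_nonneg _) (by split_ifs <;> positivity)
      refine h3.trans (le_of_eq ?_)
      split_ifs <;> ring
    have h2 := (abs_lt.1 (hg.tie ik.1)).2
    have h3 : n⁻¹ * ∑ s ∈ Finset.Icc (T₁ + 1) t, (if nearTie α c ik.1 (d s) then (1 : ℝ) else 0) ≤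
        yT + mT := by linarith [hmT ik.1]
    have h4 := mul_le_mul_of_nonneg_left h3 (mul_pos hv0 hz0).le
    have h5 := abs_sub_le (n⁻¹ * ∑ s ∈ Finset.Icc (T₁ + 1) t, stack (a s) (d s).v ik * (d s).z l)
      (n⁻¹ * ∑ s ∈ Finset.Icc (T₁ + 1) t, optStack α (d s).v ik * (d s).z l) (SigmaVZStar ν α ik l)
    linarith [hg.vz ik l]
  have h := l2norm_twoSLS_sub_le_of_close
    (V := Matrix.of fun s : {s // s ∈ Finset.Icc (T₁ + 1) t} => stack (a s) (d s).v)
    (Z := Matrix.of fun s => (d s).z) (R := fun s => reward α (d s) (a s))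
    (e := fun s => (d s).ε) (β₀ := fun ik => α ik.1 ik.2)
    (by
      ext s
      simp [reward, Matrix.mulVec, stack_dotProduct])
    (A₀ := SigmaVZStar ν α) (B₀ := SigmaZZ ν) hr
    (hA.phiMin_star_pos hM) (hA.phiMin_zz_pos hM) (phiMin_le_phiMax _) (phiMin_le_phiMax _)
    (phiMin_mul_le _ (by simpa using hA.enough_instruments)) (l2norm_mulVec_le_phiMax _)
    (phiMin_mul_sq_le hA.posDef.posSemidef) (le_phiMax_mul_sq hA.posDef.posSemidef)
    (yA := yA + vbar * zbar * (yT + mT)) (yB := yB) (by positivity)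
    ((abs_nonneg _).trans (hg.zz ⟨0, hq⟩ ⟨0, hq⟩).le)
    (by simpa using hyA) (by simpa using hyB)
    (fun ik l => by
      have h1 := hVZ ik l
      rw [← hsum fun s => stack (a s) (d s).v ik * (d s).z l] at h1
      exact h1)
    (fun l m => by
      have h1 := (hg.zz l m).le
      rw [← hsum fun s => (d s).z l * (d s).z m] at h1
      exact h1)
  have h2 := (l2norm_block_le _ i).trans h
  simp only [Matrix.of_apply] at h2
  have h3 : (fun l => n⁻¹ * ∑ s : {s // s ∈ Finset.Icc (T₁ + 1) t}, (d s).z l * (d s).ε) =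
      noiseMean d (Finset.Icc (T₁ + 1) t) n := by
    ext l
    rw [hsum fun s => (d s).z l * (d s).ε, noiseMean]
  rw [h3] at h2
  exact h2

end Pathwise

/-! ### Propagation of accuracy from period to period -/

section Induction

variable {p q M : ℕ} {α : Fin M → Fin p → ℝ} {ν : Measure (Obs p q)} {ς : ℝ≥0}
  {σ vbar zbar L : ℝ}

/-- Tolerances for the empirical moments of the two phases which keep all the estimates within
`x` of the coefficients. The near ties that matter are those up to `2 √p v̄ x`. -/
structure Tolerances (ν : Measure (Obs p q)) (α : Fin M → Fin p → ℝ) (vbar zbar L : ℝ)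
    (x yA yB yT yN uA uB uN : ℝ) : Prop where
  x_pos : 0 < x
  yA_pos : 0 < yA
  yB_pos : 0 < yB
  yT_pos : 0 < yT
  yN_pos : 0 < yN
  uA_pos : 0 < uA
  uB_pos : 0 < uB
  uN_pos : 0 < uN
  explore_vz : √(p * q) * uA ≤ 12 / 100 * phiMin (SigmaVZBreve M ν)
  explore_zz : q * uB ≤ 1 / 10 * phiMin (SigmaZZBreve M ν)
  explore_noise : kappaBreve M ν * (√q * uN) ≤ x
  joint_vz : √(M * p * q) * (yA + vbar * zbar * (yT + (M - 1) * (L * (2 * (√p * vbar * x))))) ≤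
    12 / 100 * phiMin (SigmaVZStar ν α)
  joint_zz : q * yB ≤ 1 / 10 * phiMin (SigmaZZ ν)
  joint_noise : kappaBar ν α * (√q * yN) ≤ x

lemma abs_dotProduct_le_of_l2norm_le {v w : Fin p → ℝ} {y : ℝ} (hv0 : 0 ≤ vbar)
    (hv : ∀ k, |v k| ≤ vbar) (hw : l2norm w ≤ y) : |v ⬝ᵥ w| ≤ √p * vbar * y := by
  have h1 := l2norm_le_of_abs_le hv0 hv
  rw [Fintype.card_fin] at h1
  exact (abs_dotProduct_le v w).trans (mul_le_mul h1 hw (l2norm_nonneg _) (by positivity))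

/-- On the good event all the estimates stay within `x`, by strong induction on the period: the
estimates of the earlier periods being that accurate, the arms pulled so far differ from the optimal
ones only at near ties, so that the joint estimate of the current period is close to its population
counterpart. Its error is in fact a multiple of the averaged noise alone. -/
lemma estimate_error [IsProbabilityMeasure ν] (hM : 2 ≤ M)
    (hA : IVAssumption ν α ς σ vbar zbar L) {x yA yB yT yN uA uB uN : ℝ}
    (htol : Tolerances ν α vbar zbar L x yA yB yT yN uA uB uN)
    {d : ℕ → Obs p q} {a : ℕ → Fin M} {T₁ T₂ T : ℕ} (hT₁ : 0 < T₁) (hT₁₂ : T₁ ≤ T₂)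
    (hv : ∀ s ∈ Finset.Icc 1 T, ∀ k, |(d s).v k| ≤ vbar)
    (hz : ∀ s ∈ Finset.Icc 1 T, ∀ l, |(d s).z l| ≤ zbar)
    (hgreedy : ∀ t ∈ Finset.Icc (T₁ + 1) T, ∀ i,
      (d t).v ⬝ᵥ estimate α d a T₁ T₂ (t - 1) i ≤ (d t).v ⬝ᵥ estimate α d a T₁ T₂ (t - 1) (a t))
    (harm : ∀ i, ArmGood ν d a T₁ uA uB uN i)
    (hjoint : ∀ t ∈ Finset.Ioo T₂ T, JointGood ν α d T₁ t (2 * (√p * vbar * x)) yA yB yT yN) :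
    ∀ t ∈ Finset.Ico T₁ T, (∀ i, l2norm (estimate α d a T₁ T₂ t i - α i) ≤ x) ∧
      (T₂ < t → ∀ i, l2norm (estimate α d a T₁ T₂ t i - α i) ≤
        kappaBar ν α * l2norm (noiseMean d (Finset.Icc (T₁ + 1) t) (t - T₁ : ℕ))) := by
  intro t
  induction t using Nat.strong_induction_on with
  | _ t ih =>
    intro ht
    rw [Finset.mem_Ico] at ht
    by_cases htT : t ≤ T₂
    · refine ⟨fun i => ?_, fun h => absurd htT (not_le.2 h)⟩
      rw [estimate, if_pos htT]
      exact armEstimate_error hM hA hT₁ (harm i) htol.explore_vz htol.explore_zz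
        htol.explore_noise
    · have htT' : T₂ < t := not_le.1 htT
      have hsub : ∀ s ∈ Finset.Icc (T₁ + 1) t, s ∈ Finset.Icc 1 T := fun s hs => by
        simp only [Finset.mem_Icc] at hs ⊢
        omega
      have hg := hjoint t (Finset.mem_Ioo.2 ⟨htT', ht.2⟩)
      have hc : ∀ i, ν.real {y | nearTie α (2 * (√p * vbar * x)) i y} ≤
          (M - 1) * (L * (2 * (√p * vbar * x))) := fun i => by
        have := hA.vbar_pos
        have := htol.x_pos
        have : (0 : ℝ) < p := by exact_mod_cast hA.p_pos hM
        exact hA.nearTie_le (by positivity) i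
      have hmain : ∀ i, l2norm (estimate α d a T₁ T₂ t i - α i) ≤
          kappaBar ν α * l2norm (noiseMean d (Finset.Icc (T₁ + 1) t) (t - T₁ : ℕ)) := fun i => by
        rw [estimate, if_neg htT]
        refine jointEstimate_error hM hA (hT₁₂.trans_lt htT')
          (θ := fun s => estimate α d a T₁ T₂ (s - 1)) hg (fun s hs => hv s (hsub s hs))
          (fun s hs => hz s (hsub s hs)) (fun s hs i => ?_) (fun s hs i => ?_) hc
          htol.joint_vz htol.joint_zz i
        · rw [Finset.mem_Icc] at hs
          rw [mul_div_cancel_left₀ _ (two_ne_zero' ℝ)]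
          refine abs_dotProduct_le_of_l2norm_le hA.vbar_pos.le (hv s ?_) ?_
          · rw [Finset.mem_Icc]
            omega
          · refine (ih (s - 1) (by omega) ?_).1 i
            rw [Finset.mem_Ico]
            omega
        · refine hgreedy s ?_ i
          simp only [Finset.mem_Icc] at hs ⊢
          omega
      refine ⟨fun i => (hmain i).trans (le_trans ?_ htol.joint_noise), fun _ => hmain⟩
      refine mul_le_mul_of_nonneg_left ?_ (hA.kappaBar_pos hM).le
      have h1 := l2norm_le_of_abs_le (x := noiseMean d (Finset.Icc (T₁ + 1) t) (t - T₁ : ℕ))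
        htol.yN_pos.le (fun l => by simpa [noiseMean] using (hg.noise l).le)
      rwa [Fintype.card_fin] at h1

end Induction

/-! ### Loss of a single pull -/

section Gap

variable {p q M : ℕ} {α : Fin M → Fin p → ℝ}

/-- The loss from pulling arm `a` instead of the best arm. -/
def gap (α : Fin M → Fin p → ℝ) (x : Obs p q) (a : Fin M) : ℝ := oracleReward α x - reward α x a

lemma exists_gap_eq (x : Obs p q) (a : Fin M) :
    ∃ i, gap α x a = x.v ⬝ᵥ (α i - α a) ∧ ∀ j, x.v ⬝ᵥ α j ≤ x.v ⬝ᵥ α i := by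
  have : Nonempty (Fin M) := ⟨a⟩
  obtain ⟨i, hi⟩ := Finite.exists_max fun i => x.v ⬝ᵥ α i
  refine ⟨i, ?_, hi⟩
  have : ⨆ j, x.v ⬝ᵥ α j = x.v ⬝ᵥ α i :=
    le_antisymm (ciSup_le hi) (le_ciSup (f := fun j => x.v ⬝ᵥ α j) (Set.finite_range _).bddAbove i)
  rw [gap, oracleReward, reward, this, dotProduct_sub]
  ring

lemma gap_nonneg (x : Obs p q) (a : Fin M) : 0 ≤ gap α x a := by
  obtain ⟨i, h, hi⟩ := exists_gap_eq (α := α) x a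
  rw [h, dotProduct_sub]
  linarith [hi a]

lemma l2norm_sub_le_deltaBar {i j : Fin M} (hij : i ≠ j) : l2norm (α i - α j) ≤ deltaBar α :=
  le_ciSup (f := fun ij : {ij : Fin M × Fin M // ij.1 ≠ ij.2} =>
    ‖(WithLp.toLp 2 (α ij.1.1 - α ij.1.2) : EuclideanSpace ℝ (Fin p))‖)
    (Set.finite_range _).bddAbove ⟨(i, j), hij⟩

lemma deltaBar_nonneg : 0 ≤ deltaBar α := Real.iSup_nonneg fun _ => norm_nonneg _

lemma gap_le {vbar : ℝ} {x : Obs p q} (hv0 : 0 ≤ vbar) (hv : ∀ k, |x.v k| ≤ vbar) (a : Fin M) :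
    gap α x a ≤ √p * vbar * deltaBar α := by
  obtain ⟨i, h, -⟩ := exists_gap_eq (α := α) x a
  rw [h]
  by_cases hia : i = a
  · rw [hia, sub_self, dotProduct_zero]
    have := deltaBar_nonneg (α := α)
    positivity
  · exact (le_abs_self _).trans (abs_dotProduct_le_of_l2norm_le hv0 hv (l2norm_sub_le_deltaBar hia))

open Classical in
/-- A greedy arm for estimates accurate up to `c / 2` loses at most `c`, and nothing unless there
is a near tie up to `c`. -/
lemma gap_le_of_close {x : Obs p q} {a : Fin M} {θ : Fin M → Fin p → ℝ} {c : ℝ}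
    (hθ : ∀ i, |x.v ⬝ᵥ (θ i - α i)| ≤ c / 2) (hmax : ∀ i, x.v ⬝ᵥ θ i ≤ x.v ⬝ᵥ θ a) :
    gap α x a ≤ if ∃ i, nearTie α c i x then c else 0 := by
  obtain ⟨i, h, hi⟩ := exists_gap_eq (α := α) x a
  have h1 := (abs_le.1 (hθ i)).1
  have h2 := (abs_le.1 (hθ a)).2
  have h3 := hmax i
  have hle : x.v ⬝ᵥ (α i - α a) ≤ c := by
    rw [dotProduct_sub] at h1 h2 ⊢
    linarith
  have h0 := gap_nonneg (α := α) x a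
  rw [h] at h0 ⊢
  by_cases hia : i = a
  · rw [hia, sub_self, dotProduct_zero]
    have hc : 0 ≤ c := h0.trans hle
    split_ifs <;> simp [hc]
  · rw [if_pos ⟨i, a, hia, by rwa [abs_of_nonneg h0]⟩]
    exact hle

end Gap

/-! ### Union bounds -/

section UnionBound

variable {Ω : Type*} [MeasurableSpace Ω] {μ : Measure Ω} {ι : Type*} [Fintype ι]

lemma measureReal_exists_le [IsFiniteMeasure μ] {P : ι → Ω → Prop} {r : ℝ}
    (h : ∀ i, μ.real {ω | P i ω} ≤ r) : μ.real {ω | ∃ i, P i ω} ≤ Fintype.card ι * r := by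
  have h1 : {ω | ∃ i, P i ω} = ⋃ i, {ω | P i ω} := by
    ext ω
    simp
  rw [h1]
  refine (measureReal_iUnion_fintype_le _).trans ((Finset.sum_le_sum fun i _ => h i).trans ?_)
  simp

lemma measureReal_or_le [IsFiniteMeasure μ] {P Q : Ω → Prop} {r s : ℝ}
    (hP : μ.real {ω | P ω} ≤ r) (hQ : μ.real {ω | Q ω} ≤ s) :
    μ.real {ω | P ω ∨ Q ω} ≤ r + s := by
  have h1 : {ω | P ω ∨ Q ω} = {ω | P ω} ∪ {ω | Q ω} := by
    ext ω
    simp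
  rw [h1]
  exact (measureReal_union_le _ _).trans (add_le_add hP hQ)

end UnionBound

/-! ### Probabilities of inaccurate moments -/

section Run

variable {p q M : ℕ} {α : Fin M → Fin p → ℝ} {ν : Measure (Obs p q)} {ς : ℝ≥0}
  {σ vbar zbar L : ℝ} {Ω : Type*} [MeasurableSpace Ω] {μ : Measure Ω}
  {T₁ T₂ T : ℕ} {D : ℕ → Ω → Obs p q} {a : ℕ → Ω → Fin M}

namespace IsIVGreedyRun

lemma ae_draw (hrun : IsIVGreedyRun μ ν α T₁ T₂ T D a) {P : Obs p q → Prop}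
    (hP : ∀ᵐ x ∂ν, P x) : ∀ᵐ ω ∂μ, ∀ t ∈ Finset.Icc 1 T, P (D t ω) := by
  rw [ae_all_iff]
  intro t
  by_cases ht : t ∈ Finset.Icc 1 T
  · have h := hP
    rw [← hrun.law_draw t ht] at h
    filter_upwards [ae_of_ae_map (hrun.measurable_draw t ht).aemeasurable h] with ω hω _
    exact hω
  · exact ae_of_all _ fun ω h => absurd h ht

lemma integral_draw (hrun : IsIVGreedyRun μ ν α T₁ T₂ T D a) {t : ℕ} (ht : t ∈ Finset.Icc 1 T)
    {f : Obs p q → ℝ} (hf : Measurable f) : ∫ ω, f (D t ω) ∂μ = ∫ x, f x ∂ν := by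
  rw [← hrun.law_draw t ht, integral_map (hrun.measurable_draw t ht).aemeasurable
    hf.aestronglyMeasurable]

lemma subgaussian_draw (hrun : IsIVGreedyRun μ ν α T₁ T₂ T D a) {t : ℕ}
    (ht : t ∈ Finset.Icc 1 T) {f : Obs p q → ℝ} {c : ℝ≥0} (hf : HasSubgaussianMGF f c ν) :
    HasSubgaussianMGF (fun ω => f (D t ω)) c μ := by
  rw [← hrun.law_draw t ht] at hf
  exact hf.of_map (hrun.measurable_draw t ht).aemeasurable

lemma indep_draw_of_subset (hrun : IsIVGreedyRun μ ν α T₁ T₂ T D a) {S : Finset ℕ}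
    (hS : S ⊆ Finset.Icc 1 T) : iIndepFun (fun t : S => D t) μ :=
  hrun.indep_draw.precomp (g := fun t : S => (⟨t, hS t.2⟩ : Finset.Icc 1 T))
    fun _ _ h => Subtype.ext (congrArg (fun x : Finset.Icc 1 T => (x : ℕ)) h)

lemma measurable_ite_arm (hrun : IsIVGreedyRun μ ν α T₁ T₂ T D a) (hT : T₁ ≤ T) {t : ℕ}
    (ht : t ∈ Finset.Icc 1 T₁) (i : Fin M) {f : Obs p q → ℝ} (hf : Measurable f) :
    Measurable fun ω => if a t ω = i then f (D t ω) else 0 := by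
  have hS : Finset.Icc 1 T₁ ⊆ Finset.Icc 1 T := Finset.Icc_subset_Icc_right hT
  exact Measurable.ite (hrun.measurable_arm t (hS ht) (measurableSet_singleton i))
    (hf.comp (hrun.measurable_draw t (hS ht))) measurable_const

variable [IsProbabilityMeasure μ]

lemma average_draw_tail (hrun : IsIVGreedyRun μ ν α T₁ T₂ T D a) {S : Finset ℕ}
    (hS : S ⊆ Finset.Icc 1 T) {f : Obs p q → ℝ} (hf : Measurable f) {m : ℝ} {c : ℝ≥0}
    (hsub : HasSubgaussianMGF (fun x => f x - m) c ν) {n y Λ : ℝ} (hn : n = S.card) (hn0 : 0 < n)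
    (hy : 0 < y) (h : 2 * c * Λ ≤ n * y ^ 2) :
    μ.real {ω | y ≤ |n⁻¹ * ∑ s ∈ S, f (D s ω) - m|} ≤ 2 * Real.exp (-Λ) :=
  measure_le_abs_average_sub_le (X := fun s ω => f (D s ω))
    ((hrun.indep_draw_of_subset hS).comp (fun _ => f) fun _ => hf)
    (fun _ hs => hrun.subgaussian_draw (hS hs) hsub) hn hn0 hy h

open Classical in
/-- For a single period `t > T₁`, the empirical moments are accurate except with probability of
order `exp (-Λ)`. -/
lemma measure_not_jointGood_le [IsProbabilityMeasure ν] (hA : IVAssumption ν α ς σ vbar zbar L)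
    (hrun : IsIVGreedyRun μ ν α T₁ T₂ T D a) {t : ℕ} (ht : T₁ < t) (htT : t ≤ T)
    {c yA yB yT yN Λ : ℝ} (hyA : 0 < yA) (hyB : 0 < yB) (hyT : 0 < yT) (hyN : 0 < yN)
    (hA' : 2 * (vbar * zbar) ^ 2 * Λ ≤ (t - T₁ : ℕ) * yA ^ 2)
    (hB' : 2 * (zbar ^ 2) ^ 2 * Λ ≤ (t - T₁ : ℕ) * yB ^ 2)
    (hT' : 2 * Λ ≤ (t - T₁ : ℕ) * yT ^ 2)
    (hN' : 2 * (4 * zbar ^ 2 * ς ^ 2) * Λ ≤ (t - T₁ : ℕ) * yN ^ 2) :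
    μ.real {ω | ¬ JointGood ν α (fun s => D s ω) T₁ t c yA yB yT yN} ≤
      (M * p * q + q ^ 2 + M + q) * (2 * Real.exp (-Λ)) := by
  have hS : Finset.Icc (T₁ + 1) t ⊆ Finset.Icc 1 T := fun s hs => by
    simp only [Finset.mem_Icc] at hs ⊢
    omega
  have hn : ((t - T₁ : ℕ) : ℝ) = ((Finset.Icc (T₁ + 1) t).card : ℝ) := by
    rw [Nat.card_Icc]
    congr 1
    omega
  have hn0 : (0 : ℝ) < (t - T₁ : ℕ) := by exact_mod_cast Nat.sub_pos_of_lt ht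
  have hz0 := hA.zbar_pos
  have hv0 := hA.vbar_pos
  set n : ℝ := ((t - T₁ : ℕ) : ℝ)
  have h1 : ∀ il : (Fin M × Fin p) × Fin q, μ.real {ω | yA ≤ |n⁻¹ * ∑ s ∈ Finset.Icc (T₁ + 1) t,
      optStack α (D s ω).v il.1 * (D s ω).z il.2 - SigmaVZStar ν α il.1 il.2|} ≤
      2 * Real.exp (-Λ) := fun il => by
    have hm := (measurable_optStack (q := q) α il.1).mul
      (by fun_prop : Measurable fun x : Obs p q => x.z il.2)
    refine hrun.average_draw_tail hS (f := fun x => optStack α x.v il.1 * x.z il.2) hm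
      (subgaussian_sub_integral_of_abs_le (B := vbar * zbar) hm.aemeasurable ?_) hn hn0 hyA ?_
    · filter_upwards [hA.abs_optStack_mul_le] with x hx using hx _ _
    · rwa [Real.coe_toNNReal _ (by positivity)]
  have h2 : ∀ lm : Fin q × Fin q, μ.real {ω | yB ≤ |n⁻¹ * ∑ s ∈ Finset.Icc (T₁ + 1) t,
      (D s ω).z lm.1 * (D s ω).z lm.2 - SigmaZZ ν lm.1 lm.2|} ≤ 2 * Real.exp (-Λ) := fun lm => by
    have hm : Measurable fun x : Obs p q => x.z lm.1 * x.z lm.2 := by fun_prop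
    refine hrun.average_draw_tail hS (f := fun x => x.z lm.1 * x.z lm.2) hm
      (subgaussian_sub_integral_of_abs_le (B := zbar ^ 2) hm.aemeasurable ?_) hn hn0 hyB ?_
    · filter_upwards [hA.abs_z_le] with x hx
      rw [abs_mul, sq]
      exact mul_le_mul (hx _) (hx _) (abs_nonneg _) hz0.le
    · rwa [Real.coe_toNNReal _ (by positivity)]
  have h3 : ∀ i : Fin M, μ.real {ω | yT ≤ |n⁻¹ * ∑ s ∈ Finset.Icc (T₁ + 1) t,
      (if nearTie α c i (D s ω) then 1 else 0) - ν.real {x | nearTie α c i x}|} ≤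
      2 * Real.exp (-Λ) := fun i => by
    have hm : Measurable fun x : Obs p q => if nearTie α c i x then (1 : ℝ) else 0 :=
      Measurable.ite (measurableSet_nearTie α c i) measurable_const measurable_const
    have hmean : ∫ x, (if nearTie α c i x then (1 : ℝ) else 0) ∂ν =
        ν.real {x | nearTie α c i x} := by
      rw [← integral_indicator_one (measurableSet_nearTie α c i)]
      refine integral_congr_ae (ae_of_all _ fun x => ?_)
      simp [Set.indicator_apply]
    rw [← hmean]
    refine hrun.average_draw_tail hS (f := fun x => if nearTie α c i x then 1 else 0) hm
      (subgaussian_sub_integral_of_abs_le (B := 1) hm.aemeasurable ?_) hn hn0 hyT ?_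
    · refine ae_of_all _ fun x => ?_
      split_ifs <;> simp
    · simpa using hT'
  have h4 : ∀ l : Fin q, μ.real {ω | yN ≤ |n⁻¹ * ∑ s ∈ Finset.Icc (T₁ + 1) t,
      (D s ω).z l * (D s ω).ε - 0|} ≤ 2 * Real.exp (-Λ) := fun l => by
    have hm : Measurable fun x : Obs p q => x.z l * x.ε := by fun_prop
    refine hrun.average_draw_tail hS (f := fun x => x.z l * x.ε) hm
      (c := 4 * zbar.toNNReal ^ 2 * ς ^ 2) ?_ hn hn0 hyN ?_
    · simp only [sub_zero]
      refine subgaussian_of_abs_le_mul hA.noise_sub hm.aemeasurable ?_ (hA.valid_instruments l)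
      filter_upwards [hA.abs_z_le] with x hx
      rw [abs_mul, Real.coe_toNNReal _ hz0.le]
      exact mul_le_mul_of_nonneg_right (hx l) (abs_nonneg _)
    · push_cast
      rwa [Real.coe_toNNReal _ hz0.le]
  have h12 := measureReal_or_le (measureReal_or_le (measureReal_or_le (measureReal_exists_le h1)
    (measureReal_exists_le h2)) (measureReal_exists_le h3)) (measureReal_exists_le h4)
  refine (measureReal_mono fun ω hω => ?_).trans (h12.trans (le_of_eq ?_))
  · simp only [Set.mem_ofPred_eq] at hω ⊢
    by_contra hcon
    push Not at hcon
    obtain ⟨⟨⟨k1, k2⟩, k3⟩, k4⟩ := hcon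
    exact hω ⟨fun ik l => k1 (ik, l), fun l m => k2 (l, m), k3, k4⟩
  · simp
    ring

/-- In the first phase, the arm pulled and the draw of a period are independent, and the pairs of
different periods are independent. -/
lemma explore_pairs (hrun : IsIVGreedyRun μ ν α T₁ T₂ T D a) (hT : T₁ ≤ T) :
    iIndepFun (fun (t : Finset.Icc 1 T₁) ω => (a t ω, D t ω)) μ ∧
      ∀ t ∈ Finset.Icc 1 T₁, IndepFun (a t) (D t) μ := by
  have hS : Finset.Icc 1 T₁ ⊆ Finset.Icc 1 T := Finset.Icc_subset_Icc_right hT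
  refine ⟨iIndepFun_prodMk (fun t => hrun.measurable_arm t (hS t.2))
    (fun t => hrun.measurable_draw t (hS t.2)) hrun.explore_indep (hrun.indep_draw_of_subset hS) ?_,
    fun t ht => ?_⟩
  · exact hrun.explore_indep_draw.comp (φ := id)
      (ψ := fun (f : Finset.Icc 1 T → Obs p q) (t : Finset.Icc 1 T₁) => f ⟨t, hS t.2⟩)
      measurable_id (measurable_pi_iff.2 fun t => measurable_pi_apply _)
  · exact hrun.explore_indep_draw.comp (φ := fun f : Finset.Icc 1 T₁ → Fin M => f ⟨t, ht⟩)
      (ψ := fun f : Finset.Icc 1 T → Obs p q => f ⟨t, hS ht⟩)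
      (measurable_pi_apply _) (measurable_pi_apply _)

lemma integral_ite_arm (hrun : IsIVGreedyRun μ ν α T₁ T₂ T D a) (hT : T₁ ≤ T) {t : ℕ}
    (ht : t ∈ Finset.Icc 1 T₁) (i : Fin M) {f : Obs p q → ℝ} (hf : Measurable f) :
    ∫ ω, (if a t ω = i then f (D t ω) else 0) ∂μ = 1 / (M : ℝ) * ∫ x, f x ∂ν := by
  have hS : Finset.Icc 1 T₁ ⊆ Finset.Icc 1 T := Finset.Icc_subset_Icc_right hT
  have hg : Measurable fun b : Fin M => if b = i then (1 : ℝ) else 0 := measurable_of_finite _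
  have h1 := ((hrun.explore_pairs hT).2 t ht).comp hg hf
  have h2 := h1.integral_fun_mul_eq_mul_integral
    (hg.comp (hrun.measurable_arm t (hS ht))).aestronglyMeasurable
    (hf.comp (hrun.measurable_draw t (hS ht))).aestronglyMeasurable
  have h3 : ∫ ω, (if a t ω = i then (1 : ℝ) else 0) ∂μ = 1 / (M : ℝ) := by
    rw [← hrun.explore_uniform t ht i, ← integral_indicator_one
      (show MeasurableSet {ω | a t ω = i} from
        hrun.measurable_arm t (hS ht) (measurableSet_singleton i))]
    refine integral_congr_ae (ae_of_all _ fun ω => ?_)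
    simp [Set.indicator_apply]
  simp only [Function.comp_apply] at h2
  rw [h3, hrun.integral_draw (hS ht) hf] at h2
  rw [← h2]
  refine integral_congr_ae (ae_of_all _ fun ω => ?_)
  simp

lemma average_arm_tail (hrun : IsIVGreedyRun μ ν α T₁ T₂ T D a) (hT : T₁ ≤ T) (hT₁ : 0 < T₁)
    (i : Fin M) {f : Obs p q → ℝ} (hf : Measurable f) {m : ℝ} {c : ℝ≥0}
    (hsub : ∀ t ∈ Finset.Icc 1 T₁,
      HasSubgaussianMGF (fun ω => (if a t ω = i then f (D t ω) else 0) - m) c μ)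
    {y Λ : ℝ} (hy : 0 < y) (h : 2 * c * Λ ≤ T₁ * y ^ 2) :
    μ.real {ω | y ≤ |(T₁ : ℝ)⁻¹ * ∑ s ∈ Finset.Icc 1 T₁, (if a s ω = i then f (D s ω) else 0) -
      m|} ≤ 2 * Real.exp (-Λ) := by
  have hg : Measurable fun b : Fin M × Obs p q => if b.1 = i then f b.2 else 0 :=
    Measurable.ite (measurable_fst (measurableSet_singleton i)) (hf.comp measurable_snd)
      measurable_const
  exact measure_le_abs_average_sub_le (X := fun s ω => if a s ω = i then f (D s ω) else 0)
    ((hrun.explore_pairs hT).1.comp (fun _ b => if b.1 = i then f b.2 else 0) fun _ => hg)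
    hsub (by simp) (by exact_mod_cast hT₁) hy h

lemma subgaussian_ite_arm (hrun : IsIVGreedyRun μ ν α T₁ T₂ T D a) (hT : T₁ ≤ T) {t : ℕ}
    (ht : t ∈ Finset.Icc 1 T₁) (i : Fin M) {f : Obs p q → ℝ} (hf : Measurable f) {B : ℝ}
    (hB0 : 0 ≤ B) (hB : ∀ᵐ x ∂ν, |f x| ≤ B) :
    HasSubgaussianMGF (fun ω => (if a t ω = i then f (D t ω) else 0) - 1 / (M : ℝ) * ∫ x, f x ∂ν)
      (B ^ 2).toNNReal μ := by
  have hS : Finset.Icc 1 T₁ ⊆ Finset.Icc 1 T := Finset.Icc_subset_Icc_right hT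
  rw [← hrun.integral_ite_arm hT ht i hf]
  refine subgaussian_sub_integral_of_abs_le (hrun.measurable_ite_arm hT ht i hf).aemeasurable ?_
  filter_upwards [hrun.ae_draw hB] with ω hω
  split_ifs
  · exact hω t (hS ht)
  · simpa using hB0

/-- In the first phase, the empirical moments of all the arms are accurate except with probability
of order `exp (-Λ)`. -/
lemma measure_not_armGood_le [IsProbabilityMeasure ν] (hA : IVAssumption ν α ς σ vbar zbar L)
    (hrun : IsIVGreedyRun μ ν α T₁ T₂ T D a) (hT₁ : 0 < T₁) (hT : T₁ ≤ T)
    {uA uB uN Λ : ℝ} (huA : 0 < uA) (huB : 0 < uB) (huN : 0 < uN)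
    (hA' : 2 * (vbar * zbar) ^ 2 * Λ ≤ T₁ * uA ^ 2)
    (hB' : 2 * (zbar ^ 2) ^ 2 * Λ ≤ T₁ * uB ^ 2)
    (hN' : 2 * (4 * zbar ^ 2 * ς ^ 2) * Λ ≤ T₁ * uN ^ 2) :
    μ.real {ω | ∃ i, ¬ ArmGood ν (fun s => D s ω) (fun s => a s ω) T₁ uA uB uN i} ≤
      M * ((p * q + q ^ 2 + q) * (2 * Real.exp (-Λ))) := by
  have hS : Finset.Icc 1 T₁ ⊆ Finset.Icc 1 T := Finset.Icc_subset_Icc_right hT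
  have hz0 := hA.zbar_pos
  have hv0 := hA.vbar_pos
  have key : ∀ i, μ.real {ω | ¬ ArmGood ν (fun s => D s ω) (fun s => a s ω) T₁ uA uB uN i} ≤
      (p * q + q ^ 2 + q) * (2 * Real.exp (-Λ)) := by
    intro i
    have h1 : ∀ kl : Fin p × Fin q, μ.real {ω | uA ≤ |(T₁ : ℝ)⁻¹ * ∑ s ∈ Finset.Icc 1 T₁,
        (if a s ω = i then (D s ω).v kl.1 * (D s ω).z kl.2 else 0) -
        1 / (M : ℝ) * SigmaVZ ν kl.1 kl.2|} ≤ 2 * Real.exp (-Λ) := fun kl => by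
      have hm : Measurable fun x : Obs p q => x.v kl.1 * x.z kl.2 := by fun_prop
      refine hrun.average_arm_tail hT hT₁ i hm
        (fun t ht => hrun.subgaussian_ite_arm hT ht i hm (B := vbar * zbar) (by positivity) ?_)
        huA ?_
      · filter_upwards [hA.abs_v_le, hA.abs_z_le] with x hv hz
        rw [abs_mul]
        exact mul_le_mul (hv _) (hz _) (abs_nonneg _) hv0.le
      · rwa [Real.coe_toNNReal _ (by positivity)]
    have h2 : ∀ lm : Fin q × Fin q, μ.real {ω | uB ≤ |(T₁ : ℝ)⁻¹ * ∑ s ∈ Finset.Icc 1 T₁,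
        (if a s ω = i then (D s ω).z lm.1 * (D s ω).z lm.2 else 0) -
        1 / (M : ℝ) * SigmaZZ ν lm.1 lm.2|} ≤ 2 * Real.exp (-Λ) := fun lm => by
      have hm : Measurable fun x : Obs p q => x.z lm.1 * x.z lm.2 := by fun_prop
      refine hrun.average_arm_tail hT hT₁ i hm
        (fun t ht => hrun.subgaussian_ite_arm hT ht i hm (B := zbar ^ 2) (by positivity) ?_)
        huB ?_
      · filter_upwards [hA.abs_z_le] with x hx
        rw [abs_mul, sq]
        exact mul_le_mul (hx _) (hx _) (abs_nonneg _) hz0.le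
      · rwa [Real.coe_toNNReal _ (by positivity)]
    have h3 : ∀ l : Fin q, μ.real {ω | uN ≤ |(T₁ : ℝ)⁻¹ * ∑ s ∈ Finset.Icc 1 T₁,
        (if a s ω = i then (D s ω).z l * (D s ω).ε else 0) - 0|} ≤ 2 * Real.exp (-Λ) := fun l => by
      have hm : Measurable fun x : Obs p q => x.z l * x.ε := by fun_prop
      refine hrun.average_arm_tail hT hT₁ i hm (c := 4 * zbar.toNNReal ^ 2 * ς ^ 2)
        (fun t ht => ?_) huN ?_
      · simp only [sub_zero]
        refine subgaussian_of_abs_le_mul (hrun.subgaussian_draw (hS ht) hA.noise_sub)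
          (hrun.measurable_ite_arm hT ht i hm).aemeasurable ?_ ?_
        · filter_upwards [hrun.ae_draw hA.abs_z_le] with ω hω
          rw [Real.coe_toNNReal _ hz0.le]
          split_ifs
          · rw [abs_mul]
            exact mul_le_mul_of_nonneg_right (hω t (hS ht) l) (abs_nonneg _)
          · simp only [abs_zero]
            positivity
        · rw [hrun.integral_ite_arm hT ht i hm, hA.valid_instruments l, mul_zero]
      · push_cast
        rwa [Real.coe_toNNReal _ hz0.le]
    have h12 := measureReal_or_le (measureReal_or_le (measureReal_exists_le h1)
      (measureReal_exists_le h2)) (measureReal_exists_le h3)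
    refine (measureReal_mono fun ω hω => ?_).trans (h12.trans (le_of_eq ?_))
    · simp only [Set.mem_ofPred_eq] at hω ⊢
      by_contra hcon
      push Not at hcon
      obtain ⟨⟨k1, k2⟩, k3⟩ := hcon
      exact hω ⟨fun k l => k1 (k, l), fun l m => k2 (l, m), k3⟩
    · simp
      ring
  simpa using measureReal_exists_le key

end IsIVGreedyRun

end Run

/-! ### Expected loss in a period of the third phase -/

section Regret

variable {p q M : ℕ} {α : Fin M → Fin p → ℝ} {ν : Measure (Obs p q)} {ς : ℝ≥0}
  {σ vbar zbar L : ℝ} {Ω : Type*} [MeasurableSpace Ω] {μ : Measure Ω}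
  {T₁ T₂ T : ℕ} {D : ℕ → Ω → Obs p q} {a : ℕ → Ω → Fin M}

lemma l2norm_eq_sqrt {ι : Type*} [Fintype ι] (x : ι → ℝ) : l2norm x = √(∑ i, x i ^ 2) := by
  rw [← sq_l2norm_eq_sum, Real.sqrt_sq (l2norm_nonneg x)]

lemma measurable_l2norm {ι : Type*} [Fintype ι] : Measurable (l2norm : (ι → ℝ) → ℝ) := by
  have h : (l2norm : (ι → ℝ) → ℝ) = fun x => √(∑ i, x i ^ 2) := funext l2norm_eq_sqrt
  rw [h]
  fun_prop

lemma measurableSet_exists_nearTie (α : Fin M → Fin p → ℝ) :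
    MeasurableSet {b : ℝ × Obs p q | ∃ i, nearTie α b.1 i b.2} := by
  have h : {b : ℝ × Obs p q | ∃ i, nearTie α b.1 i b.2} =
      ⋃ i, ⋃ j, ⋃ (_ : i ≠ j), {b : ℝ × Obs p q | |b.2.v ⬝ᵥ (α i - α j)| ≤ b.1} := by
    ext b
    simp [nearTie]
  rw [h]
  refine MeasurableSet.iUnion fun i => MeasurableSet.iUnion fun j =>
    MeasurableSet.iUnion fun _ => ?_
  exact measurableSet_le ((measurable_dotProduct_v _).comp measurable_snd).abs measurable_fst

open Classical in
/-- The margin condition turns a random threshold `C`, independent of the draw, into a loss of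
order `E[C²]`. -/
lemma integral_nearTie_le [IsProbabilityMeasure μ] [IsProbabilityMeasure ν]
    (hA : IVAssumption ν α ς σ vbar zbar L) {C : Ω → ℝ}
    {Y : Ω → Obs p q} (hC : Measurable C) (hY : Measurable Y) (hC0 : ∀ ω, 0 ≤ C ω)
    (hC2 : MemLp C 2 μ) (hlaw : μ.map Y = ν) (hind : IndepFun C Y μ) :
    Integrable (fun ω => if ∃ i, nearTie α (C ω) i (Y ω) then C ω else 0) μ ∧
    ∫ ω, (if ∃ i, nearTie α (C ω) i (Y ω) then C ω else 0) ∂μ ≤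
      M ^ 2 * L * ∫ ω, C ω ^ 2 ∂μ := by
  set F : ℝ × Obs p q → ℝ := fun b => if ∃ i, nearTie α b.1 i b.2 then b.1 else 0 with hF
  have hFm : Measurable F :=
    Measurable.ite (measurableSet_exists_nearTie α) measurable_fst measurable_const
  have hCY : Measurable fun ω => (C ω, Y ω) := hC.prodMk hY
  have hint : Integrable (fun ω => F (C ω, Y ω)) μ := by
    refine (hC2.integrable (by norm_num)).mono' (hFm.comp hCY).aestronglyMeasurable
      (ae_of_all _ fun ω => ?_)
    simp only [hF]
    split_ifs
    · rw [Real.norm_eq_abs, abs_of_nonneg (hC0 ω)]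
    · simpa using hC0 ω
  refine ⟨hint, ?_⟩
  have hprod := (indepFun_iff_map_prod_eq_prod_map_map hC.aemeasurable hY.aemeasurable).1 hind
  rw [hlaw] at hprod
  have hCp : IsProbabilityMeasure (μ.map C) := Measure.isProbabilityMeasure_map hC.aemeasurable
  have hint' : Integrable F ((μ.map C).prod ν) := by
    rw [← hprod]
    exact (integrable_map_measure hFm.aestronglyMeasurable hCY.aemeasurable).2 hint
  have hsq : Integrable (fun c : ℝ => c ^ 2) (μ.map C) :=
    (integrable_map_measure (by fun_prop) hC.aemeasurable).2 hC2.integrable_sq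
  have hinner : ∀ c, 0 ≤ c → ∫ x, F (c, x) ∂ν ≤ M ^ 2 * L * c ^ 2 := by
    intro c hc
    rcases eq_or_lt_of_le hc with rfl | hc
    · simp [hF]
    have hm : MeasurableSet {x : Obs p q | ∃ i, nearTie α c i x} :=
      measurableSet_exists_nearTie α |>.preimage measurable_prodMk_left
    have h1 : ∫ x, F (c, x) ∂ν = c * ν.real {x | ∃ i, nearTie α c i x} := by
      rw [← integral_indicator_one hm, ← integral_const_mul]
      refine integral_congr_ae (ae_of_all _ fun x => ?_)
      simp [hF, Set.indicator_apply]
    rw [h1]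
    calc c * ν.real {x | ∃ i, nearTie α c i x} ≤ c * (M ^ 2 * (L * c)) :=
          mul_le_mul_of_nonneg_left (hA.exists_nearTie_le hc) hc.le
      _ = _ := by ring
  calc ∫ ω, F (C ω, Y ω) ∂μ = ∫ b, F b ∂((μ.map C).prod ν) := by
        rw [← hprod, integral_map hCY.aemeasurable hFm.aestronglyMeasurable]
    _ = ∫ c, ∫ x, F (c, x) ∂ν ∂(μ.map C) := integral_prod _ hint'
    _ ≤ ∫ c, M ^ 2 * L * c ^ 2 ∂(μ.map C) := by
        refine integral_mono_ae hint'.integral_prod_left (hsq.const_mul _) ?_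
        refine (ae_map_iff hC.aemeasurable ?_).2 (ae_of_all _ fun ω => hinner _ (hC0 ω))
        exact measurableSet_le
          (hFm.stronglyMeasurable.integral_prod_right (ν := ν)).measurable (by fun_prop)
    _ = _ := by
        rw [integral_const_mul, integral_map hC.aemeasurable (by fun_prop)]

namespace IsIVGreedyRun

lemma ae_gap_le (hA : IVAssumption ν α ς σ vbar zbar L)
    (hrun : IsIVGreedyRun μ ν α T₁ T₂ T D a) : ∀ᵐ ω ∂μ, ∀ t ∈ Finset.Icc 1 T,
      gap α (D t ω) (a t ω) ≤ √p * vbar * deltaBar α := by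
  filter_upwards [hrun.ae_draw hA.abs_v_le] with ω hω t ht
  exact gap_le hA.vbar_pos.le (hω t ht) _

lemma measurable_noiseMean (hrun : IsIVGreedyRun μ ν α T₁ T₂ T D a) {S : Finset ℕ}
    (hS : S ⊆ Finset.Icc 1 T) (n : ℝ) : Measurable fun ω => noiseMean (fun s => D s ω) S n := by
  refine measurable_pi_iff.2 fun l => ?_
  refine (Finset.measurable_sum _ fun s hs => ?_).const_mul _
  exact (by fun_prop : Measurable fun x : Obs p q => x.z l * x.ε).comp
    (hrun.measurable_draw s (hS hs))

/-- The averaged noise of earlier periods is independent of the draw of period `t`. -/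
lemma indepFun_noiseMean_draw (hrun : IsIVGreedyRun μ ν α T₁ T₂ T D a) {S : Finset ℕ}
    (hS : S ⊆ Finset.Icc 1 T) (n : ℝ) {t : ℕ} (ht : t ∈ Finset.Icc 1 T) (htS : t ∉ S) :
    IndepFun (fun ω => noiseMean (fun s => D s ω) S n) (D t) μ := by
  classical
  set S' : Finset (Finset.Icc 1 T) := Finset.univ.filter fun s => (s : ℕ) ∈ S with hS'
  set R' : Finset (Finset.Icc 1 T) := {⟨t, ht⟩} with hR'
  have hdisj : Disjoint S' R' := by
    rw [hR', Finset.disjoint_singleton_right, hS', Finset.mem_filter]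
    exact fun h => htS h.2
  have h := hrun.indep_draw.indepFun_finset S' R' hdisj
    (fun s => hrun.measurable_draw s s.2)
  have hmem : ∀ s (hs : s ∈ S), (⟨s, hS hs⟩ : Finset.Icc 1 T) ∈ S' := fun s hs => by
    rw [hS', Finset.mem_filter]
    exact ⟨Finset.mem_univ _, hs⟩
  -- The averaged noise as a function of the draws in the periods of `S` only.
  set g : (S' → Obs p q) → Fin q → ℝ := fun f l =>
    n⁻¹ * ∑ s ∈ S.attach, (f ⟨_, hmem s s.2⟩).z l * (f ⟨_, hmem s s.2⟩).ε with hg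
  have hgm : Measurable g := by
    refine measurable_pi_iff.2 fun l => ?_
    refine (Finset.measurable_sum _ fun s _ => ?_).const_mul _
    exact (by fun_prop : Measurable fun x : Obs p q => x.z l * x.ε).comp (measurable_pi_apply _)
  have h2 := h.comp hgm
    (measurable_pi_apply (⟨⟨t, ht⟩, Finset.mem_singleton_self _⟩ : R'))
  have heq : (fun ω => noiseMean (fun s => D s ω) S n) = g ∘ fun ω (s : S') => D s ω := by
    ext ω l
    simp only [noiseMean, hg, Function.comp_apply]
    rw [← Finset.sum_attach S]
  rw [heq]
  exact h2

variable [IsProbabilityMeasure μ]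

lemma integral_gap_le (hA : IVAssumption ν α ς σ vbar zbar L)
    (hrun : IsIVGreedyRun μ ν α T₁ T₂ T D a) {t : ℕ} (ht : t ∈ Finset.Icc 1 T) :
    ∫ ω, gap α (D t ω) (a t ω) ∂μ ≤ √p * vbar * deltaBar α := by
  calc ∫ ω, gap α (D t ω) (a t ω) ∂μ ≤ ∫ _ω, √p * vbar * deltaBar α ∂μ := by
        refine integral_mono_of_nonneg (ae_of_all _ fun ω => gap_nonneg _ _) (integrable_const _) ?_
        filter_upwards [hrun.ae_gap_le hA] with ω hω using hω t ht
    _ = _ := by simp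

variable [IsProbabilityMeasure ν]

/-- The mean squared norm of the averaged noise decays like the inverse number of periods. -/
lemma integral_sq_noiseMean_le (hA : IVAssumption ν α ς σ vbar zbar L)
    (hrun : IsIVGreedyRun μ ν α T₁ T₂ T D a) {S : Finset ℕ} (hS : S ⊆ Finset.Icc 1 T) {n : ℝ}
    (hn : n = S.card) (hn0 : 0 < n) :
    MemLp (fun ω => l2norm (noiseMean (fun s => D s ω) S n)) 2 μ ∧
    ∫ ω, l2norm (noiseMean (fun s => D s ω) S n) ^ 2 ∂μ ≤ q * (zbar ^ 2 * (2 * ς ^ 2)) / n := by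
  have hz0 := hA.zbar_pos
  have hm : ∀ l : Fin q, Measurable fun x : Obs p q => x.z l * x.ε := fun l => by fun_prop
  have hL : ∀ l : Fin q, MemLp (fun x : Obs p q => x.z l * x.ε) 2 ν := fun l => by
    refine (hA.noise_sub.memLp 2).of_le_mul (c := zbar) (hm l).aestronglyMeasurable ?_
    filter_upwards [hA.abs_z_le] with x hx
    rw [norm_mul]
    exact mul_le_mul_of_nonneg_right (hx l) (norm_nonneg _)
  have hLt : ∀ l, ∀ t ∈ S, MemLp (fun ω => (D t ω).z l * (D t ω).ε) 2 μ := fun l t ht => by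
    have h := hL l
    rw [← hrun.law_draw t (hS ht)] at h
    exact h.comp_of_map (hrun.measurable_draw t (hS ht)).aemeasurable
  have hv : ∀ l : Fin q, ∫ x : Obs p q, (x.z l * x.ε) ^ 2 ∂ν ≤ zbar ^ 2 * (2 * ς ^ 2) := fun l => by
    calc ∫ x : Obs p q, (x.z l * x.ε) ^ 2 ∂ν ≤ ∫ x : Obs p q, zbar ^ 2 * x.ε ^ 2 ∂ν := by
          refine integral_mono_ae (hL l).integrable_sq
            ((hA.noise_sub.memLp 2).integrable_sq.const_mul _) ?_
          filter_upwards [hA.abs_z_le] with x hx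
          rw [mul_pow]
          exact mul_le_mul_of_nonneg_right (sq_le_sq' (abs_le.1 (hx l)).1 (abs_le.1 (hx l)).2)
            (sq_nonneg _)
      _ ≤ _ := by
          rw [integral_const_mul]
          have := integral_sq_le_of_subgaussian hA.noise_sub
          push_cast at this
          exact mul_le_mul_of_nonneg_left this (by positivity)
  have hsum : ∀ l : Fin q, ∫ ω, (∑ s ∈ S, (D s ω).z l * (D s ω).ε) ^ 2 ∂μ ≤
      n * (zbar ^ 2 * (2 * ς ^ 2)) := fun l => by
    have h := integral_sq_sum_le (X := fun (s : S) ω => (D s ω).z l * (D s ω).ε)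
      (v := zbar ^ 2 * (2 * ς ^ 2))
      ((hrun.indep_draw_of_subset hS).comp (fun _ x => x.z l * x.ε) fun _ => hm l)
      (fun s => hLt l s s.2)
      (fun s => by rw [hrun.integral_draw (hS s.2) (hm l), hA.valid_instruments l])
      (fun s => by
        rw [hrun.integral_draw (f := fun x => (x.z l * x.ε) ^ 2) (hS s.2) ((hm l).pow_const 2)]
        exact hv l)
    rw [Fintype.card_coe, ← hn] at h
    refine le_trans (le_of_eq ?_) h
    refine integral_congr_ae (ae_of_all _ fun ω => ?_)
    simp only
    rw [Finset.sum_coe_sort S fun s => (D s ω).z l * (D s ω).ε]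
  have hLs : ∀ l : Fin q, MemLp (fun ω => ∑ s ∈ S, (D s ω).z l * (D s ω).ε) 2 μ := fun l =>
    memLp_finsetSum _ fun s hs => hLt l s hs
  have heq : ∀ ω, l2norm (noiseMean (fun s => D s ω) S n) ^ 2 =
      ∑ l, (n⁻¹) ^ 2 * (∑ s ∈ S, (D s ω).z l * (D s ω).ε) ^ 2 := fun ω => by
    rw [sq_l2norm_eq_sum]
    simp only [noiseMean, mul_pow]
  have hintl : ∀ l : Fin q, Integrable
      (fun ω => (n⁻¹) ^ 2 * (∑ s ∈ S, (D s ω).z l * (D s ω).ε) ^ 2) μ := fun l =>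
    (hLs l).integrable_sq.const_mul _
  constructor
  · refine (memLp_two_iff_integrable_sq ?_).2 ?_
    · exact (measurable_l2norm.comp (hrun.measurable_noiseMean hS n)).aestronglyMeasurable
    · simp only [heq]
      exact integrable_finsetSum _ fun l _ => hintl l
  · simp only [heq]
    rw [integral_finsetSum _ fun l _ => hintl l]
    calc ∑ l : Fin q, ∫ ω, (n⁻¹) ^ 2 * (∑ s ∈ S, (D s ω).z l * (D s ω).ε) ^ 2 ∂μ
        ≤ ∑ _l : Fin q, (n⁻¹) ^ 2 * (n * (zbar ^ 2 * (2 * ς ^ 2))) := by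
          refine Finset.sum_le_sum fun l _ => ?_
          rw [integral_const_mul]
          exact mul_le_mul_of_nonneg_left (hsum l) (by positivity)
      _ = _ := by
          rw [Finset.sum_const, Finset.card_univ, Fintype.card_fin, nsmul_eq_mul]
          field_simp

open Classical in
/-- Expected loss in a period of the third phase: outside of the bad event `B`, the estimation error
is at most a multiple of the averaged noise of the earlier periods, and it costs something only if
the draw is a near tie at this scale. -/
lemma integral_gap_le_of_error_le (hM : 2 ≤ M) (hA : IVAssumption ν α ς σ vbar zbar L)
    (hrun : IsIVGreedyRun μ ν α T₁ T₂ T D a) {B : Set Ω} (hB : MeasurableSet B) {t : ℕ}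
    (ht₁ : T₁ + 1 < t) (htT : t ≤ T)
    (herr : ∀ᵐ ω ∂μ, ω ∉ B → ∀ i,
      l2norm (estimate α (fun s => D s ω) (fun s => a s ω) T₁ T₂ (t - 1) i - α i) ≤
      kappaBar ν α * l2norm (noiseMean (fun s => D s ω) (Finset.Icc (T₁ + 1) (t - 1))
        (t - 1 - T₁ : ℕ))) :
    ∫ ω, gap α (D t ω) (a t ω) ∂μ ≤ √p * vbar * deltaBar α * μ.real B +
      8 * M ^ 2 * L * p * q * vbar ^ 2 * zbar ^ 2 * ς ^ 2 * kappaBar ν α ^ 2 /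
        (t - 1 - T₁ : ℕ) := by
  have ht : t ∈ Finset.Icc 1 T := by
    rw [Finset.mem_Icc]
    omega
  have hS : Finset.Icc (T₁ + 1) (t - 1) ⊆ Finset.Icc 1 T := fun s hs => by
    simp only [Finset.mem_Icc] at hs ⊢
    omega
  have hn : ((t - 1 - T₁ : ℕ) : ℝ) = ((Finset.Icc (T₁ + 1) (t - 1)).card : ℝ) := by
    rw [Nat.card_Icc]
    congr 1
    omega
  have hn0 : (0 : ℝ) < (t - 1 - T₁ : ℕ) := by
    exact_mod_cast (by omega : 0 < t - 1 - T₁)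
  set n : ℝ := ((t - 1 - T₁ : ℕ) : ℝ)
  have hκ := hA.kappaBar_pos hM
  have hv0 := hA.vbar_pos
  set r : ℝ := 2 * (√p * vbar * kappaBar ν α) with hr
  have hr0 : 0 ≤ r := by positivity
  set C : Ω → ℝ := fun ω =>
    r * l2norm (noiseMean (fun s => D s ω) (Finset.Icc (T₁ + 1) (t - 1)) n) with hC
  have hrm : Measurable fun w : Fin q → ℝ => r * l2norm w := measurable_l2norm.const_mul r
  have hCm : Measurable C := hrm.comp (hrun.measurable_noiseMean hS n)
  have hC0 : ∀ ω, 0 ≤ C ω := fun ω => mul_nonneg hr0 (l2norm_nonneg _)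
  obtain ⟨hL2, hint2⟩ := hrun.integral_sq_noiseMean_le hA hS hn hn0
  have hind : IndepFun C (D t) μ := by
    have htS : t ∉ Finset.Icc (T₁ + 1) (t - 1) := by
      rw [Finset.mem_Icc]
      omega
    exact (hrun.indepFun_noiseMean_draw hS n ht htS).comp hrm measurable_id
  obtain ⟨hFint, hFle⟩ := integral_nearTie_le hA hCm (hrun.measurable_draw t ht) hC0
    (hL2.const_mul r) (hrun.law_draw t ht) hind
  have hBint : Integrable (B.indicator fun _ => √p * vbar * deltaBar α) μ :=
    (integrable_const _).indicator hB
  calc ∫ ω, gap α (D t ω) (a t ω) ∂μ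
      ≤ ∫ ω, (B.indicator (fun _ => √p * vbar * deltaBar α) ω +
          if ∃ i, nearTie α (C ω) i (D t ω) then C ω else 0) ∂μ := by
        refine integral_mono_of_nonneg (ae_of_all _ fun ω => gap_nonneg _ _) (hBint.add hFint) ?_
        filter_upwards [hrun.ae_gap_le hA, herr, hrun.ae_draw hA.abs_v_le] with ω h1 h2 h3
        by_cases hω : ω ∈ B
        · rw [Set.indicator_of_mem hω]
          refine (h1 t ht).trans (le_add_of_nonneg_right ?_)
          split_ifs
          · exact hC0 ω
          · exact le_rfl
        · rw [Set.indicator_of_notMem hω, zero_add]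
          refine gap_le_of_close (θ := estimate α (fun s => D s ω) (fun s => a s ω) T₁ T₂ (t - 1))
            (fun i => ?_) (hrun.greedy t ?_ ω)
          · refine (abs_dotProduct_le_of_l2norm_le hv0.le (h3 t ht) (h2 hω i)).trans (le_of_eq ?_)
            simp only [hC, hr]
            ring
          · rw [Finset.mem_Icc]
            omega
    _ = √p * vbar * deltaBar α * μ.real B +
          ∫ ω, (if ∃ i, nearTie α (C ω) i (D t ω) then C ω else 0) ∂μ := by
        rw [integral_add hBint hFint, integral_indicator hB, setIntegral_const, smul_eq_mul,
          mul_comm]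
    _ ≤ _ := by
        refine add_le_add_right (hFle.trans ?_) _
        have h1 : ∫ ω, C ω ^ 2 ∂μ ≤ r ^ 2 * (q * (zbar ^ 2 * (2 * ς ^ 2)) / n) := by
          simp only [hC, mul_pow]
          rw [integral_const_mul]
          exact mul_le_mul_of_nonneg_left hint2 (sq_nonneg _)
        have hL := hA.L_pos
        refine (mul_le_mul_of_nonneg_left h1 (by positivity)).trans (le_of_eq ?_)
        simp only [hr, mul_pow, Real.sq_sqrt (Nat.cast_nonneg p)]
        ring

end IsIVGreedyRun

end Regret

/-! ### Summation over the periods -/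

section TotalRegret

variable {p q M : ℕ} {α : Fin M → Fin p → ℝ} {ν : Measure (Obs p q)} {ς : ℝ≥0}
  {σ vbar zbar L : ℝ} {Ω : Type*} [MeasurableSpace Ω] {μ : Measure Ω}
  {T₁ T₂ T : ℕ} {D : ℕ → Ω → Obs p q} {a : ℕ → Ω → Fin M}

lemma regret_nonneg : 0 ≤ regret μ α T D a :=
  Finset.sum_nonneg fun _ _ => integral_nonneg fun _ => gap_nonneg _ _

lemma sum_inv_le_one_add_log (T₁ T₂ T : ℕ) (h₁₂ : T₁ ≤ T₂) :
    ∑ t ∈ Finset.Icc (T₂ + 2) T, ((t - 1 - T₁ : ℕ) : ℝ)⁻¹ ≤ 1 + Real.log T := by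
  have h1 : ∑ t ∈ Finset.Icc (T₂ + 2) T, ((t - 1 - T₁ : ℕ) : ℝ)⁻¹ ≤
      ∑ i ∈ Finset.range T, ((i + 1 : ℕ) : ℝ)⁻¹ := by
    have hinj : Set.InjOn (fun t => t - 2 - T₁) (Finset.Icc (T₂ + 2) T) := by
      intro s hs t ht hst
      simp only [Finset.mem_coe, Finset.mem_Icc] at hs ht hst
      omega
    have heq : ∑ t ∈ Finset.Icc (T₂ + 2) T, ((t - 1 - T₁ : ℕ) : ℝ)⁻¹ =
        ∑ i ∈ (Finset.Icc (T₂ + 2) T).image (fun t => t - 2 - T₁), ((i + 1 : ℕ) : ℝ)⁻¹ := by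
      rw [Finset.sum_image hinj]
      refine Finset.sum_congr rfl fun t ht => ?_
      rw [Finset.mem_Icc] at ht
      congr 2
      omega
    rw [heq]
    refine Finset.sum_le_sum_of_subset_of_nonneg (fun i hi => ?_) fun _ _ _ => by positivity
    obtain ⟨t, ht, rfl⟩ := Finset.mem_image.1 hi
    rw [Finset.mem_Icc] at ht
    rw [Finset.mem_range]
    omega
  have h2 : ((harmonic T : ℚ) : ℝ) ≤ 1 + Real.log T := harmonic_le_one_add_log T
  rw [harmonic] at h2
  push_cast at h2 h1
  exact h1.trans h2

namespace IsIVGreedyRun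

variable [IsProbabilityMeasure μ]

lemma regret_le_card_mul (hA : IVAssumption ν α ς σ vbar zbar L)
    (hrun : IsIVGreedyRun μ ν α T₁ T₂ T D a) :
    regret μ α T D a ≤ T * (√p * vbar * deltaBar α) := by
  refine (Finset.sum_le_sum fun t ht => hrun.integral_gap_le hA ht).trans (le_of_eq ?_)
  simp

variable [IsProbabilityMeasure ν]

/-- The regret in terms of the tolerances for the empirical moments, whose violations have
probabilities of order `exp (-Λ)`. -/
lemma regret_le_of_tolerances (hM : 2 ≤ M) (hA : IVAssumption ν α ς σ vbar zbar L)
    {x yA yB yT yN uA uB uN Λ : ℝ} (htol : Tolerances ν α vbar zbar L x yA yB yT yN uA uB uN)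
    (hrun : IsIVGreedyRun μ ν α T₁ T₂ T D a) (hT₁ : 0 < T₁) (hT₁₂ : T₁ ≤ T₂) (hT₂ : T₂ < T)
    (huA : 2 * (vbar * zbar) ^ 2 * Λ ≤ T₁ * uA ^ 2)
    (huB : 2 * (zbar ^ 2) ^ 2 * Λ ≤ T₁ * uB ^ 2)
    (huN : 2 * (4 * zbar ^ 2 * ς ^ 2) * Λ ≤ T₁ * uN ^ 2)
    (hyA : 2 * (vbar * zbar) ^ 2 * Λ ≤ (T₂ - T₁ : ℕ) * yA ^ 2)
    (hyB : 2 * (zbar ^ 2) ^ 2 * Λ ≤ (T₂ - T₁ : ℕ) * yB ^ 2)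
    (hyT : 2 * Λ ≤ (T₂ - T₁ : ℕ) * yT ^ 2)
    (hyN : 2 * (4 * zbar ^ 2 * ς ^ 2) * Λ ≤ (T₂ - T₁ : ℕ) * yN ^ 2) :
    regret μ α T D a ≤ √p * vbar * deltaBar α * (T₂ + 1 +
        T * (M * ((p * q + q ^ 2 + q) * (2 * Real.exp (-Λ))) +
          T * ((M * p * q + q ^ 2 + M + q) * (2 * Real.exp (-Λ))))) +
      8 * M ^ 2 * L * p * q * vbar ^ 2 * zbar ^ 2 * ς ^ 2 * kappaBar ν α ^ 2 *
        (1 + Real.log T) := by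
  set Δ : ℝ := √p * vbar * deltaBar α with hΔ
  have hΔ0 : 0 ≤ Δ := by
    have := hA.vbar_pos
    have := deltaBar_nonneg (α := α)
    positivity
  set K : ℝ := 8 * M ^ 2 * L * p * q * vbar ^ 2 * zbar ^ 2 * ς ^ 2 * kappaBar ν α ^ 2 with hK
  have hK0 : 0 ≤ K := by
    have := hA.L_pos
    positivity
  set c : ℝ := 2 * (√p * vbar * x) with hc
  set E : Set Ω := {ω | (∃ i, ¬ ArmGood ν (fun s => D s ω) (fun s => a s ω) T₁ uA uB uN i) ∨
    ∃ t : Finset.Ioo T₂ T, ¬ JointGood ν α (fun s => D s ω) T₁ t c yA yB yT yN} with hE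
  set P : ℝ := M * ((p * q + q ^ 2 + q) * (2 * Real.exp (-Λ))) +
    T * ((M * p * q + q ^ 2 + M + q) * (2 * Real.exp (-Λ))) with hP
  have hEP : μ.real E ≤ P := by
    refine (measureReal_or_le
      (hrun.measure_not_armGood_le hA hT₁ (by omega) htol.uA_pos htol.uB_pos htol.uN_pos
        huA huB huN)
      (measureReal_exists_le (r := (M * p * q + q ^ 2 + M + q) * (2 * Real.exp (-Λ)))
        fun t => ?_)).trans ?_
    · have ht := Finset.mem_Ioo.1 t.2
      have hmono : ∀ y : ℝ, ((T₂ - T₁ : ℕ) : ℝ) * y ^ 2 ≤ ((t - T₁ : ℕ) : ℝ) * y ^ 2 := fun y =>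
        mul_le_mul_of_nonneg_right (by exact_mod_cast Nat.sub_le_sub_right ht.1.le T₁)
          (sq_nonneg y)
      exact hrun.measure_not_jointGood_le hA (by omega) ht.2.le htol.yA_pos htol.yB_pos htol.yT_pos
        htol.yN_pos (hyA.trans (hmono _)) (hyB.trans (hmono _)) (hyT.trans (hmono _))
        (hyN.trans (hmono _))
    · rw [hP]
      refine add_le_add_right (mul_le_mul_of_nonneg_right ?_ (by positivity)) _
      rw [Fintype.card_coe, Nat.card_Ioo]
      exact_mod_cast (by omega : T - T₂ - 1 ≤ T)
  -- A measurable superset of the same measure spares a proof that the bad event is measurable.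
  set B : Set Ω := toMeasurable μ E with hB
  have hBm : MeasurableSet B := measurableSet_toMeasurable μ E
  have hBP : μ.real B ≤ P := by
    rwa [measureReal_def, hB, measure_toMeasurable, ← measureReal_def]
  have hlate : ∀ t ∈ Finset.Icc (T₂ + 2) T, ∫ ω, gap α (D t ω) (a t ω) ∂μ ≤
      Δ * P + K * ((t - 1 - T₁ : ℕ) : ℝ)⁻¹ := by
    intro t ht
    rw [Finset.mem_Icc] at ht
    rw [← div_eq_mul_inv]
    refine (hrun.integral_gap_le_of_error_le hM hA hBm (by omega) ht.2 ?_).trans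
      (add_le_add_left (mul_le_mul_of_nonneg_left hBP hΔ0) _)
    filter_upwards [hrun.ae_draw hA.abs_v_le, hrun.ae_draw hA.abs_z_le] with ω hv hz hω
    have hωE : ω ∉ E := fun h => hω (subset_toMeasurable μ E h)
    simp only [hE, Set.mem_ofPred_eq] at hωE
    push Not at hωE
    exact (estimate_error hM hA htol hT₁ hT₁₂ hv hz (fun s hs => hrun.greedy s hs ω) hωE.1
      (fun s hs => hωE.2 ⟨s, hs⟩) (t - 1) (by rw [Finset.mem_Ico]; omega)).2 (by omega)
  have hsplit : Finset.Icc 1 T = Finset.Icc 1 (T₂ + 1) ∪ Finset.Icc (T₂ + 2) T := by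
    ext t
    simp only [Finset.mem_union, Finset.mem_Icc]
    omega
  have hdisj : Disjoint (Finset.Icc 1 (T₂ + 1)) (Finset.Icc (T₂ + 2) T) := by
    rw [Finset.disjoint_left]
    intro t h1 h2
    rw [Finset.mem_Icc] at h1 h2
    omega
  have hearly : ∑ t ∈ Finset.Icc 1 (T₂ + 1), ∫ ω, gap α (D t ω) (a t ω) ∂μ ≤ (T₂ + 1) * Δ := by
    refine (Finset.sum_le_sum fun t ht => hrun.integral_gap_le hA ?_).trans (le_of_eq ?_)
    · rw [hsplit]
      exact Finset.mem_union_left _ ht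
    · simp [hΔ]
  have hPn : 0 ≤ P := measureReal_nonneg.trans hBP
  have hlate_sum : ∑ t ∈ Finset.Icc (T₂ + 2) T, ∫ ω, gap α (D t ω) (a t ω) ∂μ ≤
      T * (Δ * P) + K * (1 + Real.log T) := by
    refine (Finset.sum_le_sum hlate).trans ?_
    rw [Finset.sum_add_distrib, Finset.sum_const, nsmul_eq_mul, ← Finset.mul_sum]
    refine add_le_add (mul_le_mul_of_nonneg_right ?_ (by positivity))
      (mul_le_mul_of_nonneg_left (sum_inv_le_one_add_log T₁ T₂ T hT₁₂) hK0)
    rw [Nat.card_Icc]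
    exact_mod_cast (by omega : T + 1 - (T₂ + 2) ≤ T)
  calc regret μ α T D a = ∑ t ∈ Finset.Icc 1 T, ∫ ω, gap α (D t ω) (a t ω) ∂μ := rfl
    _ ≤ (T₂ + 1) * Δ + (T * (Δ * P) + K * (1 + Real.log T)) := by
        rw [hsplit, Finset.sum_union hdisj]
        exact add_le_add hearly hlate_sum
    _ = _ := by ring

end IsIVGreedyRun

end TotalRegret

/-! ### Tolerances that the constants allow -/

section Constants

variable {p q M : ℕ} {α : Fin M → Fin p → ℝ} {ν : Measure (Obs p q)} [IsProbabilityMeasure ν]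
  {ς : ℝ≥0} {σ vbar zbar L : ℝ}

/-- The accuracy of the estimates that is small enough, by the margin condition, for the greedy arms
to differ from the optimal ones in a share of the periods that `η` can absorb. -/
def targetError (M p q : ℕ) (vbar zbar L η : ℝ) : ℝ :=
  η / (5 * M * L * √p * vbar ^ 2 * zbar * √(M * p * q))

lemma mul_sqrt_mul_div_cancel {κ s x : ℝ} (hκ : 0 < κ) (hs : 0 < s) :
    κ * (s * (x / (κ * s))) = x := by
  field_simp

/-- Large constants leave room for tolerances at which every bad event has probability of order
`exp (-3 log T)`; the right-hand sides are the exponents of the tail bounds divided by `log T`. -/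
lemma exists_tolerances (hM : 2 ≤ M) (hA : IVAssumption ν α ς σ vbar zbar L) {η CA C₁ C₂ : ℝ}
    (hC : LargeConstants ν α ς vbar zbar L η CA C₁ C₂) :
    ∃ x yA yB yT yN uA uB uN : ℝ, Tolerances ν α vbar zbar L x yA yB yT yN uA uB uN ∧
      6 * (vbar * zbar) ^ 2 ≤ C₁ * uA ^ 2 ∧ 6 * (zbar ^ 2) ^ 2 ≤ C₁ * uB ^ 2 ∧
      24 * (zbar ^ 2 * ς ^ 2) ≤ C₁ * uN ^ 2 ∧ 6 * (vbar * zbar) ^ 2 ≤ C₂ * yA ^ 2 ∧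
      6 * (zbar ^ 2) ^ 2 ≤ C₂ * yB ^ 2 ∧ 6 ≤ C₂ * yT ^ 2 ∧
      24 * (zbar ^ 2 * ς ^ 2) ≤ C₂ * yN ^ 2 := by
  have hv := hA.vbar_pos
  have hz := hA.zbar_pos
  have hL := hA.L_pos
  have hη := hC.eta_pos
  have hp : (0 : ℝ) < p := by exact_mod_cast hA.p_pos hM
  have hMq : (M : ℝ) ≤ q := by exact_mod_cast hA.le_q hM
  have hM2 : (2 : ℝ) ≤ M := by exact_mod_cast hM
  have hq : (0 : ℝ) < q := by linarith
  have hM0 : (0 : ℝ) < M := by linarith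
  have hMM : (4 : ℝ) ≤ M ^ 2 := by nlinarith only [hM2]
  have hMM' : (M : ℝ) / 2 ≤ (M - 1) ^ 2 := by nlinarith only [hM2]
  have hMq4 : (4 : ℝ) ≤ M * q := by nlinarith only [hM2, hMq]
  have hκ := hA.kappaBar_pos hM
  have hκ' := hA.kappaBreve_pos hM
  set κ := kappaBar ν α
  set κ' := kappaBreve M ν
  set φ := min (phiMin (SigmaVZBreve M ν)) (phiMin (SigmaZZBreve M ν))
  have hφ : 0 < φ := lt_min (hA.phiMin_breve_vz_pos hM) (hA.phiMin_breve_zz_pos hM)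
  have hφ1 : φ ≤ phiMin (SigmaVZBreve M ν) := min_le_left _ _
  have hφ2 : φ ≤ phiMin (SigmaZZBreve M ν) := min_le_right _ _
  have hη1 : η ≤ 1 / 10 * phiMin (SigmaVZStar ν α) :=
    hC.eta_le.trans (mul_le_mul_of_nonneg_left (min_le_left _ _) (by norm_num))
  have hη2 : η ≤ 1 / 10 * phiMin (SigmaZZ ν) :=
    hC.eta_le.trans (mul_le_mul_of_nonneg_left (min_le_right _ _) (by norm_num))
  obtain ⟨hC1a, hC1b⟩ := max_le_iff.1 hC.le_C₁
  obtain ⟨hC2a, hC2bc⟩ := max_le_iff.1 hC.le_C₂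
  obtain ⟨hC2b, hC2c⟩ := max_le_iff.1 hC2bc
  have hpq : √(p * q : ℝ) ^ 2 = p * q := Real.sq_sqrt (by positivity)
  have hMpq : √(M * p * q : ℝ) ^ 2 = M * p * q := Real.sq_sqrt (by positivity)
  have hsp : √(p : ℝ) ^ 2 = p := Real.sq_sqrt hp.le
  have hsq : √(q : ℝ) ^ 2 = q := Real.sq_sqrt hq.le
  have hMpq0 : 0 < √(M * p * q : ℝ) := by positivity
  have hsq0 : 0 < √(q : ℝ) := by positivity
  set x := targetError M p q vbar zbar L η with hx
  have hx0 : 0 < x := by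
    rw [hx, targetError]
    positivity
  have hx2 : x ^ 2 = η ^ 2 / (25 * M ^ 3 * L ^ 2 * p ^ 2 * q * vbar ^ 4 * zbar ^ 2) := by
    rw [hx, targetError, div_pow]
    congr 1
    calc (5 * M * L * √p * vbar ^ 2 * zbar * √(M * p * q)) ^ 2
        = 25 * M ^ 2 * L ^ 2 * √(p : ℝ) ^ 2 * vbar ^ 4 * zbar ^ 2 * √(M * p * q : ℝ) ^ 2 := by ring
      _ = _ := by rw [hsp, hMpq]; ring
  -- the two lower bounds for `C₁` that come from the first maximum
  have hC1v : 1600 * M ^ 2 * (p * q * vbar ^ 2 * zbar ^ 2) / φ ^ 2 ≤ C₁ := by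
    refine le_trans (le_of_eq ?_) (le_trans (pow_le_pow_left₀ (by positivity)
      (div_le_div_of_nonneg_right (mul_le_mul_of_nonneg_left
        (le_max_left (√(p * q) * vbar * zbar) (q * zbar ^ 2)) (by positivity)) hφ.le) 2) hC1a)
    rw [div_pow]
    congr 1
    calc 1600 * M ^ 2 * (p * q * vbar ^ 2 * zbar ^ 2)
        = 1600 * M ^ 2 * (√(p * q : ℝ) ^ 2 * vbar ^ 2 * zbar ^ 2) := by rw [hpq]
      _ = _ := by ring
  have hC1z : 1600 * M ^ 2 * (q * zbar ^ 2) ^ 2 / φ ^ 2 ≤ C₁ := by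
    refine le_trans (le_of_eq ?_) (le_trans (pow_le_pow_left₀ (by positivity)
      (div_le_div_of_nonneg_right (mul_le_mul_of_nonneg_left
        (le_max_right (√(p * q) * vbar * zbar) (q * zbar ^ 2)) (by positivity)) hφ.le) 2) hC1a)
    rw [div_pow]
    ring
  have hCA : 4 * q ^ 2 * zbar ^ 2 * ς ^ 2 * κ ^ 2 ≤ CA ^ 2 := by
    refine le_trans (le_of_eq ?_) (pow_le_pow_left₀ (by positivity) hC.le_CA 2)
    ring
  -- The error `12 / 10 · η` that is allowed in the joint cross moments is split into
  -- `2 / 5 · η` each for the sampling error, the frequency of near ties and their probability.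
  refine ⟨x, 2 / 5 * η / √(M * p * q), η / q, 2 / 5 * η / (vbar * zbar * √(M * p * q)),
    x / (κ * √q), φ / (10 * √(p * q)), φ / (10 * q), x / (κ' * √q), ?_, ?_, ?_, ?_, ?_, ?_, ?_, ?_⟩
  · refine ⟨hx0, by positivity, by positivity, by positivity, by positivity, by positivity,
      by positivity, by positivity, ?_, ?_, ?_, ?_, ?_, ?_⟩
    · have : √(p * q : ℝ) * (φ / (10 * √(p * q))) = φ / 10 := by field_simp
      rw [this]
      linarith
    · have : (q : ℝ) * (φ / (10 * q)) = φ / 10 := by field_simp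
      rw [this]
      linarith
    · exact (mul_sqrt_mul_div_cancel hκ' hsq0).le
    · have h1 : √(M * p * q : ℝ) * (2 / 5 * η / √(M * p * q)) = 2 / 5 * η :=
        mul_div_cancel₀ _ hMpq0.ne'
      have h2 : vbar * zbar * √(M * p * q : ℝ) * (2 / 5 * η / (vbar * zbar * √(M * p * q))) =
          2 / 5 * η := mul_div_cancel₀ _ (by positivity)
      have h3 : 5 * M * L * √p * vbar ^ 2 * zbar * √(M * p * q) * x = η :=
        mul_div_cancel₀ _ (by positivity)
      have h4 : 0 ≤ L * √p * vbar ^ 2 * zbar * √(M * p * q) * x := by positivity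
      linarith
    · have : (q : ℝ) * (η / q) = η := by field_simp
      rw [this]
      exact hη2
    · exact (mul_sqrt_mul_div_cancel hκ hsq0).le
  · refine le_trans ?_ (mul_le_mul_of_nonneg_right hC1v (sq_nonneg _))
    have : 1600 * M ^ 2 * (p * q * vbar ^ 2 * zbar ^ 2) / φ ^ 2 * (φ / (10 * √(p * q : ℝ))) ^ 2 =
        16 * M ^ 2 * (vbar * zbar) ^ 2 := by
      rw [div_pow, mul_pow, hpq]
      field_simp
      norm_num
    rw [this]
    exact mul_le_mul_of_nonneg_right (by linarith) (sq_nonneg _)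
  · refine le_trans ?_ (mul_le_mul_of_nonneg_right hC1z (sq_nonneg _))
    have : 1600 * M ^ 2 * (q * zbar ^ 2) ^ 2 / φ ^ 2 * (φ / (10 * q : ℝ)) ^ 2 =
        16 * M ^ 2 * (zbar ^ 2) ^ 2 := by
      field_simp
      norm_num
    rw [this]
    exact mul_le_mul_of_nonneg_right (by linarith) (sq_nonneg _)
  · refine le_trans ?_ (mul_le_mul_of_nonneg_right hC1b (sq_nonneg _))
    have : 1024 * M ^ 4 * p ^ 2 * q ^ 3 * vbar ^ 4 * zbar ^ 4 * ς ^ 2 * κ' ^ 2 * L ^ 2 / η ^ 2 *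
        (x / (κ' * √q)) ^ 2 = 1024 / 25 * (M * q) * (zbar ^ 2 * ς ^ 2) := by
      rw [div_pow, mul_pow, hsq, hx2]
      field_simp
    rw [this]
    exact mul_le_mul_of_nonneg_right (by linarith) (by positivity)
  · refine le_trans ?_ (mul_le_mul_of_nonneg_right hC2b (sq_nonneg _))
    have : 128 * (M - 1) ^ 2 * p * q * vbar ^ 2 * zbar ^ 2 / η ^ 2 *
        (2 / 5 * η / √(M * p * q)) ^ 2 = 512 / 25 * (M - 1) ^ 2 / M * (vbar * zbar) ^ 2 := by
      rw [div_pow, hMpq]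
      field_simp
      ring
    rw [this]
    refine mul_le_mul_of_nonneg_right ?_ (sq_nonneg _)
    rw [le_div_iff₀ hM0]
    linarith
  · refine le_trans (le_of_eq ?_) (mul_le_mul_of_nonneg_right hC2a (sq_nonneg _))
    field_simp
  · refine le_trans ?_ (mul_le_mul_of_nonneg_right hC2b (sq_nonneg _))
    have : 128 * (M - 1) ^ 2 * p * q * vbar ^ 2 * zbar ^ 2 / η ^ 2 *
        (2 / 5 * η / (vbar * zbar * √(M * p * q))) ^ 2 = 512 / 25 * (M - 1) ^ 2 / M := by
      rw [div_pow, mul_pow (vbar * zbar), hMpq]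
      field_simp
      ring
    rw [this, le_div_iff₀ hM0]
    linarith
  · refine le_trans ?_ (mul_le_mul_of_nonneg_right hC2c (sq_nonneg _))
    refine le_trans ?_ (mul_le_mul_of_nonneg_right (div_le_div_of_nonneg_right
      (mul_le_mul_of_nonneg_left hCA (by positivity)) (sq_nonneg η)) (sq_nonneg _))
    have : 256 * M ^ 2 * L ^ 2 * p ^ 2 * q * vbar ^ 4 * zbar ^ 2 *
        (4 * q ^ 2 * zbar ^ 2 * ς ^ 2 * κ ^ 2) / η ^ 2 * (x / (κ * √q)) ^ 2 =
        1024 / 25 * (q / M) * (zbar ^ 2 * ς ^ 2) := by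
      rw [div_pow, mul_pow κ, hsq, hx2]
      field_simp
      ring
    rw [this]
    refine mul_le_mul_of_nonneg_right ?_ (by positivity)
    have : (1 : ℝ) ≤ q / M := (one_le_div hM0).2 hMq
    linarith

/-- The length of the second phase forces the horizon to be large. -/
lemma sq_le_horizon (hM : 2 ≤ M) (hA : IVAssumption ν α ς σ vbar zbar L) {η CA C₁ C₂ : ℝ}
    (hC : LargeConstants ν α ς vbar zbar L η CA C₁ C₂) {T : ℕ} (hT2 : 2 ≤ T)
    (hT : phaseTwoEnd C₁ C₂ T < T) : 400 * (q : ℝ) ^ 2 ≤ T := by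
  have hη := hC.eta_pos
  have hz := hA.zbar_pos
  have hlog : (2 : ℝ) / 3 ≤ Real.log T := by
    have h1 : Real.log 2 ≤ Real.log T := Real.log_le_log (by norm_num) (by exact_mod_cast hT2)
    linarith [Real.log_two_gt_d9]
  -- `φ_min(Σ_zz) ≤ E[z₁²]` turns the bound on `η` into a numerical lower bound on `C₂`.
  have hηz : 10 * η ≤ zbar ^ 2 := by
    have h1 : η ≤ 1 / 10 * phiMin (SigmaZZ ν) :=
      hC.eta_le.trans (mul_le_mul_of_nonneg_left (min_le_right _ _) (by norm_num))
    linarith [hA.phiMin_zz_le hM]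
  have hC2 : 600 * (q : ℝ) ^ 2 ≤ C₂ := by
    refine le_trans ?_ (max_le_iff.1 hC.le_C₂).1
    rw [le_div_iff₀ (by positivity)]
    have h1 : (10 * η) ^ 2 ≤ (zbar ^ 2) ^ 2 := pow_le_pow_left₀ (by positivity) hηz 2
    nlinarith [mul_le_mul_of_nonneg_left h1 (sq_nonneg (q : ℝ))]
  have h2 : C₂ * Real.log T ≤ T := by
    have h3 : ⌈C₂ * Real.log T⌉₊ ≤ T := by
      unfold phaseTwoEnd at hT
      omega
    exact (Nat.le_ceil _).trans (by exact_mod_cast h3)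
  have h4 : 600 * (q : ℝ) ^ 2 * (2 / 3) ≤ C₂ * Real.log T :=
    mul_le_mul hC2 hlog (by norm_num) ((by positivity : (0 : ℝ) ≤ 600 * q ^ 2).trans hC2)
  linarith

/-- The probabilities of all the bad events, added up over the periods in which they are harmful,
contribute at most one period. -/
lemma horizon_mul_failure_le {T : ℕ} (hM : 1 ≤ M) (hMpq : M * p ≤ q) (hMq : M ≤ q) (hpq : p ≤ q)
    (hT : 400 * (q : ℝ) ^ 2 ≤ T) :
    (T : ℝ) * (M * ((p * q + q ^ 2 + q) * (2 * Real.exp (-(3 * Real.log T)))) +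
      T * ((M * p * q + q ^ 2 + M + q) * (2 * Real.exp (-(3 * Real.log T))))) ≤ 1 := by
  have h1 : (M : ℝ) * p ≤ q := by exact_mod_cast hMpq
  have h2 : (M : ℝ) ≤ q := by exact_mod_cast hMq
  have h3 : (p : ℝ) ≤ q := by exact_mod_cast hpq
  have hq1 : (1 : ℝ) ≤ q := by exact_mod_cast hM.trans hMq
  have hp0 : (0 : ℝ) ≤ p := Nat.cast_nonneg p
  have hM0 : (0 : ℝ) ≤ M := Nat.cast_nonneg M
  have hT0 : (0 : ℝ) < T := by nlinarith
  have hexp : Real.exp (-(3 * Real.log T)) = ((T : ℝ) ^ 3)⁻¹ := by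
    rw [Real.exp_neg, mul_comm, Real.exp_mul, Real.exp_log hT0]
    norm_cast
  have hqq : (q : ℝ) ≤ q ^ 2 := by nlinarith
  have ha : (p * q + q ^ 2 + q : ℝ) ≤ 3 * q ^ 2 := by nlinarith
  have hb : (M * p * q + q ^ 2 + M + q : ℝ) ≤ 4 * q ^ 2 := by nlinarith
  have hMa : (M : ℝ) * (p * q + q ^ 2 + q) ≤ 3 * (q ^ 2) ^ 2 := by
    have h4 : (M : ℝ) ≤ q ^ 2 := h2.trans hqq
    calc (M : ℝ) * (p * q + q ^ 2 + q) ≤ q ^ 2 * (3 * q ^ 2) :=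
          mul_le_mul h4 ha (by positivity) (by positivity)
      _ = _ := by ring
  rw [hexp]
  have heq : (T : ℝ) * (M * ((p * q + q ^ 2 + q) * (2 * ((T : ℝ) ^ 3)⁻¹)) +
      T * ((M * p * q + q ^ 2 + M + q) * (2 * ((T : ℝ) ^ 3)⁻¹))) =
      (2 * (M * (p * q + q ^ 2 + q)) + 2 * (M * p * q + q ^ 2 + M + q) * T) / T ^ 2 := by
    field_simp
  rw [heq, div_le_one (by positivity)]
  have hQ : (q : ℝ) ^ 2 ≤ T / 400 := by linarith
  have hQ2 : ((q : ℝ) ^ 2) ^ 2 ≤ (T / 400) ^ 2 := pow_le_pow_left₀ (by positivity) hQ 2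
  nlinarith [mul_le_mul_of_nonneg_right hb hT0.le, mul_le_mul_of_nonneg_right hQ hT0.le]

end Constants

/-! ### The regret bound -/

section Main

variable {p q M : ℕ} {α : Fin M → Fin p → ℝ} {ν : Measure (Obs p q)} [IsProbabilityMeasure ν]
  {ς : ℝ≥0} {σ vbar zbar L : ℝ} {Ω : Type*} [MeasurableSpace Ω] {μ : Measure Ω}
  [IsProbabilityMeasure μ] {D : ℕ → Ω → Obs p q} {a : ℕ → Ω → Fin M}

/-- The constant terms needed here are the `3` periods lost to rounding and to the first greedy
choice, and at most `1` period for all the failures, well below the allowance in the statement. -/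
lemma regret_le_of_largeConstants (hM : 2 ≤ M) (hA : IVAssumption ν α ς σ vbar zbar L)
    {η CA C₁ C₂ : ℝ} (hC : LargeConstants ν α ς vbar zbar L η CA C₁ C₂) {T : ℕ}
    (hT : phaseTwoEnd C₁ C₂ T < T)
    (hrun : IsIVGreedyRun μ ν α (phaseOneEnd C₁ T) (phaseTwoEnd C₁ C₂ T) T D a) :
    regret μ α T D a ≤
      (√p * vbar * deltaBar α * (C₁ + C₂) + 16 * (M - 1) * L * p * q ^ 3 * vbar ^ 2 * zbar ^ 2
        * ς ^ 2 * kappaBar ν α ^ 2) * Real.log T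
      + √p * vbar * deltaBar α * (M - 1) * (12 * M * p + (20 * M + 24) * q + 7) := by
  have hM2 : (2 : ℝ) ≤ M := by exact_mod_cast hM
  have hMq : (M : ℝ) ≤ q := by exact_mod_cast hA.le_q hM
  have hp0 : (0 : ℝ) ≤ p := Nat.cast_nonneg p
  have hv := hA.vbar_pos
  have hz := hA.zbar_pos
  have hL := hA.L_pos
  have hκ := hA.kappaBar_pos hM
  have hΔ : 0 ≤ √p * vbar * deltaBar α := by
    have := deltaBar_nonneg (α := α)
    positivity
  have hconst : √p * vbar * deltaBar α * 7 ≤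
      √p * vbar * deltaBar α * (M - 1) * (12 * M * p + (20 * M + 24) * q + 7) := by
    rw [mul_assoc _ ((M : ℝ) - 1)]
    refine mul_le_mul_of_nonneg_left ?_ hΔ
    have h1 : (7 : ℝ) ≤ 12 * M * p + (20 * M + 24) * q + 7 := by
      have : (0 : ℝ) ≤ 12 * M * p + (20 * M + 24) * q := by positivity
      linarith
    nlinarith
  obtain hT1 | hT2 : T = 1 ∨ 2 ≤ T := by omega
  · subst hT1
    have h1 := hrun.regret_le_card_mul hA
    simp only [Nat.cast_one, one_mul, Real.log_one, mul_zero, zero_add] at h1 ⊢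
    linarith
  have hlarge := sq_le_horizon hM hA hC hT2 hT
  have hT0 : (0 : ℝ) < T := by positivity
  have hlog1 : 1 ≤ Real.log T := by
    rw [Real.le_log_iff_exp_le hT0]
    nlinarith [Real.exp_one_lt_d9]
  obtain ⟨x, yA, yB, yT, yN, uA, uB, uN, htol, h1, h2, h3, h4, h5, h6, h7⟩ :=
    exists_tolerances hM hA hC
  set ℓ := Real.log T with hℓ
  have hℓ0 : 0 < ℓ := by linarith
  have hC1 : 0 < C₁ := by
    have : 0 < C₁ * uA ^ 2 := lt_of_lt_of_le (by positivity) h1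
    exact pos_of_mul_pos_left this (sq_nonneg _)
  have hC2 : 0 < C₂ := by
    have : 0 < C₂ * yA ^ 2 := lt_of_lt_of_le (by positivity) h4
    exact pos_of_mul_pos_left this (sq_nonneg _)
  have hT₁ : C₁ * ℓ ≤ (phaseOneEnd C₁ T : ℝ) := Nat.le_ceil _
  have hsub : phaseTwoEnd C₁ C₂ T - phaseOneEnd C₁ T = ⌈C₂ * ℓ⌉₊ := by
    simp [phaseTwoEnd, phaseOneEnd, hℓ]
  have hT₂ : C₂ * ℓ ≤ ((phaseTwoEnd C₁ C₂ T - phaseOneEnd C₁ T : ℕ) : ℝ) := by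
    rw [hsub]
    exact Nat.le_ceil _
  have scale : ∀ {u C y n : ℝ}, u ≤ C * y ^ 2 → C * ℓ ≤ n → u * ℓ ≤ n * y ^ 2 := by
    intro u C y n huC hn
    calc u * ℓ ≤ C * y ^ 2 * ℓ := mul_le_mul_of_nonneg_right huC hℓ0.le
      _ = C * ℓ * y ^ 2 := by ring
      _ ≤ n * y ^ 2 := mul_le_mul_of_nonneg_right hn (sq_nonneg _)
  have hT₁pos : 0 < phaseOneEnd C₁ T := Nat.ceil_pos.2 (by positivity)
  have hmain := hrun.regret_le_of_tolerances (Λ := 3 * ℓ) hM hA htol hT₁pos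
    (by simp [phaseTwoEnd, phaseOneEnd]) hT
    (by linarith [scale h1 hT₁]) (by linarith [scale h2 hT₁]) (by linarith [scale h3 hT₁])
    (by linarith [scale h4 hT₂]) (by linarith [scale h5 hT₂]) (by linarith [scale h6 hT₂])
    (by linarith [scale h7 hT₂])
  refine hmain.trans ?_
  have hfail := horizon_mul_failure_le (by omega) hA.enough_instruments (hA.le_q hM)
    (hA.p_le_q hM) hlarge
  rw [← hℓ] at hfail
  have hend : (phaseTwoEnd C₁ C₂ T : ℝ) ≤ (C₁ + C₂) * ℓ + 2 := by
    have e1 := (Nat.ceil_lt_add_one (by positivity : 0 ≤ C₁ * ℓ)).le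
    have e2 := (Nat.ceil_lt_add_one (by positivity : 0 ≤ C₂ * ℓ)).le
    simp only [phaseTwoEnd, Nat.cast_add]
    linarith
  have hpart1 := mul_le_mul_of_nonneg_left (add_le_add (add_le_add hend (le_refl (1 : ℝ))) hfail) hΔ
  have hcoef : (M : ℝ) ^ 2 * (1 + ℓ) ≤ 2 * ((M - 1) * q ^ 2) * ℓ := by
    have e1 : (M : ℝ) ^ 2 ≤ (M - 1) * q ^ 2 := by nlinarith
    have e2 : 0 ≤ ((M : ℝ) - 1) * q ^ 2 := (sq_nonneg _).trans e1
    calc (M : ℝ) ^ 2 * (1 + ℓ) ≤ ((M - 1) * q ^ 2) * (2 * ℓ) :=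
          mul_le_mul e1 (by linarith) (by linarith) e2
      _ = _ := by ring
  have hpart2 : 8 * M ^ 2 * L * p * q * vbar ^ 2 * zbar ^ 2 * ς ^ 2 * kappaBar ν α ^ 2 * (1 + ℓ) ≤
      16 * (M - 1) * L * p * q ^ 3 * vbar ^ 2 * zbar ^ 2 * ς ^ 2 * kappaBar ν α ^ 2 * ℓ := by
    have h := mul_le_mul_of_nonneg_left hcoef
      (by positivity : 0 ≤ 8 * L * p * q * vbar ^ 2 * zbar ^ 2 * ς ^ 2 * kappaBar ν α ^ 2)
    linarith
  linarith

/-- The largest admissible `η` and the smallest admissible `C_A` give thresholds for the phase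
lengths that depend only on the law of the triples and the coefficients. -/
lemma exists_eta (hM : 2 ≤ M) (hA : IVAssumption ν α ς σ vbar zbar L) :
    ∃ η CA c₁ c₂ : ℝ, 0 < c₁ ∧ 0 < c₂ ∧ ∀ C₁ C₂, c₁ ≤ C₁ → c₂ ≤ C₂ →
      LargeConstants ν α ς vbar zbar L η CA C₁ C₂ := by
  refine ⟨1 / 10 * min (phiMin (SigmaVZStar ν α)) (phiMin (SigmaZZ ν)),
    2 * q * zbar * ς * kappaBar ν α, max 1 _, max 1 _, lt_max_of_lt_left one_pos,
    lt_max_of_lt_left one_pos, fun C₁ C₂ h1 h2 =>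
    ⟨?_, le_rfl, le_rfl, (max_le_iff.1 h1).2, (max_le_iff.1 h2).2⟩⟩
  have := lt_min (hA.phiMin_star_pos hM) (hA.phiMin_zz_pos hM)
  positivity

end Main

end

end IVBandit

theorem theorem1 {p q M : ℕ} (hM : 2 ≤ M) (α : Fin M → Fin p → ℝ)
    (ν : Measure (IVBandit.Obs p q)) [IsProbabilityMeasure ν]
    (ς : ℝ≥0) (σ vbar zbar L : ℝ)
    (hA : IVBandit.IVAssumption ν α ς σ vbar zbar L) :
    (∃ c₁ c₂ : ℝ, 0 < c₁ ∧ 0 < c₂ ∧ ∀ C₁ C₂ : ℝ, c₁ ≤ C₁ → c₂ ≤ C₂ →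
      ∃ K : ℝ, ∀ T : ℕ, 2 ≤ T → IVBandit.phaseTwoEnd C₁ C₂ T < T →
        ∀ (Ω : Type*) [MeasurableSpace Ω] (μ : Measure Ω) [IsProbabilityMeasure μ]
          (D : ℕ → Ω → IVBandit.Obs p q) (a : ℕ → Ω → Fin M),
          IVBandit.IsIVGreedyRun μ ν α (IVBandit.phaseOneEnd C₁ T)
            (IVBandit.phaseTwoEnd C₁ C₂ T) T D a →
          |IVBandit.regret μ α T D a| ≤ K * Real.log T) ∧
    (∀ η CA C₁ C₂ : ℝ, IVBandit.LargeConstants ν α ς vbar zbar L η CA C₁ C₂ →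
      ∀ T : ℕ, IVBandit.phaseTwoEnd C₁ C₂ T < T →
        ∀ (Ω : Type*) [MeasurableSpace Ω] (μ : Measure Ω) [IsProbabilityMeasure μ]
          (D : ℕ → Ω → IVBandit.Obs p q) (a : ℕ → Ω → Fin M),
          IVBandit.IsIVGreedyRun μ ν α (IVBandit.phaseOneEnd C₁ T)
            (IVBandit.phaseTwoEnd C₁ C₂ T) T D a →
          IVBandit.regret μ α T D a ≤
            (√p * vbar * IVBandit.deltaBar α * (C₁ + C₂)
                + 16 * (M - 1) * L * p * q ^ 3 * vbar ^ 2 * zbar ^ 2 * ς ^ 2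
                  * IVBandit.kappaBar ν α ^ 2) * Real.log T
              + √p * vbar * IVBandit.deltaBar α * (M - 1)
                * (12 * M * p + (20 * M + 24) * q + 7)) := by
  refine ⟨?_, fun η CA C₁ C₂ hC T hT Ω _ μ _ D a hrun =>
    IVBandit.regret_le_of_largeConstants hM hA hC hT hrun⟩
  obtain ⟨η, CA, c₁, c₂, hc₁, hc₂, hlarge⟩ := IVBandit.exists_eta hM hA
  refine ⟨c₁, c₂, hc₁, hc₂, fun C₁ C₂ h₁ h₂ => ?_⟩
  have hpos : 0 ≤ √p * vbar * IVBandit.deltaBar α * (M - 1) *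
      (12 * M * p + (20 * M + 24) * q + 7) := by
    have h1 : (0 : ℝ) ≤ M - 1 := by
      have : (2 : ℝ) ≤ M := by exact_mod_cast hM
      linarith
    have h2 := IVBandit.deltaBar_nonneg (α := α)
    have h3 := hA.vbar_pos
    positivity
  set A : ℝ := √p * vbar * IVBandit.deltaBar α * (C₁ + C₂) + 16 * (M - 1) * L * p * q ^ 3 *
    vbar ^ 2 * zbar ^ 2 * ς ^ 2 * IVBandit.kappaBar ν α ^ 2
  set B : ℝ := √p * vbar * IVBandit.deltaBar α * (M - 1) * (12 * M * p + (20 * M + 24) * q + 7)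
  -- The constant term is absorbed through `log T ≥ log 2 > 1 / 2`.
  refine ⟨A + 2 * B, fun T hT2 hT Ω _ μ _ D a hrun => ?_⟩
  rw [abs_of_nonneg IVBandit.regret_nonneg]
  refine (IVBandit.regret_le_of_largeConstants hM hA (hlarge C₁ C₂ h₁ h₂) hT hrun).trans ?_
  have hlog : (1 : ℝ) / 2 ≤ Real.log T := by
    have h1 : Real.log 2 ≤ Real.log T := Real.log_le_log (by norm_num) (by exact_mod_cast hT2)
    linarith [Real.log_two_gt_d9]
  nlinarith [mul_le_mul_of_nonneg_left hlog hpos]
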